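/- A graph is $k$-degenerate if its vertices can be ordered so that every vertex has at most $k$ neighbours occurring later in the ordering. A vertex set $S$ dominates $G$ if every vertex is in $S$ or adjacent to a vertex of $S$. A dynamic dominance structure for $G$ with operation time $t$ maintains a set $S\subseteq V(G)$, initially empty, under insertions and deletions of vertices, and tests whether $S$ dominates $G$; every insertion, deletion and test takes at least one and at most $t$ steps. For an ordering of $V(G)$ and an independent set $I$, the lexicographically first maximal independent superset of $I$ is obtained by considering the vertices in order and adding each vertex that has no neighbour in the set built so far; $\mathrm{LFMIS}$ is the one for $I=\emptyset$. For a maximal independent set $S\ne\mathrm{LFMIS}$ let $v$ be the earliest vertex of $\mathrm{LFMIS}\setminus S$ and $N=N(v)\cap S$; the parent of $S$ is the lexicographically first maximal independent superset of $(S\cup\{v\})\setminus N$. Reverse search is a depth-first traversal, starting at $\mathrm{LFMIS}$, of the tree that this parent relation forms. **Theorem.** There is an algorithm on a word RAM (words of $O(\log n)$ bits, unit-cost operations) with the following property. For every $k$ there are a constant $C$ and a polynomial $p$, depending only on $k$, such that for every function $T:\mathbb N\to\mathbb N$ and every $k$-degenerate graph $G$ with $n$ vertices, given by adjacency lists (read-only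 input) together with a dynamic dominance structure for $G$ with operation time $T(n)$, the algorithm terminates after having output every maximal independent set of $G$ exactly once and nothing else. The sets are output in the order in which they are visited by reverse search, for some ordering of $V(G)$. The total time is at most $C\,(n+1)\,T(n)$ times the number of maximal independent sets, that is, $O(n\,T(n))$ per generated set. The time before the first output, between two consecutive outputs, and between the last output and termination is at most $p(n)\,T(n)$ (so the delay is polynomial whenever $T$ is polynomially bounded). Besides the single given instance of the dominance structure, the algorithm uses at most $C\,(n+1)=O(n)$ memory words, each holding a number less than $(n+2)^C$. -/

import Mathlib

namespace MISListing

/-! ### Graph-theoretic notions -/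

/-- `S` is a maximal independent set of `G`. -/
def IsMIS {V : Type} (G : SimpleGraph V) (S : Finset V) : Prop :=
  Maximal (fun I : Finset V => G.IsIndepSet (I : Set V)) S

/-- `S` dominates `G`: every vertex is in `S` or adjacent to a member of `S`. -/
def Dominates {V : Type} (G : SimpleGraph V) (S : Finset V) : Prop :=
  ∀ v, v ∈ S ∨ ∃ u ∈ S, G.Adj u v

/-- A sequential ordering of the vertices `0, …, n-1`; `ord i` is the vertex in position `i`. -/
abbrev VertexOrder (n : ℕ) : Type := Equiv.Perm (Fin n)

/-- `G` is `k`-degenerate: its vertices can be ordered so that every vertex has at most `k`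
neighbours that occur later in the ordering. -/
def IsDegenerate {n : ℕ} (G : SimpleGraph (Fin n)) (k : ℕ) : Prop :=
  ∃ ord : VertexOrder n, ∀ v, {w | G.Adj v w ∧ ord.symm v < ord.symm w}.ncard ≤ k

/-! ### The parent operation and reverse search -/

open Classical in
/-- The lexicographically first maximal independent superset of the independent set `I`: consider
the vertices in order, and add each vertex that has no neighbour among the vertices present. -/
noncomputable def lexFirstSuperset {n : ℕ} (G : SimpleGraph (Fin n)) (ord : VertexOrder n)
    (I : Finset (Fin n)) : Finset (Fin n) :=
  (List.ofFn ord).foldl (fun S v => if ∀ u ∈ S, ¬ G.Adj u v then insert v S else S) I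

/-- The lexicographically first maximal independent set. -/
noncomputable def lfmis {n : ℕ} (G : SimpleGraph (Fin n)) (ord : VertexOrder n) :
    Finset (Fin n) :=
  lexFirstSuperset G ord ∅

open Classical in
/-- The parent of `S`: if `v` is the earliest vertex of `lfmis \ S` and `N = N(v) ∩ S`, it is the
lexicographically first maximal independent superset of `(S ∪ {v}) \ N`.  (If there is no such `v`,
then `S` is the root, and we return `S` itself.) -/
noncomputable def parent {n : ℕ} (G : SimpleGraph (Fin n)) (ord : VertexOrder n)
    (S : Finset (Fin n)) : Finset (Fin n) :=
  match (List.ofFn ord).find? (fun v => decide (v ∈ lfmis G ord ∧ v ∉ S)) with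
  | none => S
  | some v => lexFirstSuperset G ord (insert v S \ S.filter (fun u => G.Adj v u))

/-- `T` is a child of `S` in the reverse search tree. -/
def IsChild {n : ℕ} (G : SimpleGraph (Fin n)) (ord : VertexOrder n)
    (T S : Finset (Fin n)) : Prop :=
  IsMIS G T ∧ T ≠ lfmis G ord ∧ parent G ord T = S

/-- `ForestPreorder child rs L`: `L` lists, in depth-first preorder, the trees rooted at the
members of `rs`, one tree after the other, where `child y x` says that `y` is a child of `x`.
The children of a node may be visited in any order, each of them exactly once. -/
inductive ForestPreorder {α : Type} (child : α → α → Prop) : List α → List α → Prop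
  | nil : ForestPreorder child [] []
  | cons {x : α} {rs cs L₁ L₂ : List α} (hnodup : cs.Nodup) (hcs : ∀ y, y ∈ cs ↔ child y x)
      (h₁ : ForestPreorder child cs L₁) (h₂ : ForestPreorder child rs L₂) :
      ForestPreorder child (x :: rs) (x :: (L₁ ++ L₂))

/-- `L` is the sequence of sets visited by reverse search, that is, by a depth-first traversal
of the tree of the parent operation, from its root `lfmis`. -/
def IsReverseSearch {n : ℕ} (G : SimpleGraph (Fin n)) (ord : VertexOrder n)
    (L : List (Finset (Fin n))) : Prop :=
  ForestPreorder (IsChild G ord) [lfmis G ord] L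

/-! ### Input: adjacency lists and a dynamic dominance structure -/

/-- A representation of `G` by adjacency lists, each list in an arbitrary order. -/
structure AdjLists {n : ℕ} (G : SimpleGraph (Fin n)) where
  nbrs : Fin n → List (Fin n)
  nodup : ∀ v, (nbrs v).Nodup
  mem_iff : ∀ v w, w ∈ nbrs v ↔ G.Adj v w

/-- A dynamic dominance data structure for `G`.  It maintains a set of vertices, initially empty,
under insertions (of non-members) and deletions (of members), and it can be asked whether the
current set dominates `G`.  Each operation takes a number of steps, at least one, that may depend
on the operation and on the current state. -/
structure DominanceStructure {n : ℕ} (G : SimpleGraph (Fin n)) where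
  /-- the possible states of the data structure -/
  State : Type
  /-- the set that a state represents -/
  toSet : State → Finset (Fin n)
  init : State
  insert : Fin n → State → State
  delete : Fin n → State → State
  test : State → Bool
  insertCost : Fin n → State → ℕ
  deleteCost : Fin n → State → ℕ
  testCost : State → ℕ
  toSet_init : toSet init = ∅
  toSet_insert : ∀ v s, v ∉ toSet s → toSet (insert v s) = Insert.insert v (toSet s)
  toSet_delete : ∀ v s, v ∈ toSet s → toSet (delete v s) = (toSet s).erase v
  test_iff : ∀ s, test s = true ↔ Dominates G (toSet s)
  insertCost_pos : ∀ v s, 1 ≤ insertCost v s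
  deleteCost_pos : ∀ v s, 1 ≤ deleteCost v s
  testCost_pos : ∀ s, 1 ≤ testCost s

/-- Every insertion of a non-member, every deletion of a member, and every dominance test takes
at most `t` steps. -/
def DominanceStructure.RunsInTime {n : ℕ} {G : SimpleGraph (Fin n)}
    (D : DominanceStructure G) (t : ℕ) : Prop :=
  (∀ v s, v ∉ D.toSet s → D.insertCost v s ≤ t) ∧
  (∀ v s, v ∈ D.toSet s → D.deleteCost v s ≤ t) ∧
  (∀ s, D.testCost s ≤ t)

/-! ### The machine model

A word RAM, programmed in a structured language.  It has a memory of cells that hold natural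
numbers, read-only access to the adjacency lists of the input graph, one instance of a dynamic
dominance structure, which it can only use through the three operations, and a write-only output
stream. -/

/-- Binary operations on words; the comparisons return `0` or `1`. -/
inductive BinOp
  | add | sub | mul | div | mod | lt | eq

def BinOp.apply : BinOp → ℕ → ℕ → ℕ
  | .add, a, b => a + b
  | .sub, a, b => a - b
  | .mul, a, b => a * b
  | .div, a, b => a / b
  | .mod, a, b => a % b
  | .lt, a, b => if a < b then 1 else 0
  | .eq, a, b => if a = b then 1 else 0

/-- Expressions. -/
inductive Expr
  /-- a constant -/
  | lit (c : ℕ)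
  /-- the content of the memory cell with address `a` -/
  | load (a : Expr)
  | op (o : BinOp) (a b : Expr)
  /-- the number of vertices of the input graph -/
  | size
  /-- the length of the adjacency list of the vertex `v` -/
  | deg (v : Expr)
  /-- the entry with index `i` (from `0`) of the adjacency list of the vertex `v` -/
  | nbr (v i : Expr)

/-- Evaluating an expression takes one step for each node of the expression. -/
def Expr.cost : Expr → ℕ
  | .lit _ => 1
  | .load a => a.cost + 1
  | .op _ a b => a.cost + b.cost + 1
  | .size => 1
  | .deg v => v.cost + 1
  | .nbr v i => v.cost + i.cost + 1

/-- The value of an expression (only used for expressions that are `Safe`). -/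
def Expr.val {n : ℕ} {G : SimpleGraph (Fin n)} (A : AdjLists G) (mem : ℕ → ℕ) : Expr → ℕ
  | .lit c => c
  | .load a => mem (a.val A mem)
  | .op o a b => o.apply (a.val A mem) (b.val A mem)
  | .size => n
  | .deg v => if h : v.val A mem < n then (A.nbrs ⟨v.val A mem, h⟩).length else 0
  | .nbr v i =>
      if h : v.val A mem < n then
        if hi : i.val A mem < (A.nbrs ⟨v.val A mem, h⟩).length then
          ((A.nbrs ⟨v.val A mem, h⟩).get ⟨i.val A mem, hi⟩ : Fin n)
        else 0
      else 0

/-- The expression can be evaluated on a machine with `M` memory cells and with words that hold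
numbers less than `W`: addresses are less than `M`, all intermediate values are less than `W`,
and the input graph is only accessed at existing vertices and list entries. -/
def Expr.Safe {n : ℕ} {G : SimpleGraph (Fin n)} (A : AdjLists G) (M W : ℕ) (mem : ℕ → ℕ) :
    Expr → Prop
  | .lit c => c < W
  | .load a => a.Safe A M W mem ∧ a.val A mem < M ∧ mem (a.val A mem) < W
  | .op o a b => a.Safe A M W mem ∧ b.Safe A M W mem ∧ o.apply (a.val A mem) (b.val A mem) < W
  | .size => n < W
  | .deg v => v.Safe A M W mem ∧ v.val A mem < n ∧ (Expr.deg v).val A mem < W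
  | .nbr v i => v.Safe A M W mem ∧ i.Safe A M W mem ∧ v.val A mem < n ∧
      i.val A mem < (Expr.deg v).val A mem ∧ (Expr.nbr v i).val A mem < W

/-- Programs. -/
inductive Prog
  | skip
  /-- write the value of `e` into the memory cell with address `a` -/
  | store (a e : Expr)
  | seq (p q : Prog)
  /-- execute `p` if the value of `e` is nonzero, and `q` otherwise -/
  | ite (e : Expr) (p q : Prog)
  /-- repeat `p` as long as the value of `e` is nonzero -/
  | loop (e : Expr) (p : Prog)
  /-- insert the vertex `e` into the set maintained by the dominance structure -/
  | insert (e : Expr)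
  /-- delete the vertex `e` from the set maintained by the dominance structure -/
  | delete (e : Expr)
  /-- ask the dominance structure, and write the answer, `1` or `0`, into the cell `a` -/
  | test (a : Expr)
  /-- append the vertex `e` to the set that is being output -/
  | emit (e : Expr)
  /-- complete the set that is being output -/
  | endSet

/-- Configurations of the machine; `σ` is the type of states of the dominance structure. -/
structure Config (n : ℕ) (σ : Type) where
  mem : ℕ → ℕ
  dom : σ
  /-- the vertices of the set that is being output -/
  cur : List (Fin n)
  /-- the completed outputs so far, each with the time of its completion -/
  out : List (List (Fin n) × ℕ)
  /-- the number of steps so far -/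
  time : ℕ

/-- The initial configuration. -/
def Config.start {n : ℕ} {G : SimpleGraph (Fin n)} (D : DominanceStructure G) :
    Config n D.State where
  mem := fun _ => 0
  dom := D.init
  cur := []
  out := []
  time := 0

/-- `Exec A D M W p c c'`: on a machine with `M` memory cells and with words that hold numbers
less than `W`, the program `p`, started in `c`, terminates without an error in `c'`. -/
inductive Exec {n : ℕ} {G : SimpleGraph (Fin n)} (A : AdjLists G) (D : DominanceStructure G)
    (M W : ℕ) : Prog → Config n D.State → Config n D.State → Prop
  | skip (c) : Exec A D M W .skip c { c with time := c.time + 1 }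
  | store (a e : Expr) (c)
      (ha : a.Safe A M W c.mem) (haM : a.val A c.mem < M) (he : e.Safe A M W c.mem) :
      Exec A D M W (.store a e) c
        { c with
          mem := Function.update c.mem (a.val A c.mem) (e.val A c.mem)
          time := c.time + a.cost + e.cost + 1 }
  | seq (p q : Prog) (c c₁ c₂) (h₁ : Exec A D M W p c c₁) (h₂ : Exec A D M W q c₁ c₂) :
      Exec A D M W (.seq p q) c c₂
  | ite_true (e : Expr) (p q : Prog) (c c') (he : e.Safe A M W c.mem) (h : e.val A c.mem ≠ 0)
      (hp : Exec A D M W p { c with time := c.time + e.cost + 1 } c') :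
      Exec A D M W (.ite e p q) c c'
  | ite_false (e : Expr) (p q : Prog) (c c') (he : e.Safe A M W c.mem) (h : e.val A c.mem = 0)
      (hq : Exec A D M W q { c with time := c.time + e.cost + 1 } c') :
      Exec A D M W (.ite e p q) c c'
  | loop_true (e : Expr) (p : Prog) (c c₁ c₂) (he : e.Safe A M W c.mem)
      (h : e.val A c.mem ≠ 0)
      (hp : Exec A D M W p { c with time := c.time + e.cost + 1 } c₁)
      (hl : Exec A D M W (.loop e p) c₁ c₂) :
      Exec A D M W (.loop e p) c c₂
  | loop_false (e : Expr) (p : Prog) (c) (he : e.Safe A M W c.mem) (h : e.val A c.mem = 0) :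
      Exec A D M W (.loop e p) c { c with time := c.time + e.cost + 1 }
  | insert (e : Expr) (c) (he : e.Safe A M W c.mem) (hv : e.val A c.mem < n) :
      Exec A D M W (.insert e) c
        { c with
          dom := D.insert ⟨e.val A c.mem, hv⟩ c.dom
          time := c.time + e.cost + D.insertCost ⟨e.val A c.mem, hv⟩ c.dom }
  | delete (e : Expr) (c) (he : e.Safe A M W c.mem) (hv : e.val A c.mem < n) :
      Exec A D M W (.delete e) c
        { c with
          dom := D.delete ⟨e.val A c.mem, hv⟩ c.dom
          time := c.time + e.cost + D.deleteCost ⟨e.val A c.mem, hv⟩ c.dom }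
  | test (a : Expr) (c) (ha : a.Safe A M W c.mem) (haM : a.val A c.mem < M) (hW : 1 < W) :
      Exec A D M W (.test a) c
        { c with
          mem := Function.update c.mem (a.val A c.mem) (if D.test c.dom = true then 1 else 0)
          time := c.time + a.cost + D.testCost c.dom }
  | emit (e : Expr) (c) (he : e.Safe A M W c.mem) (hv : e.val A c.mem < n) :
      Exec A D M W (.emit e) c
        { c with
          cur := c.cur ++ [⟨e.val A c.mem, hv⟩]
          time := c.time + e.cost + 1 }
  | endSet (c) :
      Exec A D M W .endSet c
        { c with
          cur := []
          out := c.out ++ [(c.cur, c.time + 1)]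
          time := c.time + 1 }

/-- The sequence of sets that have been output. -/
def Config.sets {n : ℕ} {σ : Type} (c : Config n σ) : List (Finset (Fin n)) :=
  c.out.map (fun r => r.1.toFinset)

/-- At most `d` steps pass from the start to the first output, between any two consecutive
outputs, and from the last output to the end (of a run that ends in the configuration `c`). -/
def Config.HasDelay {n : ℕ} {σ : Type} (c : Config n σ) (d : ℕ) : Prop :=
  (0 :: (c.out.map Prod.snd ++ [c.time])).IsChain (fun t t' => t' ≤ t + d)

/-- The run that ended in `c` has listed all maximal independent sets of `G`: each of them was
output exactly once (as a list of its vertices without repetitions), and nothing else. -/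
def Config.ListsAllMIS {n : ℕ} {σ : Type} (G : SimpleGraph (Fin n)) (c : Config n σ) : Prop :=
  (∀ r ∈ c.out, r.1.Nodup) ∧ c.cur = [] ∧ c.sets.Nodup ∧ ∀ S, S ∈ c.sets ↔ IsMIS G S

end MISListing

/-!
The vertices are first arranged by peeling: with a threshold `K` that starts at `0`, a vertex that
has fewer than `K` remaining neighbours is removed as long as there is one, and otherwise `K` is
increased.  In a `k`-degenerate graph this never gets stuck with `K = k + 1`, so `K ≤ k + 1` in the
end, and every vertex has at most `K` neighbours later in the ordering (`peelProg_spec`).  The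
algorithm does not need to know `k`.

A maximal independent set `T` other than the root of the reverse search has a first *defect*: a
vertex `v ∉ T`, all of whose neighbours in `T` are later than `v`.  This is the vertex that the
parent operation adds, and the set `N` of neighbours of `v` in `T` is what it removes.  If `S` is
the parent of `T`, then `T` arises from `S` by adding `N` and removing the neighbours of `N`, so
that `T` is determined by `S`, `v` and `N` (`IsChild.isCandidate`).  As `N` consists of later
neighbours of `v`, there are at most `n * 2 ^ K` candidates for children of `S`.  They are
numbered: the number of a candidate gives the position of `v` and a bit mask for `N`
(`AdjLists.child`, `AdjLists.child_childIndex`).  Conversely, `IsCandidate` lists conditions under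
which an exchange does yield a child (`IsCandidate.isChild`).  Whether the new set is maximal is
answered by the dominance structure; apart from that, only the vertices of `N`, their neighbours,
and the later neighbours of these are inspected.  A failed exchange is undone
(`exchangeProg_spec`).

For an exchange to yield a child, `v` has to be the first neighbour in `S` of every member of `N`,
and this is checked, in time `O(K)`, before the exchange is carried out.  Hence each vertex is a
member of `N` in exchanges for one `v` only, which means in at most `2 ^ K` of them; since the sum
of the degrees is at most `2 * K * n`, all candidates of `S` together are tested with `O(n)`
operations, for fixed `k` (`AdjLists.sum_testCost_le`).  Printing a set and moving to its parent
also take `O(n)` operations.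

The traversal needs no stack.  When the candidates of a set are exhausted, its parent is recomputed
from the definition, and the number of the set as a child of its parent, from which the search
continues there, is read off as well (`upProg_spec`).  So `O(n)` memory cells suffice.  As for the
delay, a set is output when it is reached from above, so between two outputs the traversal moves up
a path of the tree and tests candidates of the sets on it.  The position `agree` of the first
defect increases with every step up (`agree_lt_agree_parent`), so there are at most `n` such steps;
in `Machine.potential` this becomes a bound for the time since the last output.

The behaviour and the running time of the programs are established with a program logic (`Run`),
whose unit of time is `64 * τ` machine steps if an operation of the dominance structure takes at
most `τ` steps.
-/

namespace MISListing

/-! ### A program logic for the machine -/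

/-- The program variables.  Each of them is an array; a scalar is the entry with index `0`. -/
inductive Var
  /-- a strict bound on the number of later neighbours of a vertex -/
  | dgn
  /-- the number `2 ^ dgn` of sets of indices of later neighbours -/
  | pow
  /-- the number of candidates for children of a set -/
  | lim
  /-- the number of the current candidate -/
  | cand
  /-- the vertex in each position of the ordering -/
  | ord
  /-- the position of each vertex -/
  | pos
  /-- the number of later neighbours of each vertex -/
  | len
  /-- the lists of later neighbours -/
  | late
  /-- the status of each vertex relative to the current set -/
  | st
  /-- the position of the first neighbour of each vertex in the current set -/
  | fst
  /-- the position up to which the current set agrees with the root -/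
  | agr
  /-- the number of neighbours of each vertex that the peeling process has not removed -/
  | dg
  /-- whether the peeling process has queued the vertex -/
  | mk
  /-- the ends of the queue of the peeling process -/
  | head | tail
  /-- the vertices of a candidate set, and their number -/
  | lst | cnt
  /-- a truth value -/
  | ok
  /-- loop counters -/
  | i1 | i2 | i3
  /-- a set of indices of later neighbours, as a bit mask -/
  | bits
  /-- vertices -/
  | v1 | w1 | x1 | u1
  /-- an intermediate result -/
  | tmp
  deriving DecidableEq

/-- The residue class (modulo `32`) of the addresses of the entries of a variable. -/
def Var.code : Var → ℕ
  | dgn => 0 | pow => 1 | lim => 2 | cand => 3 | ord => 4 | pos => 5 | len => 6 | late => 7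
  | st => 8 | fst => 9 | agr => 10 | dg => 11 | mk => 12 | head => 13 | tail => 14 | lst => 15
  | cnt => 16 | ok => 17 | i1 => 18 | i2 => 19 | i3 => 20 | bits => 21 | v1 => 22 | w1 => 23
  | x1 => 24 | u1 => 25 | tmp => 26

theorem Var.code_lt (a : Var) : a.code < 32 := by cases a <;> decide

theorem Var.code_injective : Function.Injective Var.code := by
  let g : ℕ → Var := fun
    | 0 => dgn | 1 => pow | 2 => lim | 3 => cand | 4 => ord | 5 => pos | 6 => len | 7 => late
    | 8 => st | 9 => fst | 10 => agr | 11 => dg | 12 => mk | 13 => head | 14 => tail | 15 => lst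
    | 16 => cnt | 17 => ok | 18 => i1 | 19 => i2 | 20 => i3 | 21 => bits | 22 => v1 | 23 => w1
    | 24 => x1 | 25 => u1 | _ => tmp
  exact Function.LeftInverse.injective (g := g) (fun a => by cases a <;> rfl)

/-- The content of a memory, sorted by variables. -/
def view (m : ℕ → ℕ) (a : Var) (x : ℕ) : ℕ := m (32 * x + a.code)

/-- Expressions over program variables. -/
inductive Ex
  | lit (c : ℕ)
  | var (a : Var)
  | arr (a : Var) (e : Ex)
  | op (o : BinOp) (a b : Ex)
  | size
  | deg (v : Ex)
  | nbr (v i : Ex)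

/-- The machine expression that an expression over program variables stands for. -/
def Ex.compile : Ex → Expr
  | .lit c => .lit c
  | .var a => .load (.lit a.code)
  | .arr a e => .load (.op .add (.op .mul (.lit 32) e.compile) (.lit a.code))
  | .op o a b => .op o a.compile b.compile
  | .size => .size
  | .deg v => .deg v.compile
  | .nbr v i => .nbr v.compile i.compile

/-- A machine together with its input.  As the arrays are interleaved with a period of `32`, the
bound for the indices of array entries is `32` times smaller than the memory.  -/
structure Machine {n : ℕ} (G : SimpleGraph (Fin n)) where
  /-- the input -/
  A : AdjLists G
  /-- the dominance structure -/
  D : DominanceStructure G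
  /-- the number of memory cells -/
  M : ℕ
  /-- a strict bound for the numbers that fit into a word -/
  W : ℕ
  /-- a strict bound for the indices of array entries -/
  X : ℕ
  /-- a bound for the time of an operation of the dominance structure -/
  τ : ℕ
  runs : D.RunsInTime τ
  hX : 1 ≤ X
  hXM : 32 * X ≤ M
  hMW : M ≤ W
  hnW : n < W
  hW : 64 ≤ W

variable {n : ℕ} {G : SimpleGraph (Fin n)}

/-- The degree of the vertex with number `v` (and `0` if there is none). -/
def AdjLists.degree (A : AdjLists G) (v : ℕ) : ℕ :=
  if h : v < n then (A.nbrs ⟨v, h⟩).length else 0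

/-- The number of the entry with index `i` of the adjacency list of the vertex with number `v`. -/
def AdjLists.entry (A : AdjLists G) (v i : ℕ) : ℕ :=
  if h : v < n then
    if hi : i < (A.nbrs ⟨v, h⟩).length then ((A.nbrs ⟨v, h⟩).get ⟨i, hi⟩ : Fin n) else 0
  else 0

@[simp] theorem AdjLists.degree_coe (A : AdjLists G) (v : Fin n) :
    A.degree v = (A.nbrs v).length := by
  simp [AdjLists.degree]

theorem AdjLists.entry_coe (A : AdjLists G) (v : Fin n) {i : ℕ} (hi : i < (A.nbrs v).length) :
    A.entry v i = ((A.nbrs v)[i] : Fin n) := by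
  simp [AdjLists.entry, hi]

theorem AdjLists.entry_le (A : AdjLists G) (v i : ℕ) : A.entry v i ≤ n := by
  unfold AdjLists.entry
  split_ifs <;> omega

theorem AdjLists.length_le (A : AdjLists G) (v : Fin n) : (A.nbrs v).length ≤ n := by
  simpa using (A.nodup v).length_le_card

theorem AdjLists.degree_le (A : AdjLists G) (v : ℕ) : A.degree v ≤ n := by
  unfold AdjLists.degree
  split_ifs
  · exact A.length_le _
  · omega

/-- The value of an expression over program variables. -/
def Ex.eval (A : AdjLists G) (mem : Var → ℕ → ℕ) : Ex → ℕ
  | .lit c => c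
  | .var a => mem a 0
  | .arr a e => mem a (e.eval A mem)
  | .op o a b => o.apply (a.eval A mem) (b.eval A mem)
  | .size => n
  | .deg v => A.degree (v.eval A mem)
  | .nbr v i => A.entry (v.eval A mem) (i.eval A mem)

/-- The condition that the result of an operation, applied to words, is a word: only sums and
products can be too large. -/
def BinOp.Fits (W : ℕ) : BinOp → ℕ → ℕ → Prop
  | .add, a, b => a + b < W
  | .mul, a, b => a * b < W
  | _, _, _ => True

/-- Sufficient conditions for the safe evaluation of an expression over program variables in a
memory that holds words only.  Literals have to be less than `64`, since all machines under
consideration have words for these numbers. -/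
def Ex.Ok (𝓜 : Machine G) (mem : Var → ℕ → ℕ) : Ex → Prop
  | .lit c => c < 64
  | .var _ => True
  | .arr _ e => e.Ok 𝓜 mem ∧ e.eval 𝓜.A mem < 𝓜.X
  | .op o a b => a.Ok 𝓜 mem ∧ b.Ok 𝓜 mem ∧ o.Fits 𝓜.W (a.eval 𝓜.A mem) (b.eval 𝓜.A mem)
  | .size => True
  | .deg v => v.Ok 𝓜 mem ∧ v.eval 𝓜.A mem < n
  | .nbr v i => v.Ok 𝓜 mem ∧ i.Ok 𝓜 mem ∧ v.eval 𝓜.A mem < n ∧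
      i.eval 𝓜.A mem < 𝓜.A.degree (v.eval 𝓜.A mem)

theorem Machine.address_lt (𝓜 : Machine G) {x : ℕ} (hx : x < 𝓜.X) (a : Var) :
    32 * x + a.code < 𝓜.M := by
  have := 𝓜.hXM
  have := a.code_lt
  omega

/-- An expression that satisfies `Ex.Ok` can be evaluated safely after compilation, the result is
the value of the expression, and this is a word.  -/
theorem Ex.sound (𝓜 : Machine G) {m : ℕ → ℕ} (hm : ∀ y, m y < 𝓜.W) (e : Ex)
    (he : e.Ok 𝓜 (view m)) :
    e.compile.Safe 𝓜.A 𝓜.M 𝓜.W m ∧ e.compile.val 𝓜.A m = e.eval 𝓜.A (view m) ∧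
      e.eval 𝓜.A (view m) < 𝓜.W := by
  have hW := 𝓜.hW
  have hnW := 𝓜.hnW
  have hMW := 𝓜.hMW
  induction e with
  | lit c =>
    simp only [Ex.Ok] at he
    exact ⟨by simp only [Ex.compile, Expr.Safe]; omega, rfl, by simp only [Ex.eval]; omega⟩
  | var a =>
    have ha := 𝓜.address_lt 𝓜.hX a
    have hlt := a.code_lt
    refine ⟨?_, by simp [Ex.compile, Expr.val, Ex.eval, view], hm _⟩
    simp only [Ex.compile, Expr.Safe, Expr.val]
    exact ⟨by omega, by omega, hm _⟩
  | arr a e ih =>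
    obtain ⟨h₁, h₂⟩ := he
    obtain ⟨i₁, i₂, i₃⟩ := ih h₁
    have ha := 𝓜.address_lt h₂ a
    refine ⟨?_, by simp [Ex.compile, Expr.val, Ex.eval, view, i₂, BinOp.apply], hm _⟩
    simp only [Ex.compile, Expr.Safe, Expr.val, BinOp.apply, i₂]
    have hlt := a.code_lt
    exact ⟨⟨⟨by omega, i₁, by omega⟩, by omega, by omega⟩, by omega, hm _⟩
  | op o a b iha ihb =>
    obtain ⟨h₁, h₂, h₃⟩ := he
    obtain ⟨a₁, a₂, a₃⟩ := iha h₁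
    obtain ⟨b₁, b₂, b₃⟩ := ihb h₂
    have key : o.apply (a.eval 𝓜.A (view m)) (b.eval 𝓜.A (view m)) < 𝓜.W := by
      cases o <;> simp only [BinOp.apply, BinOp.Fits] at *
      · exact h₃
      · omega
      · exact h₃
      · exact lt_of_le_of_lt (Nat.div_le_self _ _) a₃
      · exact lt_of_le_of_lt (Nat.mod_le _ _) a₃
      · split_ifs <;> omega
      · split_ifs <;> omega
    refine ⟨?_, by simp only [Ex.compile, Expr.val, Ex.eval, a₂, b₂], key⟩
    simp only [Ex.compile, Expr.Safe, a₂, b₂]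
    exact ⟨a₁, b₁, key⟩
  | size => exact ⟨hnW, rfl, hnW⟩
  | deg v ih =>
    obtain ⟨h₁, h₂⟩ := he
    obtain ⟨i₁, i₂, i₃⟩ := ih h₁
    have hle := 𝓜.A.degree_le (v.eval 𝓜.A (view m))
    have hv : (Ex.deg v).compile.val 𝓜.A m = (Ex.deg v).eval 𝓜.A (view m) := by
      simp only [Ex.compile, Expr.val, Ex.eval, AdjLists.degree, i₂]
    have hlt : (Ex.deg v).eval 𝓜.A (view m) < 𝓜.W := by
      simp only [Ex.eval]; omega
    refine ⟨?_, hv, hlt⟩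
    simp only [Ex.compile] at hv
    simp only [Ex.compile, Expr.Safe]
    exact ⟨i₁, by rw [i₂]; exact h₂, by rw [hv]; exact hlt⟩
  | nbr v i ihv ihi =>
    obtain ⟨h₁, h₂, h₃, h₄⟩ := he
    obtain ⟨v₁, v₂, v₃⟩ := ihv h₁
    obtain ⟨i₁, i₂, i₃⟩ := ihi h₂
    have hle := 𝓜.A.entry_le (v.eval 𝓜.A (view m)) (i.eval 𝓜.A (view m))
    have hv : (Ex.nbr v i).compile.val 𝓜.A m = (Ex.nbr v i).eval 𝓜.A (view m) := by
      simp only [Ex.eval, ← v₂, ← i₂]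
      rfl
    have hlt : (Ex.nbr v i).eval 𝓜.A (view m) < 𝓜.W := by
      simp only [Ex.eval]; omega
    refine ⟨?_, hv, hlt⟩
    simp only [Ex.compile] at hv
    simp only [Ex.compile, Expr.Safe]
    refine ⟨v₁, i₁, by rw [v₂]; exact h₃, ?_, by rw [hv]; exact hlt⟩
    rw [i₂]
    simpa only [Expr.val, AdjLists.degree, v₂] using h₄

/-- The part of a configuration that programs act on, apart from the clock and the finished
outputs. -/
structure St (n : ℕ) (σ : Type) where
  mem : Var → ℕ → ℕ
  dom : σ
  cur : List (Fin n)

/-- Write `y` into the entry with index `x` of the variable `a`. -/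
def St.upd {σ : Type} (s : St n σ) (a : Var) (x y : ℕ) : St n σ :=
  { s with mem := Function.update s.mem a (Function.update (s.mem a) x y) }

section upd
variable {σ : Type} (s : St n σ) (a b : Var) (x y z : ℕ)

theorem St.upd_mem : (s.upd a x y).mem b z = if b = a ∧ z = x then y else s.mem b z := by
  by_cases hb : b = a
  · subst hb
    by_cases hz : z = x <;> simp [St.upd, hz]
  · simp [St.upd, hb]

theorem St.upd_mem_of_ne {b : Var} (hb : b ≠ a) : (s.upd a x y).mem b = s.mem b := by
  simp [St.upd, hb]

@[simp] theorem St.upd_dom : (s.upd a x y).dom = s.dom := rfl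
@[simp] theorem St.upd_cur : (s.upd a x y).cur = s.cur := rfl

end upd

/-- The abstract state of a configuration. -/
def Config.abs {σ : Type} (c : Config n σ) : St n σ := ⟨view c.mem, c.dom, c.cur⟩

theorem view_update (m : ℕ → ℕ) (a : Var) (x y : ℕ) :
    view (Function.update m (32 * x + a.code) y) =
      Function.update (view m) a (Function.update (view m a) x y) := by
  funext b z
  have ha := a.code_lt
  have hb := b.code_lt
  by_cases hab : b = a
  · subst hab
    by_cases hz : z = x
    · subst hz; simp [view]
    · have : 32 * z + b.code ≠ 32 * x + b.code := by omega
      simp [view, hz]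
  · have : b.code ≠ a.code := fun h => hab (Var.code_injective h)
    have : 32 * z + b.code ≠ 32 * x + a.code := by omega
    simp [view, hab, this]

/-- `Run 𝓜 p s t Q`: started in the state `s`, with a memory that holds words only, the program `p`
terminates in a state that satisfies `Q`, without completing an output set.  It takes at most `t`
units of time, where a unit is `64 * τ` steps: enough for one elementary command, or for one
evaluation of a condition. -/
def Run (𝓜 : Machine G) (p : Prog) (s : St n 𝓜.D.State) (t : ℕ) (Q : St n 𝓜.D.State → Prop) :
    Prop :=
  ∀ c : Config n 𝓜.D.State, c.abs = s → (∀ y, c.mem y < 𝓜.W) →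
    ∃ c', Exec 𝓜.A 𝓜.D 𝓜.M 𝓜.W p c c' ∧ (∀ y, c'.mem y < 𝓜.W) ∧ c'.out = c.out ∧
      c'.time ≤ c.time + 64 * 𝓜.τ * t ∧ Q c'.abs

/-- Assignment to a scalar. -/
def asg (a : Var) (e : Ex) : Prog := .store (.lit a.code) e.compile

/-- Assignment to an array entry. -/
def sto (a : Var) (x e : Ex) : Prog :=
  .store (.op .add (.op .mul (.lit 32) x.compile) (.lit a.code)) e.compile

/-- Execute `p` if the value of `e` is nonzero, and `q` otherwise. -/
def branch (e : Ex) (p q : Prog) : Prog := .ite e.compile p q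

/-- Repeat `p` as long as the value of `e` is nonzero. -/
def whileLoop (e : Ex) (p : Prog) : Prog := .loop e.compile p

/-- Insert the vertex `e` into the set maintained by the dominance structure. -/
def domInsert (e : Ex) : Prog := .insert e.compile

/-- Delete the vertex `e` from the set maintained by the dominance structure. -/
def domDelete (e : Ex) : Prog := .delete e.compile

/-- Store in the scalar `a` whether the set maintained by the dominance structure dominates. -/
def domTest (a : Var) : Prog := .test (.lit a.code)

/-- Append the vertex `e` to the set that is being output. -/
def emitVertex (e : Ex) : Prog := .emit e.compile

infixr:60 " ;; " => Prog.seq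

section rules

variable {𝓜 : Machine G} {s : St n 𝓜.D.State} {t : ℕ} {Q : St n 𝓜.D.State → Prop}

/-- The time bound is positive because a dominance test takes at least one step. -/
theorem Machine.one_le_τ (𝓜 : Machine G) : 1 ≤ 𝓜.τ :=
  le_trans (𝓜.D.testCost_pos 𝓜.D.init) (𝓜.runs.2.2 _)

theorem Run.mono {p : Prog} {t' : ℕ} {Q' : St n 𝓜.D.State → Prop} (h : Run 𝓜 p s t Q)
    (ht : t ≤ t') (hQ : ∀ s', Q s' → Q' s') : Run 𝓜 p s t' Q' := by
  intro c hc hm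
  obtain ⟨c', h₁, h₂, h₃, h₄, h₅⟩ := h c hc hm
  exact ⟨c', h₁, h₂, h₃, h₄.trans (by gcongr), hQ _ h₅⟩

theorem Run.le {p : Prog} {t' : ℕ} (h : Run 𝓜 p s t Q) (ht : t ≤ t') : Run 𝓜 p s t' Q :=
  h.mono ht fun _ h => h

theorem Run.imp {p : Prog} {Q' : St n 𝓜.D.State → Prop} (h : Run 𝓜 p s t Q)
    (hQ : ∀ s', Q s' → Q' s') : Run 𝓜 p s t Q' :=
  h.mono le_rfl hQ

theorem Run.seq {p q : Prog} {t₁ t₂ : ℕ} {R : St n 𝓜.D.State → Prop} (h₁ : Run 𝓜 p s t₁ R)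
    (h₂ : ∀ s', R s' → Run 𝓜 q s' t₂ Q) (ht : t₁ + t₂ ≤ t := by omega) : Run 𝓜 (p ;; q) s t Q := by
  intro c hc hm
  obtain ⟨c₁, e₁, m₁, o₁, t₁', r₁⟩ := h₁ c hc hm
  obtain ⟨c₂, e₂, m₂, o₂, t₂', r₂⟩ := h₂ _ r₁ c₁ rfl m₁
  refine ⟨c₂, .seq _ _ _ _ _ e₁ e₂, m₂, o₂.trans o₁, ?_, r₂⟩
  have : 64 * 𝓜.τ * (t₁ + t₂) ≤ 64 * 𝓜.τ * t := by gcongr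
  rw [mul_add] at this
  omega

theorem Run.skip (h : Q s) : Run 𝓜 .skip s (t + 1) Q := by
  intro c hc hm
  refine ⟨_, .skip c, hm, rfl, ?_, by subst hc; exact h⟩
  have := 𝓜.one_le_τ
  dsimp only
  nlinarith

theorem Run.sto {a : Var} {x e : Ex} {y z : ℕ} (hx : x.Ok 𝓜 s.mem)
    (hy : x.eval 𝓜.A s.mem = y) (hyX : y < 𝓜.X) (he : e.Ok 𝓜 s.mem)
    (hz : e.eval 𝓜.A s.mem = z) (h : Q (s.upd a y z))
    (hcx : x.compile.cost ≤ 25 := by decide) (hce : e.compile.cost ≤ 25 := by decide) :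
    Run 𝓜 (sto a x e) s (t + 1) Q := by
  intro c hc hm
  subst hc
  obtain ⟨x₁, x₂, x₃⟩ := Ex.sound 𝓜 hm x hx
  obtain ⟨e₁, e₂, e₃⟩ := Ex.sound 𝓜 hm e he
  have hM := 𝓜.address_lt hyX a
  have hMW := 𝓜.hMW
  have hW := 𝓜.hW
  have hlt := a.code_lt
  have hτ := 𝓜.one_le_τ
  have hy' : x.compile.val 𝓜.A c.mem = y := x₂.trans hy
  have hz' : e.compile.val 𝓜.A c.mem = z := e₂.trans hz
  have hzW : z < 𝓜.W := by rw [← hz]; exact e₃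
  have hs := Exec.store (A := 𝓜.A) (D := 𝓜.D) (M := 𝓜.M) (W := 𝓜.W)
    (.op .add (.op .mul (.lit 32) x.compile) (.lit a.code)) e.compile c
    (by simp only [Expr.Safe, Expr.val, BinOp.apply, hy']
        exact ⟨⟨by omega, x₁, by omega⟩, by omega, by omega⟩)
    (by simp only [Expr.val, BinOp.apply, hy']; exact hM) e₁
  refine ⟨_, hs, ?_, rfl, ?_, ?_⟩
  · intro w
    simp only [Function.update_apply, hz']
    split_ifs
    · exact hzW
    · exact hm w
  · simp only [Expr.cost]
    nlinarith
  · simp only [Expr.val, BinOp.apply, hy', hz', Config.abs, view_update]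
    exact h

theorem Run.asg {a : Var} {e : Ex} {z : ℕ} (he : e.Ok 𝓜 s.mem)
    (hz : e.eval 𝓜.A s.mem = z) (h : Q (s.upd a 0 z))
    (hce : e.compile.cost ≤ 25 := by decide) : Run 𝓜 (asg a e) s (t + 1) Q := by
  intro c hc hm
  subst hc
  obtain ⟨e₁, e₂, e₃⟩ := Ex.sound 𝓜 hm e he
  have hM := 𝓜.address_lt 𝓜.hX a
  have hMW := 𝓜.hMW
  have hW := 𝓜.hW
  have hlt := a.code_lt
  have hτ := 𝓜.one_le_τ
  have hz' : e.compile.val 𝓜.A c.mem = z := e₂.trans hz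
  have hzW : z < 𝓜.W := by rw [← hz]; exact e₃
  have hs := Exec.store (A := 𝓜.A) (D := 𝓜.D) (M := 𝓜.M) (W := 𝓜.W)
    (.lit a.code) e.compile c (by simp only [Expr.Safe]; omega)
    (by simp only [Expr.val]; omega) e₁
  refine ⟨_, hs, ?_, rfl, ?_, ?_⟩
  · intro w
    simp only [Function.update_apply, hz']
    split_ifs
    · exact hzW
    · exact hm w
  · simp only [Expr.cost]
    nlinarith
  · have := view_update c.mem a 0 z
    rw [mul_zero, zero_add] at this
    simp only [Expr.val, hz', Config.abs, this]
    exact h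

theorem Run.branch {e : Ex} {p q : Prog} (he : e.Ok 𝓜 s.mem)
    (h₁ : e.eval 𝓜.A s.mem ≠ 0 → Run 𝓜 p s t Q) (h₂ : e.eval 𝓜.A s.mem = 0 → Run 𝓜 q s t Q)
    (hce : e.compile.cost ≤ 50 := by decide) : Run 𝓜 (branch e p q) s (t + 1) Q := by
  intro c hc hm
  subst hc
  obtain ⟨e₁, e₂, -⟩ := Ex.sound 𝓜 hm e he
  have hτ := 𝓜.one_le_τ
  by_cases h0 : e.eval 𝓜.A (view c.mem) = 0
  · obtain ⟨c', x₁, x₂, x₃, x₄, x₅⟩ :=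
      h₂ h0 { c with time := c.time + e.compile.cost + 1 } rfl hm
    refine ⟨c', .ite_false _ _ _ _ _ e₁ (e₂.trans h0) x₁, x₂, x₃, ?_, x₅⟩
    dsimp only at x₄
    nlinarith
  · obtain ⟨c', x₁, x₂, x₃, x₄, x₅⟩ :=
      h₁ h0 { c with time := c.time + e.compile.cost + 1 } rfl hm
    refine ⟨c', .ite_true _ _ _ _ _ e₁ (by rwa [e₂]) x₁, x₂, x₃, ?_, x₅⟩
    dsimp only at x₄
    nlinarith

theorem Run.domInsert {e : Ex} {v : Fin n} (he : e.Ok 𝓜 s.mem)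
    (hv : e.eval 𝓜.A s.mem = v) (hs : v ∉ 𝓜.D.toSet s.dom)
    (h : Q { s with dom := 𝓜.D.insert v s.dom })
    (hce : e.compile.cost ≤ 25 := by decide) : Run 𝓜 (domInsert e) s (t + 1) Q := by
  intro c hc hm
  subst hc
  obtain ⟨e₁, e₂, e₃⟩ := Ex.sound 𝓜 hm e he
  have hτ := 𝓜.one_le_τ
  have hv' : e.compile.val 𝓜.A c.mem = v := e₂.trans hv
  have hlt : e.compile.val 𝓜.A c.mem < n := by rw [hv']; exact v.2
  have hvv : (⟨e.compile.val 𝓜.A c.mem, hlt⟩ : Fin n) = v := Fin.ext hv'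
  refine ⟨_, Exec.insert _ c e₁ hlt, hm, rfl, ?_, ?_⟩
  · have := 𝓜.runs.1 v _ hs
    simp only [hvv]
    change 𝓜.D.insertCost v c.dom ≤ _ at this
    nlinarith
  · simp only [hvv]; exact h

theorem Run.domDelete {e : Ex} {v : Fin n} (he : e.Ok 𝓜 s.mem)
    (hv : e.eval 𝓜.A s.mem = v) (hs : v ∈ 𝓜.D.toSet s.dom)
    (h : Q { s with dom := 𝓜.D.delete v s.dom })
    (hce : e.compile.cost ≤ 25 := by decide) : Run 𝓜 (domDelete e) s (t + 1) Q := by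
  intro c hc hm
  subst hc
  obtain ⟨e₁, e₂, e₃⟩ := Ex.sound 𝓜 hm e he
  have hτ := 𝓜.one_le_τ
  have hv' : e.compile.val 𝓜.A c.mem = v := e₂.trans hv
  have hlt : e.compile.val 𝓜.A c.mem < n := by rw [hv']; exact v.2
  have hvv : (⟨e.compile.val 𝓜.A c.mem, hlt⟩ : Fin n) = v := Fin.ext hv'
  refine ⟨_, Exec.delete _ c e₁ hlt, hm, rfl, ?_, ?_⟩
  · have := 𝓜.runs.2.1 v _ hs
    simp only [hvv]
    change 𝓜.D.deleteCost v c.dom ≤ _ at this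
    nlinarith
  · simp only [hvv]; exact h

open Classical in
theorem Run.domTest {a : Var}
    (h : Q (s.upd a 0 (if Dominates G (𝓜.D.toSet s.dom) then 1 else 0))) :
    Run 𝓜 (domTest a) s (t + 1) Q := by
  intro c hc hm
  subst hc
  have hM := 𝓜.address_lt 𝓜.hX a
  have hMW := 𝓜.hMW
  have hW := 𝓜.hW
  have hlt := a.code_lt
  have hτ := 𝓜.one_le_τ
  refine ⟨_, Exec.test (.lit a.code) c (by simp only [Expr.Safe]; omega)
    (by simp only [Expr.val]; omega) (by omega), ?_, rfl, ?_, ?_⟩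
  · intro w
    simp only [Function.update_apply]
    split_ifs
    · omega
    · omega
    · exact hm w
  · have := 𝓜.runs.2.2 c.dom
    simp only [Expr.cost]
    nlinarith
  · have := view_update c.mem a 0 (if Dominates G (𝓜.D.toSet c.dom) then 1 else 0)
    rw [mul_zero, zero_add] at this
    simp only [Expr.val, Config.abs, 𝓜.D.test_iff, this]
    exact h

theorem Run.emitVertex {e : Ex} {v : Fin n} (he : e.Ok 𝓜 s.mem)
    (hv : e.eval 𝓜.A s.mem = v) (h : Q { s with cur := s.cur ++ [v] })
    (hce : e.compile.cost ≤ 25 := by decide) : Run 𝓜 (emitVertex e) s (t + 1) Q := by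
  intro c hc hm
  subst hc
  obtain ⟨e₁, e₂, e₃⟩ := Ex.sound 𝓜 hm e he
  have hτ := 𝓜.one_le_τ
  have hv' : e.compile.val 𝓜.A c.mem = v := e₂.trans hv
  have hlt : e.compile.val 𝓜.A c.mem < n := by rw [hv']; exact v.2
  have hvv : (⟨e.compile.val 𝓜.A c.mem, hlt⟩ : Fin n) = v := Fin.ext hv'
  refine ⟨_, Exec.emit _ c e₁ hlt, hm, rfl, ?_, ?_⟩
  · dsimp only
    nlinarith
  · simp only [hvv]; exact h

/-- Rule for loops.  The index of the invariant is a potential, which bounds the remaining time. -/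
theorem Run.whileLoop {e : Ex} {p : Prog} (I : ℕ → St n 𝓜.D.State → Prop)
    (hok : ∀ r s, I r s → e.Ok 𝓜 s.mem)
    (hstep : ∀ r s, I r s → e.eval 𝓜.A s.mem ≠ 0 →
      ∃ t', Run 𝓜 p s t' (fun s' => ∃ r', I r' s' ∧ r' + t' + 1 ≤ r))
    (hend : ∀ r s, I r s → e.eval 𝓜.A s.mem = 0 → Q s)
    {r : ℕ} (h : I r s) (ht : r + 1 ≤ t)
    (hce : e.compile.cost ≤ 50 := by decide) : Run 𝓜 (whileLoop e p) s t Q := by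
  refine Run.le (t := r + 1) ?_ ht
  clear ht
  induction r using Nat.strong_induction_on generalizing s with
  | _ r ih =>
  intro c hc hm
  subst hc
  obtain ⟨e₁, e₂, -⟩ := Ex.sound 𝓜 hm e (hok _ _ h)
  have hτ := 𝓜.one_le_τ
  by_cases h0 : e.eval 𝓜.A (view c.mem) = 0
  · refine ⟨_, .loop_false _ _ _ e₁ (e₂.trans h0), hm, rfl, ?_, hend _ _ h h0⟩
    dsimp only
    nlinarith
  · obtain ⟨t', hp⟩ := hstep _ _ h h0
    obtain ⟨c₁, x₁, x₂, x₃, x₄, r', x₅, x₆⟩ :=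
      hp { c with time := c.time + e.compile.cost + 1 } rfl hm
    obtain ⟨c₂, y₁, y₂, y₃, y₄, y₅⟩ := ih r' (by omega) x₅ c₁ rfl x₂
    refine ⟨c₂, .loop_true _ _ _ _ _ e₁ (by rwa [e₂]) x₁ y₁, y₂, y₃.trans x₃, ?_, y₅⟩
    dsimp only at x₄
    have : 64 * 𝓜.τ * (r' + t' + 1 + 1) ≤ 64 * 𝓜.τ * (r + 1) := by gcongr
    nlinarith

end rules

/-- `for i < e do p`, where the bound `e` is evaluated anew in each round. -/
def forLoop (i : Var) (e : Ex) (p : Prog) : Prog :=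
  asg i (.lit 0) ;; whileLoop (.op .lt (.var i) e) (p ;; asg i (.op .add (.var i) (.lit 1)))

/-- Rule for counting loops: `N` is the number of rounds, round `r` takes at most `b r` units of
time, and `I r` holds before it.  -/
theorem Run.forLoop {𝓜 : Machine G} {s : St n 𝓜.D.State} {t : ℕ} {Q : St n 𝓜.D.State → Prop}
    {i : Var} {e : Ex} {p : Prog} (N : ℕ) (b : ℕ → ℕ) (I : ℕ → St n 𝓜.D.State → Prop)
    (hN : N < 𝓜.W) (h0 : I 0 (s.upd i 0 0))
    (hbound : ∀ r s, r ≤ N → I r s → e.Ok 𝓜 s.mem ∧ e.eval 𝓜.A s.mem = N)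
    (hstep : ∀ r s, r < N → I r s → s.mem i 0 = r →
      Run 𝓜 p s (b r) (fun s' => s'.mem i 0 = r ∧ I (r + 1) (s'.upd i 0 (r + 1))))
    (hend : ∀ s, I N s → Q s) (ht : ∑ r ∈ Finset.range N, (b r + 2) + 2 ≤ t)
    (hce : e.compile.cost ≤ 20 := by decide) : Run 𝓜 (forLoop i e p) s t Q := by
  have hW := 𝓜.hW
  refine Run.seq (t₁ := 1) (t₂ := ∑ r ∈ Finset.range N, (b r + 2) + 1)
    (R := fun s' => s' = s.upd i 0 0)
    (Run.asg (t := 0) (by simp [Ex.Ok]) rfl rfl) ?_ (by omega)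
  rintro _ rfl
  -- The potential of the loop is the time for the remaining rounds.
  refine Run.whileLoop
    (fun r' s' => ∃ r ≤ N, r' = ∑ x ∈ Finset.Ico r N, (b x + 2) ∧ I r s' ∧ s'.mem i 0 = r)
    ?_ ?_ ?_ (r := ∑ r ∈ Finset.range N, (b r + 2)) ?_ le_rfl ?_
  · rintro _ s' ⟨r, hr, -, hI, -⟩
    exact ⟨trivial, (hbound r s' hr hI).1, trivial⟩
  · rintro _ s' ⟨r, hr, rfl, hI, hi⟩ hne
    have hrN : r < N := by
      by_contra hcon
      exact hne (by simp [Ex.eval, BinOp.apply, (hbound r s' hr hI).2, hi, hcon])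
    refine ⟨b r + 1, Run.seq (t₁ := b r) (t₂ := 1) (hstep r s' hrN hI hi) ?_⟩
    rintro s'' ⟨hi', hI'⟩
    refine Run.asg (t := 0) (z := r + 1) ⟨trivial, ?_, ?_⟩ (by simp [Ex.eval, BinOp.apply, hi']) ?_
      (by simp [Ex.compile, Expr.cost])
    · simp [Ex.Ok]
    · simp only [BinOp.Fits, Ex.eval, hi']; omega
    · refine ⟨_, ⟨r + 1, hrN, rfl, hI', by simp [St.upd_mem]⟩, ?_⟩
      rw [Finset.sum_eq_sum_Ico_succ_bot hrN]
      omega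
  · rintro _ s' ⟨r, hr, rfl, hI, hi⟩ heq
    have : r = N := by
      by_contra hcon
      have : r < N := lt_of_le_of_ne hr hcon
      simp [Ex.eval, BinOp.apply, (hbound r s' hr hI).2, hi, this] at heq
    subst this
    exact hend _ hI
  · exact ⟨0, Nat.zero_le _, by rw [Finset.range_eq_Ico], h0, by simp [St.upd_mem]⟩
  · simp only [Ex.compile, Expr.cost]
    omega

/-! ### Lexicographically first supersets and the parent operation -/

open Finset

section graph

variable {n : ℕ} (G : SimpleGraph (Fin n)) (ord : VertexOrder n)

open Classical in
/-- The position of the first neighbour of `u` in `S`, or `n` if there is none. -/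
noncomputable def firstPos (S : Finset (Fin n)) (u : Fin n) : ℕ :=
  (S.filter (G.Adj u)).fold min n (fun x => (ord.symm x : ℕ))

/-- A vertex outside `S`, all of whose neighbours in `S` occur later: the greedy construction would
have chosen it. -/
def Defect (S : Finset (Fin n)) (u : Fin n) : Prop :=
  u ∉ S ∧ (ord.symm u : ℕ) < firstPos G ord S u

open Classical in
/-- The position of the first defect of `S`, or `n` if there is none.  Up to this position, `S`
agrees with the lexicographically first maximal independent set. -/
noncomputable def agree (S : Finset (Fin n)) : ℕ :=
  (univ.filter (Defect G ord S)).fold min n (fun x => (ord.symm x : ℕ))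

variable {G ord}

theorem lt_firstPos {S : Finset (Fin n)} {u : Fin n} {p : ℕ} :
    p < firstPos G ord S u ↔ p < n ∧ ∀ x ∈ S, G.Adj u x → p < ord.symm x := by
  simp [firstPos, Finset.lt_fold_min]

theorem le_firstPos {S : Finset (Fin n)} {u : Fin n} {p : ℕ} :
    p ≤ firstPos G ord S u ↔ p ≤ n ∧ ∀ x ∈ S, G.Adj u x → p ≤ ord.symm x := by
  simp [firstPos, Finset.le_fold_min]

theorem firstPos_le_of_adj {S : Finset (Fin n)} {u x : Fin n} (hx : x ∈ S) (h : G.Adj u x) :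
    firstPos G ord S u ≤ ord.symm x :=
  (le_firstPos.1 le_rfl).2 x hx h

theorem firstPos_eq {S : Finset (Fin n)} {u v : Fin n} (hv : v ∈ S) (h : G.Adj u v)
    (hmin : ∀ x ∈ S, G.Adj u x → ord.symm v ≤ ord.symm x) :
    firstPos G ord S u = ord.symm v :=
  le_antisymm (firstPos_le_of_adj hv h)
    (le_firstPos.2 ⟨(ord.symm v).2.le, fun x hx hux => Fin.le_def.1 (hmin x hx hux)⟩)

theorem defect_iff {S : Finset (Fin n)} {u : Fin n} :
    Defect G ord S u ↔ u ∉ S ∧ ∀ x ∈ S, G.Adj u x → ord.symm u < ord.symm x := by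
  simp only [Defect, lt_firstPos, Fin.is_lt, true_and, Fin.lt_def]

theorem agree_le {S : Finset (Fin n)} : agree G ord S ≤ n := by
  have : agree G ord S ≤ agree G ord S := le_rfl
  conv at this => rhs; rw [agree]
  rw [Finset.le_fold_min] at this
  exact this.1

theorem le_agree {S : Finset (Fin n)} {p : ℕ} :
    p ≤ agree G ord S ↔ p ≤ n ∧ ∀ u, Defect G ord S u → p ≤ ord.symm u := by
  simp [agree, Finset.le_fold_min]

theorem agree_le_of_defect {S : Finset (Fin n)} {u : Fin n} (h : Defect G ord S u) :
    agree G ord S ≤ ord.symm u :=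
  (le_agree.1 le_rfl).2 u h

theorem exists_adj_of_lt_agree {S : Finset (Fin n)} {u : Fin n} (h : ord.symm u < agree G ord S)
    (hu : u ∉ S) : ∃ x ∈ S, G.Adj u x ∧ ord.symm x < ord.symm u := by
  by_contra hcon
  push Not at hcon
  have : Defect G ord S u := by
    refine defect_iff.2 ⟨hu, fun x hx hux => lt_of_le_of_ne (hcon x hx hux) ?_⟩
    intro heq
    exact G.ne_of_adj hux (ord.symm.injective heq)
  have := agree_le_of_defect this
  omega

theorem agree_eq {S : Finset (Fin n)} {v : Fin n} (hv : Defect G ord S v)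
    (h : ∀ u, ord.symm u < ord.symm v → ¬ Defect G ord S u) : agree G ord S = ord.symm v := by
  refine le_antisymm (agree_le_of_defect hv) (le_agree.2 ⟨(ord.symm v).2.le, fun u hu => ?_⟩)
  by_contra hcon
  exact h u (Fin.lt_def.2 (by omega)) hu

theorem defect_of_agree_lt {S : Finset (Fin n)} (h : agree G ord S < n) :
    Defect G ord S (ord ⟨agree G ord S, h⟩) := by
  by_contra hcon
  have : agree G ord S + 1 ≤ agree G ord S := by
    refine le_agree.2 ⟨h, fun u hu => ?_⟩
    have h1 := agree_le_of_defect hu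
    by_contra h2
    have h3 : (ord.symm u : ℕ) = agree G ord S := by omega
    apply hcon
    have : ord ⟨agree G ord S, h⟩ = u := by
      rw [← Equiv.eq_symm_apply]; exact Fin.ext h3.symm
    rwa [this]
  omega

theorem exists_defect_of_agree_lt {S : Finset (Fin n)} (h : agree G ord S < n) :
    ∃ v, Defect G ord S v ∧ agree G ord S = ord.symm v :=
  ⟨_, defect_of_agree_lt h, (congrArg Fin.val (ord.symm_apply_apply ⟨_, h⟩)).symm⟩

/-! #### The greedy construction -/

variable (G ord)

open Classical in
/-- The result of the greedy construction after considering the first `i` vertices. -/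
noncomputable def lexPrefix (I : Finset (Fin n)) (i : ℕ) : Finset (Fin n) :=
  ((List.ofFn ord).take i).foldl
    (fun S v => if ∀ u ∈ S, ¬ G.Adj u v then insert v S else S) I

theorem lexPrefix_zero (I : Finset (Fin n)) : lexPrefix G ord I 0 = I := by
  simp [lexPrefix]

open Classical in
theorem lexPrefix_succ (I : Finset (Fin n)) (i : Fin n) :
    lexPrefix G ord I (i + 1) =
      if ∀ u ∈ lexPrefix G ord I i, ¬ G.Adj u (ord i) then insert (ord i) (lexPrefix G ord I i)
      else lexPrefix G ord I i := by
  have hi : (i : ℕ) < (List.ofFn ord).length := by simp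
  unfold lexPrefix
  rw [List.take_add_one, List.getElem?_eq_getElem hi, List.foldl_append]
  simp

theorem lexPrefix_last (I : Finset (Fin n)) :
    lexPrefix G ord I n = lexFirstSuperset G ord I := by
  unfold lexPrefix lexFirstSuperset
  rw [List.take_of_length_le (by simp)]

variable {G ord}

/-- The greedy construction adds a vertex, when it comes to it, unless the vertex has a neighbour in
`I`, or among the vertices that have been added before. -/
theorem mem_lexPrefix {I : Finset (Fin n)} {i : ℕ} (hi : i ≤ n) (u : Fin n) :
    u ∈ lexPrefix G ord I i ↔ u ∈ I ∨ ((ord.symm u : ℕ) < i ∧ (∀ x ∈ I, ¬ G.Adj x u) ∧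
      ∀ x ∈ lexPrefix G ord I i, ord.symm x < ord.symm u → ¬ G.Adj x u) := by
  classical
  induction i generalizing u with
  | zero => simp [lexPrefix_zero]
  | succ i ih =>
    have ih := ih (by omega)
    obtain ⟨v, rfl⟩ : ∃ v : Fin n, i = ord.symm v := ⟨ord ⟨i, hi⟩, by simp⟩
    have hstep := lexPrefix_succ G ord I (ord.symm v)
    rw [Equiv.apply_symm_apply] at hstep
    have hsub : ∀ x, ord.symm x ≠ ord.symm v → (x ∈ lexPrefix G ord I (ord.symm v + 1) ↔
        x ∈ lexPrefix G ord I (ord.symm v)) := by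
      intro x hx
      have hxv : x ≠ v := fun h => hx (by rw [h])
      rw [hstep]
      split_ifs <;> simp [hxv]
    by_cases hu : u = v
    · subst hu
      have hmem : u ∈ lexPrefix G ord I (ord.symm u + 1) ↔
          u ∈ I ∨ ∀ x ∈ lexPrefix G ord I (ord.symm u), ¬ G.Adj x u := by
        have h := ih u
        simp only [lt_irrefl, false_and, or_false] at h
        rw [hstep]
        split_ifs with hc
        · exact iff_of_true (mem_insert_self _ _) (Or.inr hc)
        · rw [h]; simp [hc]
      rw [hmem]
      refine or_congr_right ⟨fun h => ⟨Nat.lt_succ_self _, fun x hx => h x ((ih x).2 (Or.inl hx)),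
        fun x hx hlt => h x ((hsub x hlt.ne).1 hx)⟩, ?_⟩
      rintro ⟨-, h₁, h₂⟩ x hx
      rcases (ih x).1 hx with h | h
      · exact h₁ x h
      · exact h₂ x ((hsub x (fun he => by have := h.1; omega)).2 hx) (Fin.lt_def.2 h.1)
    · have hne : ord.symm u ≠ ord.symm v := fun h => hu (ord.symm.injective h)
      rw [hsub u hne, ih u]
      refine or_congr_right ⟨fun ⟨h₁, h₂, h₃⟩ => ⟨by omega, h₂, fun x hx hlt => ?_⟩,
        fun ⟨h₁, h₂, h₃⟩ => ⟨?_, h₂, fun x hx hlt => ?_⟩⟩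
      · have : ord.symm x ≠ ord.symm v := by
          intro h; rw [h, Fin.lt_def] at hlt; omega
        exact h₃ x ((hsub x this).1 hx) hlt
      · have : (ord.symm u : ℕ) ≠ ord.symm v := fun h => hne (Fin.ext h)
        omega
      · have : ord.symm x ≠ ord.symm v := by
          intro h; rw [h, Fin.lt_def] at hlt; omega
        exact h₃ x ((hsub x this).2 hx) hlt

theorem mem_lexFirstSuperset {I : Finset (Fin n)} (u : Fin n) :
    u ∈ lexFirstSuperset G ord I ↔ u ∈ I ∨ ((∀ x ∈ I, ¬ G.Adj x u) ∧
      ∀ x ∈ lexFirstSuperset G ord I, ord.symm x < ord.symm u → ¬ G.Adj x u) := by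
  have := mem_lexPrefix (G := G) (ord := ord) (I := I) le_rfl u
  simpa [lexPrefix_last] using this

/-- The greedy construction is determined by its recursion. -/
theorem eq_lexFirstSuperset {I S : Finset (Fin n)}
    (h : ∀ u, u ∈ S ↔ u ∈ I ∨ ((∀ x ∈ I, ¬ G.Adj x u) ∧
      ∀ x ∈ S, ord.symm x < ord.symm u → ¬ G.Adj x u)) : S = lexFirstSuperset G ord I := by
  suffices ∀ p, ∀ u : Fin n, (ord.symm u : ℕ) = p → (u ∈ S ↔ u ∈ lexFirstSuperset G ord I) by
    ext u; exact this _ u rfl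
  intro p
  induction p using Nat.strong_induction_on with
  | _ p ih =>
    rintro u rfl
    rw [h, mem_lexFirstSuperset]
    refine or_congr_right (and_congr_right fun _ => ?_)
    constructor
    · intro h x hx hlt
      exact h x ((ih _ (Fin.lt_def.1 hlt) x rfl).2 hx) hlt
    · intro h x hx hlt
      exact h x ((ih _ (Fin.lt_def.1 hlt) x rfl).1 hx) hlt

theorem subset_lexFirstSuperset {I : Finset (Fin n)} : I ⊆ lexFirstSuperset G ord I :=
  fun _ hu => (mem_lexFirstSuperset _).2 (Or.inl hu)

/-- Maximality of an independent set amounts to domination, which the dominance structure tests. -/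
theorem isMIS_iff {S : Finset (Fin n)} :
    IsMIS G S ↔ (∀ u ∈ S, ∀ v ∈ S, ¬ G.Adj u v) ∧ Dominates G S := by
  classical
  have hind : ∀ S : Finset (Fin n), G.IsIndepSet (S : Set (Fin n)) ↔
      ∀ u ∈ S, ∀ v ∈ S, ¬ G.Adj u v := by
    intro S
    refine ⟨fun h u hu v hv huv => h hu hv (G.ne_of_adj huv) huv, fun h u hu v hv _ => h u hu v hv⟩
  unfold IsMIS Maximal
  beta_reduce
  rw [hind]
  refine and_congr_right fun hS => ?_
  constructor
  · intro h v
    by_contra hcon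
    push Not at hcon
    have := h (y := insert v S) ((hind _).2 ?_) (subset_insert _ _)
    · exact hcon.1 (this (mem_insert_self _ _))
    · intro a ha b hb
      rcases mem_insert.1 ha with ha' | ha' <;> rcases mem_insert.1 hb with hb' | hb'
      · rw [ha', hb']; exact G.loopless.irrefl _
      · rw [ha']; exact fun h => hcon.2 b hb' h.symm
      · rw [hb']; exact hcon.2 a ha'
      · exact hS a ha' b hb'
  · intro h T hT hST v hv
    rcases h v with h | ⟨u, hu, huv⟩
    · exact h
    · exact absurd huv ((hind T).1 hT u (hST hu) v hv)

theorem IsMIS.not_adj {S : Finset (Fin n)} (h : IsMIS G S) {u v : Fin n} (hu : u ∈ S)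
    (hv : v ∈ S) : ¬ G.Adj u v :=
  (isMIS_iff.1 h).1 u hu v hv

theorem IsMIS.exists_adj {S : Finset (Fin n)} (h : IsMIS G S) {v : Fin n} (hv : v ∉ S) :
    ∃ u ∈ S, G.Adj u v :=
  ((isMIS_iff.1 h).2 v).resolve_left hv

theorem isMIS_lexFirstSuperset {I : Finset (Fin n)} (hI : ∀ u ∈ I, ∀ v ∈ I, ¬ G.Adj u v) :
    IsMIS G (lexFirstSuperset G ord I) := by
  refine isMIS_iff.2 ⟨?_, ?_⟩
  · suffices ∀ u ∈ lexFirstSuperset G ord I, ∀ v ∈ lexFirstSuperset G ord I,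
        ord.symm u < ord.symm v → ¬ G.Adj u v by
      intro u hu v hv huv
      rcases lt_trichotomy (ord.symm u) (ord.symm v) with h | h | h
      · exact this u hu v hv h huv
      · exact G.ne_of_adj huv (ord.symm.injective h)
      · exact this v hv u hu h huv.symm
    intro u hu v hv hlt
    rcases (mem_lexFirstSuperset v).1 hv with h | h
    · rcases (mem_lexFirstSuperset u).1 hu with h' | h'
      · exact hI u h' v h
      · exact fun huv => h'.1 v h huv.symm
    · exact h.2 u hu hlt
  · intro v
    by_contra hcon
    push Not at hcon
    refine hcon.1 ((mem_lexFirstSuperset v).2 (Or.inr ⟨fun x hx => ?_, fun x hx _ => ?_⟩))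
    · exact hcon.2 x (subset_lexFirstSuperset hx)
    · exact hcon.2 x hx

theorem mem_lfmis {u : Fin n} :
    u ∈ lfmis G ord ↔ ∀ x ∈ lfmis G ord, ord.symm x < ord.symm u → ¬ G.Adj x u := by
  have := mem_lexFirstSuperset (G := G) (ord := ord) (I := ∅) u
  simpa [lfmis] using this

theorem isMIS_lfmis : IsMIS G (lfmis G ord) := isMIS_lexFirstSuperset (by simp)

/-- Before its first defect, a maximal independent set agrees with the root. -/
theorem mem_iff_mem_lfmis {S : Finset (Fin n)} (hS : IsMIS G S) {u : Fin n}
    (hu : ord.symm u < agree G ord S) : u ∈ S ↔ u ∈ lfmis G ord := by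
  suffices ∀ p, ∀ u : Fin n, (ord.symm u : ℕ) = p → p < agree G ord S →
      (u ∈ S ↔ u ∈ lfmis G ord) from this _ u rfl hu
  intro p
  induction p using Nat.strong_induction_on with
  | _ p ih =>
    rintro u rfl hu
    rw [mem_lfmis]
    constructor
    · intro h x hx hlt
      exact hS.not_adj ((ih _ hlt x rfl (by omega)).2 hx) h
    · intro h
      by_contra hcon
      obtain ⟨x, hx, hux, hlt⟩ := exists_adj_of_lt_agree hu hcon
      exact h x ((ih _ hlt x rfl (by omega)).1 hx) hlt hux.symm

/-- The first defect of a maximal independent set belongs to the root. -/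
theorem mem_lfmis_of_agree {S : Finset (Fin n)} (hS : IsMIS G S) {v : Fin n}
    (hv : Defect G ord S v) (h : agree G ord S = ord.symm v) : v ∈ lfmis G ord := by
  refine mem_lfmis.2 fun x hx hlt hxv => ?_
  have hxS := (mem_iff_mem_lfmis hS (by rw [h]; exact hlt)).2 hx
  exact absurd ((defect_iff.1 hv).2 x hxS hxv.symm) (not_lt.2 hlt.le)

/-- The root is the only maximal independent set without a defect. -/
theorem agree_lt_iff {S : Finset (Fin n)} (hS : IsMIS G S) :
    agree G ord S < n ↔ S ≠ lfmis G ord := by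
  constructor
  · rintro h rfl
    obtain ⟨v, hv, ha⟩ := exists_defect_of_agree_lt h
    exact hv.1 (mem_lfmis_of_agree hS hv ha)
  · intro h
    by_contra hcon
    apply h
    ext u
    exact mem_iff_mem_lfmis hS (lt_of_lt_of_le (ord.symm u).2 (not_lt.1 hcon))

open Classical in
/-- The vertex that the parent operation adds is the first defect. -/
theorem parent_eq {S : Finset (Fin n)} (hS : IsMIS G S) {v : Fin n} (hv : Defect G ord S v)
    (h : agree G ord S = ord.symm v) :
    parent G ord S = lexFirstSuperset G ord (insert v S \ S.filter (fun u => G.Adj v u)) := by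
  have hfind : (List.ofFn ord).find? (fun v => decide (v ∈ lfmis G ord ∧ v ∉ S)) = some v := by
    rw [List.find?_eq_some_iff_getElem]
    refine ⟨by simpa using ⟨mem_lfmis_of_agree hS hv h, hv.1⟩, ord.symm v, by simp, by simp, ?_⟩
    intro i hi
    have hin : i < n := by omega
    have := mem_iff_mem_lfmis (ord := ord) hS (u := ord ⟨i, hin⟩)
      (by rw [Equiv.symm_apply_apply]; dsimp only; omega)
    simp [this]
  unfold parent
  split
  · rename_i heq; rw [hfind] at heq; cases heq
  · rename_i w heq
    rw [hfind] at heq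
    cases heq
    rfl

/-- The vertices that the parent operation starts from form an independent set. -/
theorem indep_insert_sdiff {S : Finset (Fin n)} (hS : IsMIS G S) (v : Fin n) {N : Finset (Fin n)}
    (hN : ∀ w ∈ S, G.Adj v w → w ∈ N) :
    ∀ u ∈ insert v S \ N, ∀ w ∈ insert v S \ N, ¬ G.Adj u w := by
  intro u hu w hw huw
  rw [mem_sdiff, mem_insert] at hu hw
  rcases hu with ⟨rfl | hu, hu'⟩ <;> rcases hw with ⟨rfl | hw, hw'⟩
  · exact G.loopless.irrefl _ huw
  · exact hw' (hN w hw huw)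
  · exact hu' (hN u hu huw.symm)
  · exact hS.not_adj hu hw huw

theorem isMIS_parent {S : Finset (Fin n)} (hS : IsMIS G S) : IsMIS G (parent G ord S) := by
  by_cases h : agree G ord S < n
  · obtain ⟨v, hv, ha⟩ := exists_defect_of_agree_lt h
    rw [parent_eq hS hv ha]
    exact isMIS_lexFirstSuperset (indep_insert_sdiff hS v fun w hw hvw => by simp [hw, hvw])
  · have : S = lfmis G ord := by
      by_contra hne; exact h ((agree_lt_iff hS).2 hne)
    unfold parent
    split
    · exact hS
    · rename_i v hv
      have := List.find?_some hv
      simp_all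

/-- The parent of a set agrees with the root up to a later position than the set itself. -/
theorem agree_lt_agree_parent {S : Finset (Fin n)} (hS : IsMIS G S) (h : agree G ord S < n) :
    agree G ord S < agree G ord (parent G ord S) := by
  classical
  obtain ⟨v, hv, ha⟩ := exists_defect_of_agree_lt h
  have hv' := defect_iff.1 hv
  rw [parent_eq hS hv ha]
  set N := S.filter (fun u => G.Adj v u) with hN
  have hkeep : ∀ x ∈ S, ord.symm x < ord.symm v → x ∈ lexFirstSuperset G ord (insert v S \ N) := by
    intro x hx hlt
    refine subset_lexFirstSuperset (mem_sdiff.2 ⟨mem_insert_of_mem hx, fun hxN => ?_⟩)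
    have := hv'.2 x hx (mem_filter.1 hxN).2
    exact absurd this (not_lt.2 hlt.le)
  -- The parent contains `v`, and it contains all members of `S` before `v`, because the neighbours
  -- that are removed come after `v`.  So it has no defects up to `v`.
  refine Nat.lt_of_succ_le (le_agree.2 ⟨h, fun u hu => ?_⟩)
  by_contra hcon
  have hle : (ord.symm u : ℕ) ≤ ord.symm v := by omega
  rw [defect_iff] at hu
  by_cases huv : u = v
  · subst huv
    exact hu.1 (subset_lexFirstSuperset (by simp [hN, hv'.1]))
  · have hlt : ord.symm u < ord.symm v :=
      lt_of_le_of_ne (Fin.le_def.2 hle) fun h => huv (ord.symm.injective h)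
    by_cases huS : u ∈ S
    · exact hu.1 (hkeep u huS hlt)
    · obtain ⟨x, hx, hux, hxu⟩ := exists_adj_of_lt_agree (by rw [ha]; exact hlt) huS
      exact absurd (hu.2 x (hkeep x hx (hxu.trans hlt)) hux) (not_lt.2 hxu.le)

/-! ### The children of a set -/

variable (G ord)

open Classical in
/-- The set that arises from `S` by adding the vertices of `N` and removing their neighbours. -/
noncomputable def exchange (S N : Finset (Fin n)) : Finset (Fin n) :=
  S.filter (fun x => ∀ w ∈ N, ¬ G.Adj w x) ∪ N

/-- The conditions under which exchanging the neighbours of `N` for `N` gives a child of `S` whose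
parent arises by adding `v`.  The last condition, which says that the greedy construction of the
parent does not add a vertex outside `S`, only needs to be tested at the neighbours of `N`. -/
structure IsCandidate (S : Finset (Fin n)) (v : Fin n) (N : Finset (Fin n)) : Prop where
  lt_agree : ord.symm v < agree G ord S
  mem : v ∈ S
  nonempty : N.Nonempty
  adj : ∀ w ∈ N, G.Adj v w
  lt : ∀ w ∈ N, ord.symm v < ord.symm w
  first : ∀ w ∈ N, firstPos G ord S w = ord.symm v
  indep : ∀ w ∈ N, ∀ x ∈ N, ¬ G.Adj w x
  dominates : Dominates G (exchange G S N)
  kept : ∀ w ∈ N, ∀ u, G.Adj w u → u ∉ N → Defect G ord S u →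
    ∃ x ∈ S, G.Adj u x ∧ ∀ w' ∈ N, ¬ G.Adj w' x

variable {G ord}

theorem mem_exchange {S N : Finset (Fin n)} {x : Fin n} :
    x ∈ exchange G S N ↔ (x ∈ S ∧ ∀ w ∈ N, ¬ G.Adj w x) ∨ x ∈ N := by
  simp [exchange]

section candidate

variable {S N : Finset (Fin n)} {v : Fin n} (h : IsCandidate G ord S v N) (hS : IsMIS G S)
include h hS

theorem IsCandidate.isMIS_exchange : IsMIS G (exchange G S N) := by
  refine isMIS_iff.2 ⟨?_, h.dominates⟩
  intro x hx y hy hxy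
  rw [mem_exchange] at hx hy
  rcases hx with hx | hx <;> rcases hy with hy | hy
  · exact hS.not_adj hx.1 hy.1 hxy
  · exact hx.2 y hy hxy.symm
  · exact hy.2 x hx hxy
  · exact h.indep x hx y hy hxy

omit hS in
theorem IsCandidate.not_mem_exchange : v ∉ exchange G S N := by
  obtain ⟨w, hw⟩ := h.nonempty
  rw [mem_exchange]
  rintro (hv | hv)
  · exact hv.2 w hw (h.adj w hw).symm
  · exact G.loopless.irrefl _ (h.adj v hv)

omit hS in
theorem IsCandidate.mem_exchange_iff {x : Fin n} (hx : ord.symm x < ord.symm v) :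
    x ∈ exchange G S N ↔ x ∈ S := by
  rw [mem_exchange]
  constructor
  · rintro (hS | hN)
    · exact hS.1
    · exact absurd (h.lt x hN) (not_lt.2 hx.le)
  · intro hxS
    refine Or.inl ⟨hxS, fun w hw hwx => ?_⟩
    have := firstPos_le_of_adj (ord := ord) hxS hwx
    rw [h.first w hw] at this
    exact absurd hx (not_lt.2 (Fin.le_def.2 this))

theorem IsCandidate.defect_exchange : Defect G ord (exchange G S N) v := by
  refine defect_iff.2 ⟨h.not_mem_exchange, fun x hx hvx => ?_⟩
  rcases mem_exchange.1 hx with hx | hx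
  · exact absurd hvx (hS.not_adj h.mem hx.1)
  · exact h.lt x hx

/-- The first defect of the exchanged set is `v`: before `v`, it agrees with `S`. -/
theorem IsCandidate.agree_exchange : agree G ord (exchange G S N) = ord.symm v := by
  refine agree_eq (h.defect_exchange hS) fun u hu hd => ?_
  rw [defect_iff, h.mem_exchange_iff hu] at hd
  obtain ⟨x, hx, hux, hxu⟩ := exists_adj_of_lt_agree (lt_trans (Fin.lt_def.1 hu) h.lt_agree) hd.1
  exact absurd (hd.2 x ((h.mem_exchange_iff (hxu.trans hu)).2 hx) hux) (not_lt.2 hxu.le)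

theorem IsCandidate.adj_exchange_iff {x : Fin n} :
    x ∈ exchange G S N ∧ G.Adj v x ↔ x ∈ N := by
  constructor
  · rintro ⟨hx, hvx⟩
    rcases mem_exchange.1 hx with hx | hx
    · exact absurd hvx (hS.not_adj h.mem hx.1)
    · exact hx
  · exact fun hx => ⟨mem_exchange.2 (Or.inr hx), h.adj x hx⟩

/-- The parent of the exchanged set is constructed from `S` without the removed vertices other than
`v`.  The greedy construction puts the removed vertices back, and by the condition `kept` it adds no
others. -/
theorem IsCandidate.parent_exchange : parent G ord (exchange G S N) = S := by
  classical
  have hT := h.isMIS_exchange hS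
  rw [parent_eq hT (h.defect_exchange hS) (h.agree_exchange hS)]
  symm
  have hNT : (exchange G S N).filter (fun u => G.Adj v u) = N := by
    ext x; rw [mem_filter, h.adj_exchange_iff hS]
  rw [hNT]
  have hI : ∀ u, u ∈ insert v (exchange G S N) \ N ↔
      u = v ∨ (u ∈ S ∧ ∀ w ∈ N, ¬ G.Adj w u) := by
    intro u
    have hvN : v ∉ N := fun hv => G.loopless.irrefl _ (h.adj v hv)
    have hSN : u ∈ S → u ∉ N := fun hu huN => hS.not_adj h.mem hu (h.adj u huN)
    rw [mem_sdiff, mem_insert, mem_exchange]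
    by_cases huv : u = v
    · subst huv; simp [hvN]
    · simp only [huv, false_or]
      tauto
  refine eq_lexFirstSuperset fun u => ?_
  constructor
  · intro hu
    refine Or.inr ⟨fun x hx => ?_, fun x hx _ => hS.not_adj hx hu⟩
    rcases (hI x).1 hx with rfl | hx
    · exact hS.not_adj h.mem hu
    · exact hS.not_adj hx.1 hu
  · rintro (hu | ⟨hu₁, hu₂⟩)
    · rcases (hI u).1 hu with rfl | hu
      · exact h.mem
      · exact hu.1
    · by_contra huS
      have huN : u ∉ N := fun huN => hu₁ v ((hI v).2 (Or.inl rfl)) (h.adj u huN)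
      have hd : Defect G ord S u := by
        refine defect_iff.2 ⟨huS, fun x hx hux => lt_of_not_ge fun hle => ?_⟩
        rcases hle.lt_or_eq with hlt | heq
        · exact hu₂ x hx hlt hux.symm
        · exact G.ne_of_adj hux (ord.symm.injective heq).symm
      have huT : u ∉ exchange G S N := by
        rw [mem_exchange]; tauto
      -- As the exchanged set is maximal, `u` has a neighbour in it, which must belong to `N`.
      obtain ⟨y, hy, hyu⟩ := hT.exists_adj huT
      rcases mem_exchange.1 hy with hy | hy
      · exact hu₁ y ((hI y).2 (Or.inr hy)) hyu
      · obtain ⟨x, hx, hux, hxN⟩ := h.kept y hy u hyu huN hd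
        exact hu₁ x ((hI x).2 (Or.inr ⟨hx, hxN⟩)) hux.symm

theorem IsCandidate.isChild : IsChild G ord (exchange G S N) S := by
  have hT := h.isMIS_exchange hS
  refine ⟨hT, (agree_lt_iff (ord := ord) hT).1 ?_, h.parent_exchange hS⟩
  rw [h.agree_exchange hS]
  exact (ord.symm v).2

end candidate

open Classical in
/-- Every child arises by an exchange. -/
theorem IsChild.isCandidate {S T : Finset (Fin n)} (h : IsChild G ord T S) {v : Fin n}
    (ha : agree G ord T = ord.symm v) :
    IsCandidate G ord S v (T.filter (G.Adj v)) ∧ exchange G S (T.filter (G.Adj v)) = T := by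
  obtain ⟨hT, hne, hpar⟩ := h
  have halt := (agree_lt_iff (ord := ord) hT).2 hne
  have hv : Defect G ord T v := by
    have := defect_of_agree_lt halt
    have hv : ord ⟨agree G ord T, halt⟩ = v := by
      rw [← Equiv.eq_symm_apply]; exact Fin.ext ha
    rwa [hv] at this
  have hv' := defect_iff.1 hv
  have hSM : IsMIS G S := hpar ▸ isMIS_parent hT
  have haS : agree G ord T < agree G ord S := hpar ▸ agree_lt_agree_parent hT halt
  have hS : S = lexFirstSuperset G ord (insert v T \ T.filter (fun u => G.Adj v u)) := by
    rw [← hpar, parent_eq hT hv ha]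
  set N := T.filter (G.Adj v) with hN
  set I := insert v T \ N with hI
  have hIS : I ⊆ S := by rw [hS]; exact subset_lexFirstSuperset
  have hmemN : ∀ w, w ∈ N ↔ w ∈ T ∧ G.Adj v w := fun w => by simp [hN]
  have hvS : v ∈ S := hIS (by simp [hI, hN])
  have hTI : ∀ x, x ∈ T → x ∉ N → x ∈ I := fun x hx hxN => by simp [hI, hx, hxN]
  have hIv : ∀ x ∈ I, x = v ∨ x ∈ T := fun x hx => mem_insert.1 (mem_sdiff.1 hx).1
  have hex : exchange G S N = T := by
    ext x
    rw [mem_exchange]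
    constructor
    · rintro (⟨hxS, hx⟩ | hx)
      · by_contra hxT
        obtain ⟨y, hy, hyx⟩ := hT.exists_adj hxT
        by_cases hyN : y ∈ N
        · exact hx y hyN hyx
        · exact hSM.not_adj (hIS (hTI y hy hyN)) hxS hyx
      · exact ((hmemN x).1 hx).1
    · intro hxT
      by_cases hxN : x ∈ N
      · exact Or.inr hxN
      · exact Or.inl ⟨hIS (hTI x hxT hxN), fun w hw => hT.not_adj ((hmemN w).1 hw).1 hxT⟩
  refine ⟨⟨ha ▸ haS, hvS, ?_, fun w hw => ((hmemN w).1 hw).2,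
    fun w hw => hv'.2 w ((hmemN w).1 hw).1 ((hmemN w).1 hw).2, ?_,
    fun w hw x hx => hT.not_adj ((hmemN w).1 hw).1 ((hmemN x).1 hx).1,
    hex ▸ (isMIS_iff.1 hT).2, ?_⟩, hex⟩
  · obtain ⟨w, hw, hwv⟩ := hT.exists_adj hv.1
    exact ⟨w, (hmemN w).2 ⟨hw, hwv.symm⟩⟩
  · -- A neighbour of `w` in `S` before `v` would belong to `T`, since `S` and `T` agree there.
    intro w hw
    obtain ⟨hwT, hvw⟩ := (hmemN w).1 hw
    refine firstPos_eq hvS hvw.symm fun x hx hwx => ?_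
    by_contra hlt
    have hlt' := Fin.lt_def.1 (not_le.1 hlt)
    have hxT : x ∈ T :=
      (mem_iff_mem_lfmis (ord := ord) hT (by omega)).2
        ((mem_iff_mem_lfmis (ord := ord) hSM (by omega)).1 hx)
    exact hT.not_adj hwT hxT hwx
  · -- As the greedy construction has not added `u`, although `u` is a defect of `S`, a neighbour of
    -- `u` must be one of the vertices from which the construction started.
    intro w hw u hwu huN hd
    rw [defect_iff] at hd
    have huS := hd.1
    rw [hS, mem_lexFirstSuperset, ← hS] at huS
    push Not at huS
    have hx : ∃ x ∈ I, G.Adj x u := by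
      by_contra hcon
      push Not at hcon
      obtain ⟨x, hx, hlt, hxu⟩ := huS.2 hcon
      exact absurd (hd.2 x hx hxu.symm) (not_lt.2 hlt.le)
    obtain ⟨x, hx, hxu⟩ := hx
    refine ⟨x, hIS hx, hxu.symm, fun w' hw' => ?_⟩
    rcases hIv x hx with rfl | hxT
    · -- A neighbour of `v` that is a defect of `S` would precede `v`.
      have hlt := Fin.lt_def.1 (hd.2 x hvS hxu.symm)
      have := agree_le_of_defect (defect_iff.2 hd)
      omega
    · exact hT.not_adj ((hmemN w').1 hw').1 hxT

end graph


/-! ### Depth-first preorders -/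

section forest

variable {α : Type} {child : α → α → Prop}

/-- A preorder lists the descendants of the roots. -/
theorem ForestPreorder.mem_iff {rs L : List α} (h : ForestPreorder child rs L) (z : α) :
    z ∈ L ↔ ∃ r ∈ rs, Relation.ReflTransGen (fun x y => child y x) r z := by
  induction h with
  | nil => simp
  | @cons x rs cs L₁ L₂ hnodup hcs h₁ h₂ ih₁ ih₂ =>
    rw [List.mem_cons, List.mem_append, ih₁, ih₂, List.exists_mem_cons_iff, ← or_assoc]
    refine or_congr_left ?_
    rw [Relation.ReflTransGen.cases_head_iff]
    refine or_congr eq_comm ?_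
    exact exists_congr fun c => and_congr_left fun _ => hcs c

/-- Since parents are unique and have a larger rank, no node occurs twice in a preorder of trees
that have no common nodes. -/
theorem ForestPreorder.nodup (rank : α → ℕ) (hrank : ∀ x y, child y x → rank y < rank x)
    (huniq : ∀ x x' y, child y x → child y x' → x = x') {rs L : List α}
    (h : ForestPreorder child rs L)
    (hrs : rs.Pairwise fun r r' => ∀ z, Relation.ReflTransGen (fun x y => child y x) r z →
      ¬ Relation.ReflTransGen (fun x y => child y x) r' z) : L.Nodup := by
  have hle : ∀ x y, Relation.ReflTransGen (fun x y => child y x) x y → rank y ≤ rank x := by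
    intro x y hxy
    induction hxy with
    | refl => exact le_rfl
    | tail _ h ih => exact (hrank _ _ h).le.trans ih
  induction h with
  | nil => exact List.nodup_nil
  | @cons x rs cs L₁ L₂ hnodup hcs h₁ h₂ ih₁ ih₂ =>
    rw [List.pairwise_cons] at hrs
    have hsib : ∀ c ∈ cs, ∀ c' ∈ cs,
        Relation.ReflTransGen (fun x y => child y x) c c' → c = c' := by
      intro c hc c' hc' hcc
      rcases Relation.ReflTransGen.cases_tail hcc with h | ⟨y, hy, hyc⟩
      · exact h.symm
      · have hxy : y = x := huniq _ _ _ hyc ((hcs _).1 hc')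
        subst hxy
        have := hle _ _ hy
        have := hrank _ _ ((hcs _).1 hc)
        omega
    refine List.nodup_cons.2 ⟨?_, List.Nodup.append (ih₁ ?_) (ih₂ hrs.2) ?_⟩
    · rw [List.mem_append, h₁.mem_iff, h₂.mem_iff]
      rintro (⟨c, hc, hcx⟩ | ⟨r, hr, hrx⟩)
      · have := hle _ _ hcx
        have := hrank _ _ ((hcs _).1 hc)
        omega
      · exact hrs.1 r hr x .refl hrx
    · refine hnodup.imp_of_mem fun {c c'} hc hc' hne z hz hz' => ?_
      have htot := Relation.ReflTransGen.total_of_right_unique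
        (r := fun y x => child y x) (a := z) (fun a b c hab hac => huniq _ _ _ hab hac)
        (Relation.reflTransGen_swap.2 hz) (Relation.reflTransGen_swap.2 hz')
      rcases htot with h | h
      · exact hne (hsib _ hc' _ hc (Relation.reflTransGen_swap.1 h)).symm
      · exact hne (hsib _ hc _ hc' (Relation.reflTransGen_swap.1 h))
    · intro z hz hz'
      obtain ⟨c, hc, hcz⟩ := (h₁.mem_iff z).1 hz
      obtain ⟨r, hr, hrz⟩ := (h₂.mem_iff z).1 hz'
      exact hrs.1 r hr z (.head ((hcs _).1 hc) hcz) hrz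

end forest

section

variable {n : ℕ} {G : SimpleGraph (Fin n)} {ord : VertexOrder n}

/-- Reverse search visits every maximal independent set exactly once. -/
theorem IsReverseSearch.nodup_and_mem_iff {L : List (Finset (Fin n))}
    (h : IsReverseSearch G ord L) : L.Nodup ∧ ∀ S, S ∈ L ↔ IsMIS G S := by
  refine ⟨ForestPreorder.nodup (agree G ord) ?_ ?_ h (List.pairwise_singleton _ _), fun S => ?_⟩
  · rintro S T ⟨hT, hne, rfl⟩
    exact agree_lt_agree_parent hT ((agree_lt_iff hT).2 hne)
  · rintro S S' T ⟨-, -, rfl⟩ ⟨-, -, rfl⟩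
    rfl
  · rw [ForestPreorder.mem_iff h]
    simp only [List.mem_singleton, exists_eq_left]
    constructor
    · intro hS
      rcases Relation.ReflTransGen.cases_tail hS with h | ⟨y, -, hy⟩
      · rw [h]; exact isMIS_lfmis
      · exact hy.1
    · intro hS
      induction hk : n - agree G ord S using Nat.strong_induction_on generalizing S with
      | _ k ih =>
        by_cases hne : S = lfmis G ord
        · rw [hne]
        · have hlt := (agree_lt_iff (ord := ord) hS).2 hne
          have hlt' := agree_lt_agree_parent hS hlt
          exact (ih _ (by omega) _ (isMIS_parent hS) rfl).tail ⟨hS, hne, rfl⟩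

end

/-! ### Subsets of a list, encoded by numbers -/

/-- The entries of a list whose indices are the positions of the ones in the binary expansion. -/
def pick {α : Type} : List α → ℕ → List α
  | [], _ => []
  | w :: l, q => if q % 2 = 1 then w :: pick l (q / 2) else pick l (q / 2)

/-- The number whose binary expansion has ones at the indices of the entries in `S`. -/
def mask {α : Type} [DecidableEq α] : List α → Finset α → ℕ
  | [], _ => 0
  | w :: l, S => (if w ∈ S then 1 else 0) + 2 * mask l S

section pick

variable {α : Type}

theorem pick_sublist (l : List α) (q : ℕ) : (pick l q).Sublist l := by
  induction l generalizing q with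
  | nil => exact List.Sublist.refl _
  | cons w l ih =>
    rw [pick]
    split_ifs
    · exact (ih _).cons_cons w
    · exact (ih _).cons w

variable [DecidableEq α]

theorem mask_lt (l : List α) (S : Finset α) : mask l S < 2 ^ l.length := by
  induction l with
  | nil => simp [mask]
  | cons w l ih =>
    rw [mask, List.length_cons, pow_succ]
    split_ifs <;> omega

theorem pick_mask (l : List α) (S : Finset α) : pick l (mask l S) = l.filter (· ∈ S) := by
  induction l with
  | nil => rfl
  | cons w l ih =>
    rw [mask, pick]
    by_cases hw : w ∈ S
    · have h1 : (1 + 2 * mask l S) % 2 = 1 := by omega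
      have h2 : (1 + 2 * mask l S) / 2 = mask l S := by omega
      simp [hw, h1, h2, ih]
    · have h1 : ¬ (0 + 2 * mask l S) % 2 = 1 := by omega
      have h2 : (0 + 2 * mask l S) / 2 = mask l S := by omega
      simp only [hw, if_false, if_neg h1, h2, ih]
      simp [hw]

theorem mask_congr (l : List α) {S S' : Finset α} (h : ∀ w ∈ l, w ∈ S ↔ w ∈ S') :
    mask l S = mask l S' := by
  induction l with
  | nil => rfl
  | cons w l ih =>
    rw [mask, mask, ih fun w hw => h w (List.mem_cons_of_mem _ hw)]
    simp [h w (List.mem_cons_self ..)]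

theorem mask_pick (l : List α) (hl : l.Nodup) {q : ℕ} (hq : q < 2 ^ l.length) :
    mask l (pick l q).toFinset = q := by
  induction l generalizing q with
  | nil => simp at hq; simp [mask, hq]
  | cons w l ih =>
    rw [List.nodup_cons] at hl
    rw [List.length_cons, pow_succ] at hq
    have hw : w ∉ pick l (q / 2) := fun h => hl.1 ((pick_sublist _ _).subset h)
    rw [mask, pick]
    have hcongr : mask l (if q % 2 = 1 then w :: pick l (q / 2) else pick l (q / 2)).toFinset =
        q / 2 := by
      rw [← ih hl.2 (q := q / 2) (by omega)]
      refine mask_congr l fun x hx => ?_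
      have : x ≠ w := fun h => hl.1 (h ▸ hx)
      rw [ih hl.2 (by omega)]
      split_ifs <;> simp [this]
    rw [hcongr]
    split_ifs with h1 h2 h2 <;> simp_all <;> omega

end pick

/-! ### The numbering of the candidates -/

section candidates

variable {n : ℕ} {G : SimpleGraph (Fin n)} (A : AdjLists G) (ord : VertexOrder n) (K : ℕ)

/-- The list of the later neighbours of a vertex. -/
def AdjLists.late (v : Fin n) : List (Fin n) :=
  (A.nbrs v).filter fun w => ord.symm v < ord.symm w

variable {A ord} in
theorem AdjLists.mem_late {v w : Fin n} :
    w ∈ A.late ord v ↔ G.Adj v w ∧ ord.symm v < ord.symm w := by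
  simp [AdjLists.late, A.mem_iff]

theorem AdjLists.nodup_late (v : Fin n) : (A.late ord v).Nodup := (A.nodup v).filter _

/-- The set of later neighbours of `v` in the candidate with number `j`. -/
def AdjLists.candidate (v : Fin n) (j : ℕ) : List (Fin n) := pick (A.late ord v) (j % 2 ^ K)

theorem AdjLists.nodup_candidate (v : Fin n) (j : ℕ) : (A.candidate ord K v j).Nodup :=
  (A.nodup_late ord v).sublist (pick_sublist _ _)

open Classical in
/-- The child of `S` with number `j`, if there is one.  The number encodes the position of the
vertex `v` and a subset of its later neighbours.  The bits beyond the number of later neighbours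
have to be zero: otherwise, a child would have several numbers.  -/
noncomputable def AdjLists.child (S : Finset (Fin n)) (j : ℕ) : Option (Finset (Fin n)) :=
  if h : j / 2 ^ K < n then
    if j % 2 ^ K < 2 ^ (A.late ord (ord ⟨_, h⟩)).length ∧
        IsCandidate G ord S (ord ⟨_, h⟩) (A.candidate ord K (ord ⟨_, h⟩) j).toFinset then
      some (exchange G S (A.candidate ord K (ord ⟨_, h⟩) j).toFinset)
    else none
  else none

open Classical in
/-- The number of `T` as a child of its parent. -/
noncomputable def AdjLists.childIndex (T : Finset (Fin n)) : ℕ :=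
  if h : agree G ord T < n then
    agree G ord T * 2 ^ K + mask (A.late ord (ord ⟨_, h⟩)) T
  else 0

variable {A ord K}

/-- The candidates that pass the test are children, and different numbers yield different children.
-/
theorem AdjLists.isChild_of_child_eq_some {S T : Finset (Fin n)} {j : ℕ} (hS : IsMIS G S)
    (h : A.child ord K S j = some T) : IsChild G ord T S ∧ A.childIndex ord K T = j := by
  unfold AdjLists.child at h
  split_ifs at h with h₁ h₂
  obtain ⟨hq, hc⟩ := h₂
  cases h
  refine ⟨hc.isChild hS, ?_⟩
  have ha := hc.agree_exchange hS
  rw [Equiv.symm_apply_apply] at ha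
  dsimp only at ha
  unfold AdjLists.childIndex
  have hv : (⟨agree G ord (exchange G S (A.candidate ord K (ord ⟨_, h₁⟩) j).toFinset), by omega⟩ :
      Fin n) = ⟨_, h₁⟩ := Fin.ext ha
  rw [dif_pos (by omega), hv, ha]
  have hm : mask (A.late ord (ord ⟨_, h₁⟩))
      (exchange G S (A.candidate ord K (ord ⟨_, h₁⟩) j).toFinset) = j % 2 ^ K := by
    rw [← mask_pick _ (A.nodup_late ord (ord ⟨_, h₁⟩)) hq]
    refine mask_congr _ fun w hw => ?_
    have := hc.adj_exchange_iff hS (x := w)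
    simp only [(AdjLists.mem_late.1 hw).1, and_true] at this
    exact this
  convert Nat.div_add_mod' j (2 ^ K) using 2

/-- Every child passes the test. -/
theorem AdjLists.child_childIndex {S T : Finset (Fin n)} (hK : ∀ v, (A.late ord v).length ≤ K)
    (h : IsChild G ord T S) :
    A.childIndex ord K T < n * 2 ^ K ∧ A.child ord K S (A.childIndex ord K T) = some T := by
  classical
  have hlt := (agree_lt_iff (ord := ord) h.1).2 h.2.1
  obtain ⟨v, hv, ha⟩ := exists_defect_of_agree_lt hlt
  obtain ⟨hc, hex⟩ := h.isCandidate ha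
  have hvv : ord ⟨agree G ord T, hlt⟩ = v := by
    rw [← Equiv.eq_symm_apply]; exact Fin.ext ha
  have hml := mask_lt (A.late ord v) T
  have hml' : mask (A.late ord v) T < 2 ^ K :=
    hml.trans_le (Nat.pow_le_pow_right (by norm_num) (hK v))
  have hidx : A.childIndex ord K T = agree G ord T * 2 ^ K + mask (A.late ord v) T := by
    unfold AdjLists.childIndex
    rw [dif_pos hlt, hvv]
  have hpos : 0 < 2 ^ K := by positivity
  have hdiv : A.childIndex ord K T / 2 ^ K = agree G ord T := by
    rw [hidx, mul_comm, Nat.mul_add_div hpos, Nat.div_eq_of_lt hml', add_zero]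
  have hmod : A.childIndex ord K T % 2 ^ K = mask (A.late ord v) T := by
    rw [hidx, mul_comm, Nat.mul_add_mod, Nat.mod_eq_of_lt hml']
  have hcand : (A.candidate ord K v (A.childIndex ord K T)).toFinset = T.filter (G.Adj v) := by
    ext w
    rw [AdjLists.candidate, hmod, pick_mask, mem_filter]
    simp only [List.mem_toFinset, List.mem_filter, AdjLists.mem_late, decide_eq_true_eq]
    constructor
    · tauto
    · rintro ⟨h₁, h₂⟩
      exact ⟨⟨h₂, (defect_iff.1 hv).2 w h₁ h₂⟩, h₁⟩
  refine ⟨?_, ?_⟩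
  · rw [hidx]
    calc _ < (agree G ord T + 1) * 2 ^ K := by rw [add_mul, one_mul]; omega
      _ ≤ _ := Nat.mul_le_mul_right _ hlt
  · unfold AdjLists.child
    have hvv' : ∀ h, ord ⟨A.childIndex ord K T / 2 ^ K, h⟩ = v := by
      intro h; rw [← hvv]; congr 2
    rw [dif_pos (by rw [hdiv]; exact hlt)]
    simp only [hvv']
    rw [hcand, if_pos ⟨by rw [hmod]; exact hml, hc⟩, hex]

/-! ### Counting edges -/

theorem AdjLists.length_nbrs_eq [DecidableRel G.Adj] (v : Fin n) :
    (A.nbrs v).length = ∑ w, if G.Adj v w then 1 else 0 := by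
  rw [← Finset.card_filter, ← List.toFinset_card_of_nodup (A.nodup v)]
  congr 1
  ext w
  simp [A.mem_iff]

theorem AdjLists.length_late_eq [DecidableRel G.Adj] (v : Fin n) :
    (A.late ord v).length = ∑ w, if G.Adj v w ∧ ord.symm v < ord.symm w then 1 else 0 := by
  rw [← Finset.card_filter, ← List.toFinset_card_of_nodup (A.nodup_late ord v)]
  congr 1
  ext w
  simp [AdjLists.mem_late]

/-- The sum of the degrees is twice the number of edges, each of which is counted once in the lists
of later neighbours. -/
theorem AdjLists.sum_length_nbrs_le {k : ℕ} (h : ∀ v, (A.late ord v).length ≤ k) :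
    ∑ v, (A.nbrs v).length ≤ 2 * k * n := by
  classical
  have h₁ : ∑ v, (A.nbrs v).length ≤ ∑ v, (A.late ord v).length + ∑ v, (A.late ord v).length := by
    simp only [A.length_nbrs_eq, A.length_late_eq]
    conv_rhs => rw [add_comm]
    nth_rw 2 [Finset.sum_comm]
    rw [← Finset.sum_add_distrib]
    refine Finset.sum_le_sum fun v _ => ?_
    rw [← Finset.sum_add_distrib]
    refine Finset.sum_le_sum fun w _ => ?_
    by_cases hvw : G.Adj v w
    · have hne : ord.symm v ≠ ord.symm w := fun h => G.ne_of_adj hvw (ord.symm.injective h)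
      rcases lt_or_gt_of_ne hne with h | h
      · simp [hvw, h]
      · simp [hvw, hvw.symm, h]
    · simp [hvw]
  have h₂ : ∑ v, (A.late ord v).length ≤ n * k := by
    simpa using Finset.sum_le_card_nsmul univ _ k fun v _ => h v
  nlinarith

/-! ### The cost of testing the candidates -/

variable (A ord K)

open Classical in
/-- The part of the cost of testing the candidate with number `j` that depends on degrees.  The
neighbours of the members are only inspected if they all have the same first neighbour in `S`. -/
noncomputable def AdjLists.testCost (S : Finset (Fin n)) (j : ℕ) : ℕ :=
  if h : j / 2 ^ K < n then
    if ∀ w ∈ A.candidate ord K (ord ⟨_, h⟩) j, firstPos G ord S w = j / 2 ^ K then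
      ((A.candidate ord K (ord ⟨_, h⟩) j).map fun w => (A.nbrs w).length + 1).sum
    else 0
  else 0

theorem sum_range_mul_div (f : ℕ → ℕ) (n : ℕ) {p : ℕ} (hp : 0 < p) :
    ∑ j ∈ range (n * p), f (j / p) = p * ∑ i ∈ range n, f i := by
  induction n with
  | zero => simp
  | succ n ih =>
    rw [add_mul, one_mul, Finset.sum_range_add, ih, Finset.sum_range_succ, mul_add]
    congr 1
    rw [Finset.sum_congr rfl (g := fun _ => f n)]
    · simp
    · intro x hx
      rw [mul_comm n p, Nat.mul_add_div hp, Nat.div_eq_of_lt (mem_range.1 hx), add_zero]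

/-- Every vertex has only one first neighbour in `S`, so it contributes to at most `2 ^ K` tests. -/
theorem AdjLists.sum_testCost_le (S : Finset (Fin n)) :
    ∑ j ∈ range (n * 2 ^ K), A.testCost ord K S j ≤ 2 ^ K * ∑ w, ((A.nbrs w).length + 1) := by
  classical
  have hle : ∀ j, A.testCost ord K S j ≤
      ∑ w with firstPos G ord S w = j / 2 ^ K, ((A.nbrs w).length + 1) := by
    intro j
    unfold AdjLists.testCost
    split_ifs with h₁ h₂
    · rw [← List.sum_toFinset _ (A.nodup_candidate ord K _ j)]
      refine Finset.sum_le_sum_of_subset fun w hw => ?_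
      simp only [mem_filter, mem_univ, true_and]
      exact h₂ w (List.mem_toFinset.1 hw)
    · exact Nat.zero_le _
    · exact Nat.zero_le _
  refine (Finset.sum_le_sum fun j _ => hle j).trans ?_
  rw [sum_range_mul_div (fun i => ∑ w with firstPos G ord S w = i, ((A.nbrs w).length + 1)) n
    (by positivity : 0 < 2 ^ K)]
  refine Nat.mul_le_mul_left _ ?_
  rw [Finset.sum_fiberwise_eq_sum_filter]
  exact Finset.sum_le_sum_of_subset (filter_subset _ _)

end candidates


/-! ### Loops over adjacency lists -/

section loops

variable {n : ℕ} {G : SimpleGraph (Fin n)}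

/-- Execute `p` for each neighbour `x1` of the vertex `y`. -/
def forNbrs (y : Var) (p : Prog) : Prog :=
  forLoop .i2 (.deg (.var y)) (asg .x1 (.nbr (.var y) (.var .i2)) ;; p)

/-- Rule for loops over adjacency lists.  The invariant is indexed by the list of neighbours that
have been processed.  -/
theorem Run.forNbrs {𝓜 : Machine G} {s : St n 𝓜.D.State} {t : ℕ} {Q : St n 𝓜.D.State → Prop}
    {y : Var} {p : Prog} (v : Fin n) (b : ℕ) (I : List (Fin n) → St n 𝓜.D.State → Prop)
    (h0 : I [] s) (hi : ∀ l s z, I l s → I l (s.upd .i2 0 z))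
    (hx : ∀ l s z, I l s → I l (s.upd .x1 0 z)) (hy : ∀ l s, I l s → s.mem y 0 = v)
    (hstep : ∀ l (x : Fin n) s, l ++ [x] <+: 𝓜.A.nbrs v → I l s → s.mem .x1 0 = x →
      Run 𝓜 p s b (fun s' => s'.mem .i2 0 = s.mem .i2 0 ∧ I (l ++ [x]) s'))
    (hend : ∀ s, I (𝓜.A.nbrs v) s → Q s) (ht : (b + 3) * (𝓜.A.nbrs v).length + 2 ≤ t) :
    Run 𝓜 (forNbrs y p) s t Q := by
  have hnW := 𝓜.hnW
  have hle := 𝓜.A.length_le v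
  refine Run.forLoop (𝓜.A.nbrs v).length (fun _ => b + 1)
    (fun r s => I ((𝓜.A.nbrs v).take r) s) (by omega) (hi _ _ _ (by simpa using h0)) ?_ ?_ ?_ ?_
    (by simp [Ex.compile, Expr.cost])
  · intro r s _ hI
    have := hy _ _ hI
    exact ⟨⟨trivial, by simp [Ex.eval, this]⟩, by simp [Ex.eval, this]⟩
  · intro r s hr hI hir
    have hyv := hy _ _ hI
    have hent := 𝓜.A.entry_coe v hr
    refine Run.seq (t₁ := 1) (t₂ := b) (R := fun s' => s' = s.upd .x1 0 (𝓜.A.nbrs v)[r])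
      (Run.asg (t := 0) ?_ ?_ rfl (by simp [Ex.compile, Expr.cost])) ?_
    · exact ⟨trivial, trivial, by simp [Ex.eval, hyv], by simp [Ex.eval, hyv, hir, hr]⟩
    · simp [Ex.eval, hyv, hir, hent]
    · rintro _ rfl
      have htake : (𝓜.A.nbrs v).take r ++ [(𝓜.A.nbrs v)[r]] = (𝓜.A.nbrs v).take (r + 1) := by
        simp
      refine (hstep _ (𝓜.A.nbrs v)[r] _ (htake ▸ List.take_prefix _ _) (hx _ _ _ hI)
        (by simp [St.upd_mem])).imp ?_
      rintro s' ⟨h₁, h₂⟩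
      refine ⟨by simpa [St.upd_mem, hir] using h₁, hi _ _ _ ?_⟩
      rwa [htake] at h₂
  · intro s hI
    rw [List.take_length] at hI
    exact hend s hI
  · simp only [sum_const, card_range, smul_eq_mul]
    nlinarith

end loops

/-! ### The representation of the data -/

section representation

variable {n : ℕ} {G : SimpleGraph (Fin n)}

/-- The machine is large enough for the ordering `ord`, in which every vertex has at most `K` later
neighbours.  The factor `2` in `pow_lt` covers sums of two numbers up to `2 ^ K`. -/
structure Machine.Params (𝓜 : Machine G) (ord : VertexOrder n) (K : ℕ) : Prop where
  length_le : ∀ v, (𝓜.A.late ord v).length ≤ K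
  n_lt : n < 𝓜.X
  table_lt : n * K < 𝓜.X
  K_lt : K < 𝓜.X
  K_lt_W : K < 𝓜.W
  pow_lt : 2 * 2 ^ K < 𝓜.W
  lim_lt : n * 2 ^ K < 𝓜.W

/-- The memory contains the ordering and the lists of later neighbours. -/
structure Machine.Env (𝓜 : Machine G) (ord : VertexOrder n) (K : ℕ) (s : St n 𝓜.D.State) :
    Prop where
  dgn : s.mem .dgn 0 = K
  pow : s.mem .pow 0 = 2 ^ K
  lim : s.mem .lim 0 = n * 2 ^ K
  ordAt : ∀ i : Fin n, s.mem .ord i = ord i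
  posOf : ∀ v : Fin n, s.mem .pos v = ord.symm v
  len : ∀ v : Fin n, s.mem .len v = (𝓜.A.late ord v).length
  late : ∀ (v : Fin n) (i : ℕ) (h : i < (𝓜.A.late ord v).length),
    s.mem .late (v * K + i) = (𝓜.A.late ord v)[i]

/-- The variables that `Machine.Env` is about. -/
def envVars : List Var := [.dgn, .pow, .lim, .ord, .pos, .len, .late]

theorem Machine.Env.congr {𝓜 : Machine G} {ord : VertexOrder n} {K : ℕ} {s s' : St n 𝓜.D.State}
    (h : 𝓜.Env ord K s) (hs : ∀ a ∈ envVars, s'.mem a = s.mem a) : 𝓜.Env ord K s' := by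
  obtain ⟨h₁, h₂, h₃, h₄, h₅, h₆, h₇⟩ := h
  simp only [envVars, List.mem_cons, List.not_mem_nil, or_false, forall_eq_or_imp, forall_eq] at hs
  obtain ⟨e₁, e₂, e₃, e₄, e₅, e₆, e₇⟩ := hs
  exact ⟨e₁ ▸ h₁, e₂ ▸ h₂, e₃ ▸ h₃, e₄ ▸ h₄, e₅ ▸ h₅, e₆ ▸ h₆, e₇ ▸ h₇⟩

/-- The current set, as represented by the status of the vertices and by the dominance structure,
is `S`. -/
structure Machine.Holds (𝓜 : Machine G) (S : Finset (Fin n)) (s : St n 𝓜.D.State) : Prop where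
  st : ∀ v : Fin n, s.mem .st v = if v ∈ S then 1 else 0
  dom : 𝓜.D.toSet s.dom = S

/-- The first neighbours in `S` and the first defect of `S` have been computed. -/
structure Machine.Analysed (𝓜 : Machine G) (ord : VertexOrder n) (S : Finset (Fin n))
    (s : St n 𝓜.D.State) : Prop where
  fst : ∀ v : Fin n, s.mem .fst v = firstPos G ord S v
  agr : s.mem .agr 0 = agree G ord S

theorem Machine.Holds.congr {𝓜 : Machine G} {S : Finset (Fin n)} {s s' : St n 𝓜.D.State}
    (h : 𝓜.Holds S s) (h₁ : s'.mem .st = s.mem .st) (h₂ : s'.dom = s.dom) : 𝓜.Holds S s' :=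
  ⟨h₁ ▸ h.st, h₂ ▸ h.dom⟩

theorem Machine.Analysed.congr {𝓜 : Machine G} {ord : VertexOrder n} {S : Finset (Fin n)}
    {s s' : St n 𝓜.D.State} (h : 𝓜.Analysed ord S s) (h₁ : s'.mem .fst = s.mem .fst)
    (h₂ : s'.mem .agr = s.mem .agr) : 𝓜.Analysed ord S s' :=
  ⟨h₁ ▸ h.fst, h₂ ▸ h.agr⟩

/-- `s'` differs from `s` only in the variables from `l`, and possibly in the dominance
structure. -/
def Frame {σ : Type} (l : List Var) (s s' : St n σ) : Prop :=
  (∀ a, a ∉ l → s'.mem a = s.mem a) ∧ s'.cur = s.cur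

theorem Frame.refl {σ : Type} (l : List Var) (s : St n σ) : Frame l s s := ⟨fun _ _ => rfl, rfl⟩

theorem Frame.trans {σ : Type} {l : List Var} {s s' s'' : St n σ} (h : Frame l s s')
    (h' : Frame l s' s'') : Frame l s s'' :=
  ⟨fun a ha => (h'.1 a ha).trans (h.1 a ha), h'.2.trans h.2⟩

theorem Frame.mono {σ : Type} {l l' : List Var} {s s' : St n σ} (h : Frame l s s')
    (hl : l ⊆ l') : Frame l' s s' :=
  ⟨fun a ha => h.1 a fun h => ha (hl h), h.2⟩

theorem Frame.upd {σ : Type} {l : List Var} {s s' : St n σ} (h : Frame l s s') {a : Var}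
    (ha : a ∈ l) (x y : ℕ) : Frame l s (s'.upd a x y) :=
  ⟨fun b hb => by rw [← h.1 b hb]; exact St.upd_mem_of_ne _ _ _ _ (fun hba => hb (hba ▸ ha)),
    h.2⟩

theorem Frame.setDom {σ : Type} {l : List Var} {s s' : St n σ} (h : Frame l s s') (d : σ) :
    Frame l s { s' with dom := d } := h

theorem Machine.Env.frame {𝓜 : Machine G} {ord : VertexOrder n} {K : ℕ} {s s' : St n 𝓜.D.State}
    (h : 𝓜.Env ord K s) {l : List Var} (hs : Frame l s s') (hl : ∀ a ∈ envVars, a ∉ l) :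
    𝓜.Env ord K s' :=
  h.congr fun a ha => hs.1 a (hl a ha)

/-- The degree of the vertex in position `r`. -/
def AdjLists.degAt (A : AdjLists G) (ord : VertexOrder n) (r : ℕ) : ℕ :=
  if h : r < n then (A.nbrs (ord ⟨r, h⟩)).length else 0

/-- The sum of the degrees. -/
def AdjLists.degSum (A : AdjLists G) : ℕ := ∑ v, (A.nbrs v).length

theorem AdjLists.sum_degAt (A : AdjLists G) (ord : VertexOrder n) :
    ∑ r ∈ range n, A.degAt ord r = A.degSum := by
  rw [Finset.sum_range]
  simp only [AdjLists.degAt, Fin.is_lt, dif_pos, AdjLists.degSum]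
  exact Equiv.sum_comp ord fun v => (A.nbrs v).length

end representation

/-! ### A program for the greedy construction -/

/-- Add each vertex, in the given order, that has no neighbour in the current set. -/
def greedyProg : Prog :=
  forLoop .i1 .size (
    asg .u1 (.arr .ord (.var .i1)) ;;
    branch (.arr .st (.var .u1)) .skip (
      asg .ok (.lit 1) ;;
      forNbrs .u1 (branch (.arr .st (.var .x1)) (asg .ok (.lit 0)) .skip) ;;
      branch (.var .ok) (domInsert (.var .u1) ;; sto .st (.var .u1) (.lit 1)) .skip))

section greedy

variable {n : ℕ} {G : SimpleGraph (Fin n)}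

theorem lexPrefix_succ_of_mem {ord : VertexOrder n} {I : Finset (Fin n)} (i : Fin n)
    (h : ord i ∈ lexPrefix G ord I i) : lexPrefix G ord I (i + 1) = lexPrefix G ord I i := by
  rw [lexPrefix_succ]
  split_ifs
  · exact insert_eq_of_mem h
  · rfl

/-- The variables that the greedy construction changes. -/
def greedyVars : List Var := [.i1, .i2, .x1, .u1, .ok, .st]

/-- The invariant of the loop is that the current set is `lexPrefix`. -/
theorem greedyProg_spec {𝓜 : Machine G} {ord : VertexOrder n} {K : ℕ} (hp : 𝓜.Params ord K)
    {s : St n 𝓜.D.State} {I : Finset (Fin n)} (hE : 𝓜.Env ord K s) (hS : 𝓜.Holds I s) :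
    Run 𝓜 greedyProg s (5 * 𝓜.A.degSum + 12 * n + 2) (fun s' =>
      𝓜.Holds (lexFirstSuperset G ord I) s' ∧ Frame greedyVars s s') := by
  have hnX := hp.n_lt
  refine Run.forLoop n (fun r => 5 * 𝓜.A.degAt ord r + 10)
    (fun r s' => 𝓜.Holds (lexPrefix G ord I r) s' ∧ Frame greedyVars s s') 𝓜.hnW ?_ ?_ ?_ ?_ ?_
  · rw [lexPrefix_zero]
    exact ⟨hS.congr rfl rfl, (Frame.refl _ s).upd (by decide) _ _⟩
  · intros; exact ⟨trivial, rfl⟩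
  · rintro r s₁ hr ⟨h₁, hF₁⟩ hir
    have hE₁ := hE.frame hF₁ (by decide)
    obtain ⟨v, hv⟩ : ∃ v, v = ord ⟨r, hr⟩ := ⟨_, rfl⟩
    have hov : s₁.mem .ord r = v := by rw [hv]; exact hE₁.ordAt ⟨r, hr⟩
    have hdeg : 𝓜.A.degAt ord r = (𝓜.A.nbrs v).length := by simp [AdjLists.degAt, hr, hv]
    have hvn := v.2
    rw [hdeg]
    refine Run.seq (t₁ := 1) (t₂ := 5 * (𝓜.A.nbrs v).length + 9)
      (R := fun s' => s' = s₁.upd .u1 0 v) (Run.asg (t := 0) ?_ ?_ rfl) ?_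
    · exact ⟨trivial, by simp only [Ex.eval, hir]; omega⟩
    · simp [Ex.eval, hir, hov]
    rintro _ rfl
    refine Run.branch ⟨trivial, ?_⟩ ?_ ?_
    · simp only [Ex.eval, St.upd_mem]; simp; omega
    · intro hne
      have hmem : v ∈ lexPrefix G ord I r := by
        by_contra hcon
        exact hne (by simp [Ex.eval, St.upd_mem, h₁.st, hcon])
      refine Run.skip ⟨by simp [St.upd_mem, hir], ?_, ?_⟩
      · have := lexPrefix_succ_of_mem (G := G) (ord := ord) (I := I) ⟨r, hr⟩ (hv ▸ hmem)
        dsimp only at this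
        rw [this]
        exact h₁.congr rfl rfl
      · exact (hF₁.upd (by decide) _ _).upd (by decide) _ _
    · intro h0
      have hmem : v ∉ lexPrefix G ord I r := by
        intro hcon
        simp [Ex.eval, St.upd_mem, h₁.st, hcon] at h0
      refine Run.seq (t₁ := 1) (t₂ := 5 * (𝓜.A.nbrs v).length + 7)
        (R := fun s' => s' = (s₁.upd .u1 0 v).upd .ok 0 1)
        (Run.asg (t := 0) (by simp [Ex.Ok]) rfl rfl) ?_
      rintro _ rfl
      refine Run.seq (t₁ := 5 * (𝓜.A.nbrs v).length + 2) (t₂ := 3)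
        (R := fun s' => (s'.mem .i1 0 = r ∧ s'.mem .u1 0 = v ∧ 𝓜.Holds (lexPrefix G ord I r) s' ∧
          Frame greedyVars s s') ∧ s'.mem .ok 0 =
            if ∀ x ∈ 𝓜.A.nbrs v, x ∉ lexPrefix G ord I r then 1 else 0) ?_ ?_
      · refine Run.forNbrs v 2 (fun l s' => (s'.mem .i1 0 = r ∧ s'.mem .u1 0 = v ∧
            𝓜.Holds (lexPrefix G ord I r) s' ∧ Frame greedyVars s s') ∧ s'.mem .ok 0 =
            if ∀ x ∈ l, x ∉ lexPrefix G ord I r then 1 else 0) ?_ ?_ ?_ ?_ ?_ ?_ ?_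
        · exact ⟨⟨by simp [St.upd_mem, hir], by simp [St.upd_mem], h₁.congr rfl rfl,
            (hF₁.upd (by decide) _ _).upd (by decide) _ _⟩, by simp [St.upd_mem]⟩
        · rintro l s' z ⟨⟨a₁, a₂, a₃, a₄⟩, a₅⟩
          exact ⟨⟨by simpa [St.upd_mem] using a₁, by simpa [St.upd_mem] using a₂,
            a₃.congr rfl rfl, a₄.upd (by decide) _ _⟩, by simpa [St.upd_mem] using a₅⟩
        · rintro l s' z ⟨⟨a₁, a₂, a₃, a₄⟩, a₅⟩
          exact ⟨⟨by simpa [St.upd_mem] using a₁, by simpa [St.upd_mem] using a₂,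
            a₃.congr rfl rfl, a₄.upd (by decide) _ _⟩, by simpa [St.upd_mem] using a₅⟩
        · rintro l s' ⟨⟨a₁, a₂, a₃, a₄⟩, a₅⟩
          exact a₂
        · rintro l x s' - ⟨⟨a₁, a₂, a₃, a₄⟩, a₅⟩ hx
          refine Run.branch ⟨trivial, ?_⟩ ?_ ?_
          · simp only [Ex.eval, hx]; omega
          · intro hne
            refine Run.asg (t := 0) (by simp [Ex.Ok]) rfl ⟨by simp [St.upd_mem],
              ⟨by simpa [St.upd_mem] using a₁, by simpa [St.upd_mem] using a₂, a₃.congr rfl rfl,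
              a₄.upd (by decide) _ _⟩, ?_⟩
            have : x ∈ lexPrefix G ord I r := by
              by_contra hcon
              exact hne (by simp [Ex.eval, hx, a₃.st, hcon])
            rw [if_neg (fun h => h x (by simp) this)]
            simp [St.upd_mem, Ex.eval]
          · intro h0
            have : x ∉ lexPrefix G ord I r := by
              intro hcon
              simp [Ex.eval, hx, a₃.st, hcon] at h0
            refine Run.skip ⟨rfl, ⟨a₁, a₂, a₃, a₄⟩, ?_⟩
            rw [a₅]
            simp [or_imp, forall_and, this]
        · exact fun _ h => h
        · omega
      · rintro s₂ ⟨⟨a₁, a₂, a₃, a₄⟩, a₅⟩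
        have hstep := lexPrefix_succ G ord I ⟨r, hr⟩
        have hiff : (∀ x ∈ 𝓜.A.nbrs v, x ∉ lexPrefix G ord I r) ↔
            ∀ u ∈ lexPrefix G ord I r, ¬ G.Adj u v := by
          simp only [𝓜.A.mem_iff, G.adj_comm v]
          exact ⟨fun h u hu huv => h u huv hu, fun h u huv hu => h u hu huv⟩
        rw [← hv] at hstep
        dsimp only at hstep
        refine Run.branch trivial ?_ ?_
        · intro hne
          have hfree : ∀ x ∈ 𝓜.A.nbrs v, x ∉ lexPrefix G ord I r := by
            by_contra hcon
            exact hne (by simp only [Ex.eval, a₅, if_neg hcon])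
          rw [if_pos (hiff.1 hfree)] at hstep
          refine Run.seq (t₁ := 1) (t₂ := 1)
            (R := fun s' => s' = { s₂ with dom := 𝓜.D.insert v s₂.dom })
            (Run.domInsert (t := 0) trivial a₂ (by rw [a₃.dom]; exact hmem) rfl) ?_
          rintro _ rfl
          refine Run.sto (t := 0) (y := v) (z := 1) trivial a₂ (by omega) (by simp [Ex.Ok]) rfl ?_
          refine ⟨by simpa [St.upd_mem] using a₁, ⟨?_, ?_⟩, ?_⟩
          · intro w
            rw [hstep]
            have := a₃.st w
            by_cases hwv : w = v
            · simp [St.upd_mem, hwv]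
            · have : (w : ℕ) ≠ v := fun h => hwv (Fin.ext h)
              simp [St.upd_mem, hwv, this, a₃.st]
          · rw [hstep, ← a₃.dom]
            exact 𝓜.D.toSet_insert v _ (by rw [a₃.dom]; exact hmem)
          · exact ((a₄.setDom _).upd (by decide) _ _).upd (by decide) _ _
        · intro h0
          have hfree : ¬ ∀ x ∈ 𝓜.A.nbrs v, x ∉ lexPrefix G ord I r := by
            intro hcon
            simp only [Ex.eval, a₅, if_pos hcon] at h0
            omega
          rw [if_neg (fun h => hfree (hiff.2 h))] at hstep
          refine Run.skip ⟨a₁, ?_, a₄.upd (by decide) _ _⟩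
          rw [hstep]
          exact a₃.congr rfl rfl
  · rintro s' ⟨h₁, h₂⟩
    rw [lexPrefix_last] at h₁
    exact ⟨h₁, h₂⟩
  · have := 𝓜.A.sum_degAt ord
    simp only [add_assoc, Finset.sum_add_distrib, ← Finset.mul_sum, this, sum_const, card_range,
      smul_eq_mul]
    omega

end greedy


/-! ### Analysing and printing the current set -/

/-- Compute the first neighbour of each vertex in the current set, and the first defect. -/
def analyseProg : Prog :=
  asg .agr .size ;;
  forLoop .i1 .size (
    asg .u1 (.arr .ord (.var .i1)) ;;
    sto .fst (.var .u1) .size ;;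
    forNbrs .u1 (
      branch (.arr .st (.var .x1))
        (branch (.op .lt (.arr .pos (.var .x1)) (.arr .fst (.var .u1)))
          (sto .fst (.var .u1) (.arr .pos (.var .x1))) .skip) .skip) ;;
    branch (.arr .st (.var .u1)) .skip
      (branch (.op .lt (.var .i1) (.arr .fst (.var .u1)))
        (branch (.op .lt (.var .i1) (.var .agr)) (asg .agr (.var .i1)) .skip) .skip))

/-- Print the current set. -/
def emitProg : Prog :=
  forLoop .i1 .size (branch (.arr .st (.var .i1)) (emitVertex (.var .i1)) .skip)

/-- The variables that the analysis changes. -/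
def analyseVars : List Var := [.i1, .i2, .x1, .u1, .fst, .agr]

section

variable {n : ℕ} {G : SimpleGraph (Fin n)}

open Classical in
/-- How the position of the first defect, among the vertices considered so far, is updated when the
vertex `v` in position `r` is considered. -/
theorem agree_step {ord : VertexOrder n} {S : Finset (Fin n)} {v : Fin n} {r : ℕ}
    (hv : (ord.symm v : ℕ) = r) :
    (if agree G ord S < r + 1 then agree G ord S else n) =
      if Defect G ord S v ∧ r < (if agree G ord S < r then agree G ord S else n) then r
      else if agree G ord S < r then agree G ord S else n := by
  have hvn := (ord.symm v).2
  by_cases hlt : agree G ord S < r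
  · rw [if_pos (by omega), if_pos hlt, if_neg (by omega)]
  · rw [if_neg hlt]
    by_cases hd : Defect G ord S v
    · have := agree_le_of_defect hd
      rw [if_pos (by omega), if_pos ⟨hd, by omega⟩]
      omega
    · rw [if_neg (fun h : Defect G ord S v ∧ r < n => hd h.1), if_neg]
      intro h
      have heq : agree G ord S = r := by omega
      have := defect_of_agree_lt (G := G) (ord := ord) (S := S) (by omega)
      apply hd
      have hv' : ord ⟨agree G ord S, by omega⟩ = v := by
        rw [← Equiv.eq_symm_apply]; exact Fin.ext (heq.trans hv.symm)
      rwa [hv'] at this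

theorem analyseProg_spec {𝓜 : Machine G} {ord : VertexOrder n} {K : ℕ} (hp : 𝓜.Params ord K)
    {s : St n 𝓜.D.State} {S : Finset (Fin n)} (hE : 𝓜.Env ord K s) (hS : 𝓜.Holds S s) :
    Run 𝓜 analyseProg s (6 * 𝓜.A.degSum + 11 * n + 3) (fun s' =>
      𝓜.Holds S s' ∧ 𝓜.Analysed ord S s' ∧ Frame analyseVars s s') := by
  classical
  have hnX := hp.n_lt
  refine Run.seq (t₁ := 1) (t₂ := 6 * 𝓜.A.degSum + 11 * n + 2) (R := fun s' => s' = s.upd .agr 0 n)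
    (Run.asg (t := 0) trivial rfl rfl) ?_
  rintro _ rfl
  refine Run.forLoop n (fun r => 6 * 𝓜.A.degAt ord r + 9)
    (fun r s' => (𝓜.Holds S s' ∧ Frame analyseVars s s') ∧
      (∀ v : Fin n, (ord.symm v : ℕ) < r → s'.mem .fst v = firstPos G ord S v) ∧
      s'.mem .agr 0 = if agree G ord S < r then agree G ord S else n) 𝓜.hnW ?_ ?_ ?_ ?_ ?_
  · exact ⟨⟨hS.congr rfl rfl, ((Frame.refl _ s).upd (by decide) _ _).upd (by decide) _ _⟩,
      by simp, by simp [St.upd_mem]⟩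
  · intros; exact ⟨trivial, rfl⟩
  · rintro r s₁ hr ⟨⟨h₁, hF₁⟩, hfst, hagr⟩ hir
    have hE₁ := hE.frame hF₁ (by decide)
    obtain ⟨v, hv⟩ : ∃ v, v = ord ⟨r, hr⟩ := ⟨_, rfl⟩
    have hov : s₁.mem .ord r = v := by rw [hv]; exact hE₁.ordAt ⟨r, hr⟩
    have hvr : (ord.symm v : ℕ) = r := by rw [hv]; simp
    have hdeg : 𝓜.A.degAt ord r = (𝓜.A.nbrs v).length := by simp [AdjLists.degAt, hr, hv]
    have hvn := v.2
    rw [hdeg]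
    refine Run.seq (t₁ := 1) (t₂ := 6 * (𝓜.A.nbrs v).length + 8)
      (R := fun s' => s' = s₁.upd .u1 0 v) (Run.asg (t := 0) ?_ ?_ rfl) ?_
    · exact ⟨trivial, by simp only [Ex.eval, hir]; omega⟩
    · simp [Ex.eval, hir, hov]
    rintro _ rfl
    refine Run.seq (t₁ := 1) (t₂ := 6 * (𝓜.A.nbrs v).length + 7)
      (R := fun s' => s' = (s₁.upd .u1 0 v).upd .fst v n)
      (Run.sto (t := 0) trivial (by simp [Ex.eval, St.upd_mem]) (by omega) trivial rfl rfl) ?_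
    rintro _ rfl
    -- The part of the invariant that the inner loop only preserves.
    let I₀ : St n 𝓜.D.State → Prop := fun s' => (s'.mem .i1 0 = r ∧ s'.mem .u1 0 = v ∧
      𝓜.Holds S s' ∧ Frame analyseVars s s') ∧
      (∀ v : Fin n, (ord.symm v : ℕ) < r → s'.mem .fst v = firstPos G ord S v) ∧
      s'.mem .agr 0 = if agree G ord S < r then agree G ord S else n
    have hstab : ∀ s' a z, a = .i2 ∨ a = .x1 → I₀ s' → I₀ (s'.upd a 0 z) := by
      rintro s' a z ha ⟨⟨a₁, a₂, a₃, a₄⟩, a₅, a₆⟩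
      have hmem : ∀ b, b ≠ .i2 → b ≠ .x1 → (s'.upd a 0 z).mem b = s'.mem b := by
        intro b h₁ h₂
        refine St.upd_mem_of_ne _ _ _ _ ?_
        rcases ha with rfl | rfl <;> assumption
      refine ⟨⟨?_, ?_, a₃.congr (hmem _ (by decide) (by decide)) rfl, a₄.upd ?_ _ _⟩, ?_, ?_⟩
      · rw [hmem _ (by decide) (by decide)]; exact a₁
      · rw [hmem _ (by decide) (by decide)]; exact a₂
      · rcases ha with rfl | rfl <;> decide
      · rw [hmem _ (by decide) (by decide)]; exact a₅
      · rw [hmem _ (by decide) (by decide)]; exact a₆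
    have hsetfst : ∀ s' z, I₀ s' → I₀ (s'.upd .fst v z) := by
      rintro s' z ⟨⟨a₁, a₂, a₃, a₄⟩, a₅, a₆⟩
      refine ⟨⟨by simpa [St.upd_mem] using a₁, by simpa [St.upd_mem] using a₂, a₃.congr rfl rfl,
        a₄.upd (by decide) _ _⟩, fun w hw => ?_, by simpa [St.upd_mem] using a₆⟩
      have : (w : ℕ) ≠ v := fun h => by rw [Fin.ext h] at hw; omega
      simpa [St.upd_mem, this] using a₅ w hw
    have hinit : I₀ (s₁.upd .u1 0 v) :=
      ⟨⟨by simp [St.upd_mem, hir], by simp [St.upd_mem], h₁.congr rfl rfl,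
        hF₁.upd (by decide) _ _⟩, hfst, hagr⟩
    refine Run.seq (t₁ := 6 * (𝓜.A.nbrs v).length + 2) (t₂ := 5)
      (R := fun s' => I₀ s' ∧ s'.mem .fst v = firstPos G ord S v) ?_ ?_
    · refine Run.forNbrs v 3 (fun l s' => I₀ s' ∧ s'.mem .fst v =
        (S.filter (· ∈ l)).fold min n (fun x => (ord.symm x : ℕ))) ?_ ?_ ?_ ?_ ?_ ?_ ?_
      · exact ⟨hsetfst _ _ hinit, by simp [St.upd_mem]⟩
      · rintro l s' z ⟨h, h'⟩
        exact ⟨hstab _ _ _ (Or.inl rfl) h, by simpa [St.upd_mem] using h'⟩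
      · rintro l s' z ⟨h, h'⟩
        exact ⟨hstab _ _ _ (Or.inr rfl) h, by simpa [St.upd_mem] using h'⟩
      · rintro l s' ⟨h, -⟩
        exact h.1.2.1
      · rintro l x s' - ⟨h, h'⟩ hx
        obtain ⟨⟨a₁, a₂, a₃, a₄⟩, a₅, a₆⟩ := id h
        have hE' := hE.frame a₄ (by decide)
        have hxX : (x : ℕ) < 𝓜.X := x.2.trans hnX
        have hvX : (v : ℕ) < 𝓜.X := v.2.trans hnX
        have hpx := hE'.posOf x
        refine Run.branch (t := 2) ⟨trivial, by simpa [Ex.eval, hx] using hxX⟩ ?_ ?_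
        · intro hne
          have hxS : x ∈ S := by
            by_contra hcon
            exact hne (by simp [Ex.eval, hx, a₃.st, hcon])
          have hfil : S.filter (· ∈ l ++ [x]) = insert x (S.filter (· ∈ l)) := by
            ext y; simp only [mem_filter, List.mem_append, List.mem_singleton, mem_insert]
            constructor
            · tauto
            · rintro (rfl | h) <;> tauto
          rw [hfil, Finset.fold_insert_idem, ← h']
          refine Run.branch (t := 1) ⟨⟨trivial, by simpa [Ex.eval, hx] using hxX⟩,
            ⟨trivial, by simpa [Ex.eval, a₂] using hvX⟩, trivial⟩ ?_ ?_
          · intro hlt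
            have hlt : (ord.symm x : ℕ) < s'.mem .fst v := by
              by_contra hcon
              exact hlt (by simp [Ex.eval, BinOp.apply, hx, a₂, hpx, hcon])
            refine Run.sto (t := 0) trivial a₂ hvX ⟨trivial, by simpa [Ex.eval, hx] using hxX⟩
              (z := ord.symm x) (by simp [Ex.eval, hx, hpx])
              ⟨by simp [St.upd_mem], hsetfst _ _ h, ?_⟩
            simp only [St.upd_mem, and_self, if_true]
            omega
          · intro hge
            have hge : ¬ (ord.symm x : ℕ) < s'.mem .fst v := by
              intro hcon
              simp [Ex.eval, BinOp.apply, hx, a₂, hpx, hcon] at hge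
            exact Run.skip ⟨rfl, h, by omega⟩
        · intro h0
          have hxS : x ∉ S := by
            intro hcon
            simp [Ex.eval, hx, a₃.st, hcon] at h0
          have hfil : S.filter (· ∈ l ++ [x]) = S.filter (· ∈ l) := by
            ext y; simp only [mem_filter, List.mem_append, List.mem_singleton]
            constructor
            · rintro ⟨h, h' | rfl⟩
              · exact ⟨h, h'⟩
              · exact absurd h hxS
            · tauto
          rw [hfil]
          exact Run.skip ⟨rfl, h, h'⟩
      · rintro s' ⟨h, h'⟩
        refine ⟨h, h'.trans ?_⟩
        unfold firstPos
        congr 1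
        ext y; simp [𝓜.A.mem_iff]
      · omega
    · rintro s₂ ⟨⟨⟨a₁, a₂, a₃, a₄⟩, a₅, a₆⟩, a₇⟩
      have hvX : (v : ℕ) < 𝓜.X := v.2.trans hnX
      have hfst' : ∀ w : Fin n, (ord.symm w : ℕ) < r + 1 → s₂.mem .fst w = firstPos G ord S w := by
        intro w hw
        by_cases hwv : w = v
        · rw [hwv]; exact a₇
        · have : (ord.symm w : ℕ) ≠ ord.symm v :=
            fun h => hwv (ord.symm.injective (Fin.ext h))
          exact a₅ w (by omega)
      have hstep := agree_step (G := G) (S := S) hvr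
      -- Nothing changes unless `v` is the first defect.
      have hnone : ¬ (Defect G ord S v ∧ r < s₂.mem .agr 0) → s₂.mem .i1 0 = r ∧
          (𝓜.Holds S (s₂.upd .i1 0 (r + 1)) ∧ Frame analyseVars s (s₂.upd .i1 0 (r + 1))) ∧
          (∀ v : Fin n, (ord.symm v : ℕ) < r + 1 →
            (s₂.upd .i1 0 (r + 1)).mem .fst v = firstPos G ord S v) ∧
          (s₂.upd .i1 0 (r + 1)).mem .agr 0 =
            if agree G ord S < r + 1 then agree G ord S else n := by
        intro hn
        refine ⟨a₁, ⟨a₃.congr rfl rfl, a₄.upd (by decide) _ _⟩, hfst', ?_⟩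
        rw [hstep, ← a₆, if_neg hn]
        rfl
      refine Run.branch ⟨trivial, by simpa [Ex.eval, a₂] using hvX⟩ ?_ ?_
      · intro hne
        refine Run.skip (hnone fun hd => hd.1.1 ?_)
        by_contra hcon
        exact hne (by simp [Ex.eval, a₂, a₃.st, hcon])
      · intro h0
        have hvS : v ∉ S := by
          intro hcon
          simp [Ex.eval, a₂, a₃.st, hcon] at h0
        have hdef : Defect G ord S v ↔ r < firstPos G ord S v := by
          rw [Defect, hvr]; simp [hvS]
        refine Run.branch ⟨trivial, ⟨trivial, by simpa [Ex.eval, a₂] using hvX⟩, trivial⟩ ?_ ?_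
        · intro hlt
          have hlt : r < firstPos G ord S v := by
            by_contra hcon
            exact hlt (by simp [Ex.eval, BinOp.apply, a₁, a₂, a₇, hcon])
          refine Run.branch ⟨trivial, trivial, trivial⟩ ?_ ?_
          · intro hlt'
            have hlt' : r < s₂.mem .agr 0 := by
              by_contra hcon
              exact hlt' (by simp [Ex.eval, BinOp.apply, a₁, hcon])
            refine Run.asg trivial a₁ ⟨by simp [St.upd_mem, a₁],
              ⟨a₃.congr rfl rfl, (a₄.upd (by decide) _ _).upd (by decide) _ _⟩, hfst', ?_⟩
            rw [hstep, ← a₆, if_pos ⟨hdef.2 hlt, hlt'⟩]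
            simp [St.upd_mem]
          · intro hge
            refine Run.skip (hnone fun hd => ?_)
            simp [Ex.eval, BinOp.apply, a₁, hd.2] at hge
        · intro hge
          refine Run.skip (hnone fun hd => ?_)
          simp [Ex.eval, BinOp.apply, a₁, a₂, a₇, hdef.1 hd.1] at hge
  · rintro s' ⟨⟨h₁, h₂⟩, h₃, h₄⟩
    refine ⟨h₁, ⟨fun v => h₃ v (ord.symm v).2, ?_⟩, h₂⟩
    have := agree_le (G := G) (ord := ord) (S := S)
    rw [h₄]
    split_ifs <;> omega
  · have := 𝓜.A.sum_degAt ord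
    simp only [add_assoc, Finset.sum_add_distrib, ← Finset.mul_sum, this, sum_const, card_range,
      smul_eq_mul]
    omega

/-- Only the counter and the output change. -/
theorem emitProg_spec {𝓜 : Machine G} {s : St n 𝓜.D.State} {S : Finset (Fin n)}
    (hnX : n < 𝓜.X) (hS : 𝓜.Holds S s) :
    Run 𝓜 emitProg s (4 * n + 2) (fun s' => Frame [.i1] s { s' with cur := s.cur } ∧
      s'.dom = s.dom ∧ s'.cur = s.cur ++ (List.finRange n).filter (· ∈ S)) := by
  refine Run.forLoop n (fun _ => 2) (fun r s' => Frame [.i1] s { s' with cur := s.cur } ∧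
      s'.dom = s.dom ∧ s'.cur = s.cur ++ ((List.finRange n).take r).filter (· ∈ S))
      𝓜.hnW ?_ ?_ ?_ ?_ ?_
  · exact ⟨(Frame.refl _ s).upd (by decide) _ _, rfl, by simp⟩
  · intros; exact ⟨trivial, rfl⟩
  · rintro r s₁ hr ⟨h₁, h₂, h₃⟩ hir
    have hst : s₁.mem .st r = if (⟨r, hr⟩ : Fin n) ∈ S then 1 else 0 := by
      have := h₁.1 .st (by decide)
      dsimp only at this
      rw [this]; exact hS.st ⟨r, hr⟩
    have htake : (List.finRange n).take (r + 1) = (List.finRange n).take r ++ [⟨r, hr⟩] := by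
      rw [List.take_add_one, List.getElem?_eq_getElem (by simpa using hr)]
      simp
    have hF : ∀ l, Frame [.i1] s { ({ s₁ with cur := l } : St n _).upd .i1 0 (r + 1) with
        cur := s.cur } := fun l => h₁.upd (by decide) _ _
    refine Run.branch ⟨trivial, by simp only [Ex.eval, hir]; omega⟩ ?_ ?_
    · intro hne
      have hmem : (⟨r, hr⟩ : Fin n) ∈ S := by
        by_contra hcon
        exact hne (by simp [Ex.eval, hir, hst, hcon])
      refine Run.emitVertex (t := 0) (v := ⟨r, hr⟩) trivial hir ⟨hir, hF _, h₂, ?_⟩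
      rw [htake]
      simp [h₃, hmem]
    · intro h0
      have hmem : (⟨r, hr⟩ : Fin n) ∉ S := by
        intro hcon
        simp [Ex.eval, hir, hst, hcon] at h0
      refine Run.skip ⟨hir, hF _, h₂, ?_⟩
      rw [htake]
      simp [h₃, hmem]
  · rintro s' ⟨h₁, h₂, h₃⟩
    refine ⟨h₁, h₂, ?_⟩
    rw [h₃, List.take_of_length_le (by simp)]
  · simp; omega

end


/-! ### Loops over the members of a candidate and their neighbours -/

/-- Execute `p` for each entry `w1` of the list `lst`. -/
def forMembers (p : Prog) : Prog :=
  forLoop .i3 (.var .cnt) (asg .w1 (.arr .lst (.var .i3)) ;; p)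

/-- Execute `p` for each neighbour `x1` of each entry of the list `lst`. -/
def forPairs (p : Prog) : Prog := forMembers (forNbrs .w1 p)

section

variable {n : ℕ} {G : SimpleGraph (Fin n)}

/-- The list `lst` is `N`. -/
structure HasList {σ : Type} (N : List (Fin n)) (s : St n σ) : Prop where
  cnt : s.mem .cnt 0 = N.length
  lst : ∀ (i : ℕ) (h : i < N.length), s.mem .lst i = N[i]

theorem HasList.frame {σ : Type} {N : List (Fin n)} {s s' : St n σ} (h : HasList N s)
    {l : List Var} (hs : Frame l s s') (h₁ : Var.lst ∉ l) (h₂ : Var.cnt ∉ l) : HasList N s' :=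
  ⟨hs.1 _ h₂ ▸ h.cnt, hs.1 _ h₁ ▸ h.lst⟩

/-- Rule for loops over the list `lst`.  The invariant is indexed by the list of members that have
been processed.  -/
theorem Run.forMembers {𝓜 : Machine G} {s : St n 𝓜.D.State} {t : ℕ} {Q : St n 𝓜.D.State → Prop}
    {p : Prog} (hnX : n < 𝓜.X) (N : List (Fin n)) (hN : N.Nodup) (b : Fin n → ℕ)
    (I : List (Fin n) → St n 𝓜.D.State → Prop)
    (h0 : I [] s) (hi : ∀ l s z, I l s → I l (s.upd .i3 0 z))
    (hw : ∀ l s z, I l s → I l (s.upd .w1 0 z)) (hL : ∀ l s, I l s → HasList N s)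
    (hstep : ∀ l (w : Fin n) s, l ++ [w] <+: N → I l s → s.mem .w1 0 = w →
      Run 𝓜 p s (b w) (fun s' => s'.mem .i3 0 = s.mem .i3 0 ∧ I (l ++ [w]) s'))
    (hend : ∀ s, I N s → Q s) (ht : (N.map fun w => b w + 3).sum + 2 ≤ t) :
    Run 𝓜 (forMembers p) s t Q := by
  have hnW := 𝓜.hnW
  have hle : N.length ≤ n := by simpa using hN.length_le_card
  refine Run.forLoop N.length (fun r => if h : r < N.length then b N[r] + 1 else 0)
    (fun r s => I (N.take r) s) (by omega) (hi _ _ _ (by simpa using h0)) ?_ ?_ ?_ ?_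
  · intro r s _ hI
    exact ⟨trivial, (hL _ _ hI).cnt⟩
  · intro r s hr hI hir
    have hlst := (hL _ _ hI).lst r hr
    rw [dif_pos hr]
    refine Run.seq (t₁ := 1) (t₂ := b N[r]) (R := fun s' => s' = s.upd .w1 0 N[r])
      (Run.asg (t := 0) ?_ ?_ rfl) ?_
    · exact ⟨trivial, by simp only [Ex.eval, hir]; omega⟩
    · simp [Ex.eval, hir, hlst]
    · rintro _ rfl
      have htake : N.take r ++ [N[r]] = N.take (r + 1) := by simp
      refine (hstep _ N[r] _ (htake ▸ List.take_prefix _ _) (hw _ _ _ hI)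
        (by simp [St.upd_mem])).imp ?_
      rintro s' ⟨h₁, h₂⟩
      refine ⟨by simpa [St.upd_mem, hir] using h₁, hi _ _ _ ?_⟩
      rwa [htake] at h₂
  · intro s hI
    rw [List.take_length] at hI
    exact hend s hI
  · refine le_trans (le_of_eq ?_) ht
    congr 1
    rw [Finset.sum_range, ← Fin.sum_univ_fun_getElem]
    refine Finset.sum_congr rfl fun i _ => ?_
    simp

/-- The number of steps of a loop over all neighbours of the members of a list. -/
def AdjLists.size (A : AdjLists G) (N : List (Fin n)) : ℕ :=
  (N.map fun w => (A.nbrs w).length + 1).sum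

theorem sum_map_le_mul {α : Type} (l : List α) (f g : α → ℕ) (c : ℕ)
    (h : ∀ x, f x ≤ c * g x) : (l.map f).sum ≤ c * (l.map g).sum := by
  induction l with
  | nil => simp
  | cons x l ih =>
    simp only [List.map_cons, List.sum_cons, mul_add]
    have := h x
    omega

theorem AdjLists.length_le_size (A : AdjLists G) (N : List (Fin n)) : N.length ≤ A.size N := by
  simp [AdjLists.size]

/-- Rule for loops over the neighbours of members.  The invariant is indexed by the list of
neighbours that have been processed; it contains a vertex several times if this is a neighbour of
several members.  -/
theorem Run.forPairs {𝓜 : Machine G} {s : St n 𝓜.D.State} {t : ℕ} {Q : St n 𝓜.D.State → Prop}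
    {p : Prog} (hnX : n < 𝓜.X) (N : List (Fin n)) (hN : N.Nodup) (b : ℕ)
    (I : List (Fin n) → St n 𝓜.D.State → Prop) (h0 : I [] s)
    (hi : ∀ l s a z, a ∈ [Var.i2, .i3, .w1, .x1] → I l s → I l (s.upd a 0 z))
    (hL : ∀ l s, I l s → HasList N s)
    (hstep : ∀ l (w x : Fin n) s, w ∈ N → x ∈ 𝓜.A.nbrs w → I l s → s.mem .x1 0 = x →
      Run 𝓜 p s b (fun s' => (∀ a ∈ [Var.i2, .i3, .w1], s'.mem a = s.mem a) ∧ I (l ++ [x]) s'))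
    (hend : ∀ s, I (N.flatMap 𝓜.A.nbrs) s → Q s) (ht : (b + 5) * 𝓜.A.size N + 2 ≤ t) :
    Run 𝓜 (forPairs p) s t Q := by
  refine Run.forMembers hnX N hN (fun w => (b + 3) * (𝓜.A.nbrs w).length + 2)
    (fun l s => I (l.flatMap 𝓜.A.nbrs) s) h0 (fun l s z h => hi _ _ _ _ (by decide) h)
    (fun l s z h => hi _ _ _ _ (by decide) h) (fun l s h => hL _ _ h) ?_ hend ?_
  · intro l w s' hl hI hw
    have hwN : w ∈ N := hl.subset (by simp)
    refine Run.forNbrs w b (fun l' s'' => I (l.flatMap 𝓜.A.nbrs ++ l') s'' ∧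
      s''.mem .i3 0 = s'.mem .i3 0 ∧ s''.mem .w1 0 = w) ?_ ?_ ?_ ?_ ?_ ?_ le_rfl
    · exact ⟨by simpa using hI, rfl, hw⟩
    · rintro l' s'' z ⟨h₁, h₂, h₃⟩
      exact ⟨hi _ _ _ _ (by decide) h₁, by simpa [St.upd_mem] using h₂,
        by simpa [St.upd_mem] using h₃⟩
    · rintro l' s'' z ⟨h₁, h₂, h₃⟩
      exact ⟨hi _ _ _ _ (by decide) h₁, by simpa [St.upd_mem] using h₂,
        by simpa [St.upd_mem] using h₃⟩
    · rintro l' s'' ⟨h₁, h₂, h₃⟩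
      exact h₃
    · rintro l' x s'' hx ⟨h₁, h₂, h₃⟩ hxx
      refine (hstep _ w x s'' hwN (hx.subset (by simp)) h₁ hxx).imp ?_
      rintro s₃ ⟨h₄, h₅⟩
      rw [h₄ .i2 (by decide), h₄ .i3 (by decide), h₄ .w1 (by decide)]
      exact ⟨rfl, by simpa using h₅, h₂, h₃⟩
    · rintro s'' ⟨h₁, h₂, h₃⟩
      exact ⟨h₂, by simpa using h₁⟩
  · refine le_trans ?_ ht
    have := sum_map_le_mul N (fun w => (b + 3) * (𝓜.A.nbrs w).length + 2 + 3)
      (fun w => (𝓜.A.nbrs w).length + 1) (b + 5) (by intro w; nlinarith)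
    rw [AdjLists.size]
    omega

/-! ### Changing the status of vertices -/

/-- The vertices have the status `φ`, and the vertices of odd status form the set maintained by the
dominance structure. -/
structure Machine.Status (𝓜 : Machine G) (φ : Fin n → ℕ) (s : St n 𝓜.D.State) : Prop where
  st : ∀ v : Fin n, s.mem .st v = φ v
  dom : 𝓜.D.toSet s.dom = univ.filter fun v => φ v % 2 = 1

theorem Machine.Status.congr {𝓜 : Machine G} {φ : Fin n → ℕ} {s s' : St n 𝓜.D.State}
    (h : 𝓜.Status φ s) (h₁ : s'.mem .st = s.mem .st) (h₂ : s'.dom = s.dom) : 𝓜.Status φ s' :=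
  ⟨h₁ ▸ h.st, h₂ ▸ h.dom⟩

theorem Machine.holds_iff_status {𝓜 : Machine G} {S : Finset (Fin n)} {s : St n 𝓜.D.State} :
    𝓜.Holds S s ↔ 𝓜.Status (fun v => if v ∈ S then 1 else 0) s := by
  have : (univ.filter fun v => (if v ∈ S then 1 else 0) % 2 = 1) = S := by
    ext v; by_cases hv : v ∈ S <;> simp [hv]
  constructor
  · rintro ⟨h₁, h₂⟩
    exact ⟨h₁, by rw [h₂, this]⟩
  · rintro ⟨h₁, h₂⟩
    exact ⟨h₁, by rw [h₂, this]⟩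

/-- Give the vertex `y` the status `β`, when it enters the maintained set. -/
def setIn (y : Var) (β : ℕ) : Prog := domInsert (.var y) ;; sto .st (.var y) (.lit β)

/-- Give the vertex `y` the status `β`, when it leaves the maintained set. -/
def setOut (y : Var) (β : ℕ) : Prog := domDelete (.var y) ;; sto .st (.var y) (.lit β)

/-- Give the vertex `y` the status `β`, when the maintained set does not change. -/
def setKeep (y : Var) (β : ℕ) : Prog := sto .st (.var y) (.lit β)

/-- The program `p` changes the status of the vertex `y` to `β`, if it has been `α`. -/
def Machine.Recolours (𝓜 : Machine G) (p : Prog) (y : Var) (α β : ℕ) : Prop :=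
  ∀ (φ : Fin n → ℕ) (s : St n 𝓜.D.State) (v : Fin n), 𝓜.Status φ s → s.mem y 0 = v → φ v = α →
    Run 𝓜 p s 2 (fun s' => Frame [.st] s s' ∧ 𝓜.Status (Function.update φ v β) s')

theorem Machine.status_st_update {𝓜 : Machine G} {φ : Fin n → ℕ} {s : St n 𝓜.D.State} (v : Fin n)
    (β : ℕ) (h : ∀ v : Fin n, s.mem .st v = φ v) (w : Fin n) :
    (s.upd .st v β).mem .st w = Function.update φ v β w := by
  by_cases hw : w = v
  · simp [St.upd_mem, hw]
  · have : (w : ℕ) ≠ v := fun h => hw (Fin.ext h)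
    simp [St.upd_mem, hw, this, h]

theorem Machine.recolours_setIn {𝓜 : Machine G} (hnX : n < 𝓜.X) (y : Var) {α β : ℕ}
    (hα : α % 2 = 0) (hβ : β % 2 = 1) (hβ' : β < 64) : 𝓜.Recolours (setIn y β) y α β := by
  intro φ s v hφ hy hv
  have hvd : v ∉ 𝓜.D.toSet s.dom := by rw [hφ.dom]; simp [hv, hα]
  refine Run.seq (t₁ := 1) (t₂ := 1) (R := fun s' => s' = { s with dom := 𝓜.D.insert v s.dom })
    (Run.domInsert (t := 0) trivial hy hvd rfl (by simp [Ex.compile, Expr.cost])) ?_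
  rintro _ rfl
  refine Run.sto (t := 0) (y := v) (z := β) trivial hy (v.2.trans hnX) hβ' rfl ?_
    (by simp [Ex.compile, Expr.cost]) (by simp [Ex.compile, Expr.cost])
  refine ⟨((Frame.refl _ s).setDom _).upd (by simp) _ _, status_st_update v β hφ.st, ?_⟩
  rw [St.upd_dom]
  dsimp only
  rw [𝓜.D.toSet_insert v _ hvd, hφ.dom]
  ext w
  by_cases hw : w = v
  · simp [hw, hβ]
  · simp [hw]

theorem Machine.recolours_setOut {𝓜 : Machine G} (hnX : n < 𝓜.X) (y : Var) {α β : ℕ}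
    (hα : α % 2 = 1) (hβ : β % 2 = 0) (hβ' : β < 64) : 𝓜.Recolours (setOut y β) y α β := by
  intro φ s v hφ hy hv
  have hvd : v ∈ 𝓜.D.toSet s.dom := by rw [hφ.dom]; simp [hv, hα]
  refine Run.seq (t₁ := 1) (t₂ := 1) (R := fun s' => s' = { s with dom := 𝓜.D.delete v s.dom })
    (Run.domDelete (t := 0) trivial hy hvd rfl (by simp [Ex.compile, Expr.cost])) ?_
  rintro _ rfl
  refine Run.sto (t := 0) (y := v) (z := β) trivial hy (v.2.trans hnX) hβ' rfl ?_
    (by simp [Ex.compile, Expr.cost]) (by simp [Ex.compile, Expr.cost])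
  refine ⟨((Frame.refl _ s).setDom _).upd (by simp) _ _, status_st_update v β hφ.st, ?_⟩
  rw [St.upd_dom]
  dsimp only
  rw [𝓜.D.toSet_delete v _ hvd, hφ.dom]
  ext w
  by_cases hw : w = v
  · simp [hw, hβ]
  · simp [hw]

theorem Machine.recolours_setKeep {𝓜 : Machine G} (hnX : n < 𝓜.X) (y : Var) {α β : ℕ}
    (hαβ : α % 2 = β % 2) (hβ' : β < 64) : 𝓜.Recolours (setKeep y β) y α β := by
  intro φ s v hφ hy hv
  refine Run.sto (t := 1) (y := v) (z := β) trivial hy (v.2.trans hnX) hβ' rfl ?_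
    (by simp [Ex.compile, Expr.cost]) (by simp [Ex.compile, Expr.cost])
  refine ⟨(Frame.refl _ s).upd (by simp) _ _, status_st_update v β hφ.st, ?_⟩
  rw [St.upd_dom, hφ.dom]
  ext w
  by_cases hw : w = v
  · simp [hw, hv, hαβ]
  · simp [hw]

/-- The variables that loops over a candidate change. -/
def sweepVars : List Var := [.i2, .i3, .w1, .x1, .st]

/-- Changing the status of all members of the list from `α` to `β`. -/
theorem memberSweep_spec {𝓜 : Machine G} {s : St n 𝓜.D.State} {p : Prog} {α β : ℕ}
    (hnX : n < 𝓜.X) (hp : 𝓜.Recolours p .w1 α β) {N : List (Fin n)} (hN : N.Nodup)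
    (hL : HasList N s) {φ ψ : Fin n → ℕ} (hφ : 𝓜.Status φ s) (hα : ∀ w ∈ N, φ w = α)
    (hψ : ∀ v, ψ v = if v ∈ N then β else φ v) :
    Run 𝓜 (forMembers p) s (5 * 𝓜.A.size N + 2)
      (fun s' => 𝓜.Status ψ s' ∧ Frame sweepVars s s') := by
  have hLF : ∀ s', Frame sweepVars s s' → HasList N s' :=
    fun s' h => hL.frame h (by decide) (by decide)
  refine Run.forMembers hnX N hN (fun _ => 2) (fun l s' =>
    𝓜.Status (fun v => if v ∈ l then β else φ v) s' ∧ Frame sweepVars s s')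
    ⟨by simpa using hφ, Frame.refl _ s⟩ ?_ ?_ (fun l s' h => hLF s' h.2) ?_ ?_ ?_
  · rintro l s' z ⟨h₁, h₂⟩
    exact ⟨h₁.congr rfl rfl, h₂.upd (by decide) _ _⟩
  · rintro l s' z ⟨h₁, h₂⟩
    exact ⟨h₁.congr rfl rfl, h₂.upd (by decide) _ _⟩
  · rintro l w s' hl ⟨h₁, h₂⟩ hw
    have hwl : w ∉ l := by
      have := hN.sublist hl.sublist
      rw [List.nodup_append] at this
      exact fun h => this.2.2 w h w (by simp) rfl
    refine (hp _ s' w h₁ hw ?_).imp ?_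
    · simp [hwl, hα w (hl.subset (by simp))]
    · rintro s'' ⟨h₃, h₄⟩
      refine ⟨by rw [h₃.1 .i3 (by decide)], ?_, h₂.trans (h₃.mono (by decide))⟩
      convert h₄ using 1
      funext v
      by_cases hv : v = w
      · simp [hv]
      · simp [hv]
  · rintro s' ⟨h₁, h₂⟩
    refine ⟨?_, h₂⟩
    convert h₁ using 1
    exact funext hψ
  · have := 𝓜.A.length_le_size N
    simp
    omega

/-- Changing the status of all neighbours of members of the list from `α` to `β`.  A neighbour that
is met again no longer has the status `α`, so that it is changed only once.  -/
theorem pairSweep_spec {𝓜 : Machine G} {s : St n 𝓜.D.State} {p : Prog} {α β : ℕ}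
    (hnX : n < 𝓜.X) (hp : 𝓜.Recolours p .x1 α β) (hαβ : β ≠ α) (hα : α < 64)
    {N : List (Fin n)} (hN : N.Nodup)
    (hL : HasList N s) {φ ψ : Fin n → ℕ} (hφ : 𝓜.Status φ s)
    (hψ : ∀ v, (φ v = α → (∃ w ∈ N, G.Adj w v) → ψ v = β) ∧
      (¬ (φ v = α ∧ ∃ w ∈ N, G.Adj w v) → ψ v = φ v)) :
    Run 𝓜 (forPairs (branch (.op .eq (.arr .st (.var .x1)) (.lit α)) p .skip)) s
      (8 * 𝓜.A.size N + 2) (fun s' => 𝓜.Status ψ s' ∧ Frame sweepVars s s') := by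
  classical
  have hLF : ∀ s', Frame sweepVars s s' → HasList N s' :=
    fun s' h => hL.frame h (by decide) (by decide)
  refine Run.forPairs hnX N hN 3 (fun l s' =>
    𝓜.Status (fun v => if φ v = α ∧ v ∈ l then β else φ v) s' ∧ Frame sweepVars s s')
    ⟨by simpa using hφ, Frame.refl _ s⟩ ?_ (fun l s' h => hLF s' h.2) ?_ ?_ le_rfl
  · rintro l s' a z ha ⟨h₁, h₂⟩
    refine ⟨h₁.congr (St.upd_mem_of_ne _ _ _ _ ?_) rfl, h₂.upd ?_ _ _⟩
    · revert a; decide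
    · revert a; decide
  · rintro l w x s' hw hx ⟨h₁, h₂⟩ hxx
    have hst := h₁.st x
    refine Run.branch ⟨⟨trivial, ?_⟩, hα, trivial⟩ ?_ ?_ (by simp [Ex.compile, Expr.cost])
    · simp only [Ex.eval, hxx]; omega
    · intro hne
      have hxα : φ x = α ∧ x ∉ l := by
        by_contra hcon
        apply hne
        simp only [Ex.eval, BinOp.apply, hxx, hst]
        rw [if_neg]
        by_cases h : φ x = α <;> simp_all
      refine (hp _ s' x h₁ hxx (by simp [hxα])).imp ?_
      rintro s'' ⟨h₃, h₄⟩
      refine ⟨fun a ha => h₃.1 a ?_, ?_, h₂.trans (h₃.mono (by decide))⟩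
      · revert a; decide
      · convert h₄ using 1
        funext v
        by_cases hv : v = x
        · simp [hv, hxα]
        · simp [hv]
    · intro h0
      have hxα : φ x = α → x ∈ l := by
        intro h
        by_contra hcon
        simp [Ex.eval, BinOp.apply, hxx, hst, h, hcon] at h0
      refine Run.skip ⟨fun _ _ => rfl, ?_, h₂⟩
      convert h₁ using 1
      funext v
      by_cases hv : v = x
      · by_cases hφv : φ x = α <;> simp [hv, hφv, hxα]
      · simp [hv]
  · rintro s' ⟨h₁, h₂⟩
    refine ⟨?_, h₂⟩
    convert h₁ using 1
    funext v
    have hmem : v ∈ N.flatMap 𝓜.A.nbrs ↔ ∃ w ∈ N, G.Adj w v := by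
      simp [𝓜.A.mem_iff]
    by_cases hv : φ v = α ∧ ∃ w ∈ N, G.Adj w v
    · rw [(hψ v).1 hv.1 hv.2, if_pos ⟨hv.1, hmem.2 hv.2⟩]
    · rw [(hψ v).2 hv, if_neg]
      rwa [hmem]

end


/-! ### Testing a candidate -/

/-- Decode the list of members of a candidate, and check that all of them have the vertex `v1`, in
position `i1`, as their first neighbour in the current set. -/
def collectProg : Prog :=
  asg .cnt (.lit 0) ;;
  forLoop .i2 (.arr .len (.var .v1)) (
    branch (.op .mod (.var .bits) (.lit 2)) (
      asg .w1 (.arr .late (.op .add (.op .mul (.var .v1) (.var .dgn)) (.var .i2))) ;;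
      branch (.op .eq (.arr .fst (.var .w1)) (.var .i1)) .skip (asg .ok (.lit 0)) ;;
      sto .lst (.var .cnt) (.var .w1) ;;
      asg .cnt (.op .add (.var .cnt) (.lit 1))) .skip ;;
    asg .bits (.op .div (.var .bits) (.lit 2))) ;;
  branch (.var .bits) (asg .ok (.lit 0)) .skip

/-- Check that one of the later neighbours of `x1` has status `1`, that is, belongs to the previous
set and has not been removed. -/
def keptProg : Prog :=
  asg .tmp (.lit 0) ;;
  forLoop .i1 (.arr .len (.var .x1)) (
    asg .u1 (.arr .late (.op .add (.op .mul (.var .x1) (.var .dgn)) (.var .i1))) ;;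
    branch (.op .eq (.arr .st (.var .u1)) (.lit 1)) (asg .tmp (.lit 1)) .skip) ;;
  branch (.var .tmp) .skip (asg .ok (.lit 0))

/-- Check the conditions for a neighbour `x1` of a member of the candidate: it is not a member
itself, and if it is a defect of the current set, then the exchange leaves it a neighbour.  -/
def checkProg : Prog :=
  branch (.op .eq (.arr .st (.var .x1)) (.lit 3)) (asg .ok (.lit 0))
    (branch (.arr .st (.var .x1)) .skip
      (branch (.op .lt (.arr .pos (.var .x1)) (.arr .fst (.var .x1))) keptProg .skip))

/-- Change the status of all neighbours of members of the candidate that have status `α`. -/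
def pairSweep (α : ℕ) (p : Prog) : Prog :=
  forPairs (branch (.op .eq (.arr .st (.var .x1)) (.lit α)) p .skip)

/-- Exchange the neighbours of the members of the list for these members.  If this does not yield a
child, then undo it.  Until this has been decided, the members have status `3`, and the vertices
that have been removed have status `2`.  So the odd values still mark the set in the dominance
structure, and the previous set can be restored.  -/
def exchangeProg : Prog :=
  forMembers (setIn .w1 3) ;;
  pairSweep 1 (setOut .x1 2) ;;
  domTest .ok ;;
  forPairs checkProg ;;
  branch (.var .ok)
    (pairSweep 2 (setKeep .x1 0) ;; forMembers (setKeep .w1 1))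
    (pairSweep 2 (setIn .x1 1) ;; forMembers (setOut .w1 0))

/-- Test the candidate with number `cand`.  If it stands for a child, then proceed to this child;
the result is stored in `ok`.  -/
def tryProg : Prog :=
  asg .i1 (.op .div (.var .cand) (.var .pow)) ;;
  asg .bits (.op .mod (.var .cand) (.var .pow)) ;;
  asg .ok (.lit 0) ;;
  branch (.op .lt (.var .i1) (.var .agr)) (
    asg .v1 (.arr .ord (.var .i1)) ;;
    branch (.arr .st (.var .v1)) (
      branch (.var .bits) (
        asg .ok (.lit 1) ;;
        collectProg ;;
        branch (.var .ok) exchangeProg .skip) .skip) .skip) .skip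

section

variable {n : ℕ} {G : SimpleGraph (Fin n)} {𝓜 : Machine G} {ord : VertexOrder n} {K : ℕ}

theorem Machine.Params.index_lt (hp : 𝓜.Params ord K) (v : Fin n) {i : ℕ}
    (hi : i < (𝓜.A.late ord v).length) : v * K + i < 𝓜.X ∧ v * K + i < 𝓜.W := by
  have h₁ := hp.length_le v
  have h₂ : (v + 1) * K ≤ n * K := Nat.mul_le_mul_right _ v.2
  have h₃ := hp.table_lt
  have h₄ := 𝓜.hXM
  have h₅ := 𝓜.hMW
  rw [add_mul, one_mul] at h₂
  omega

/-- Reading the table of later neighbours. -/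
theorem Machine.Env.late_ok (hp : 𝓜.Params ord K) {s : St n 𝓜.D.State} (hE : 𝓜.Env ord K s)
    {v : Fin n} {y z : Var} {i : ℕ} (hi : i < (𝓜.A.late ord v).length) (hy : s.mem y 0 = v)
    (hz : s.mem z 0 = i) :
    (Ex.arr .late (.op .add (.op .mul (.var y) (.var .dgn)) (.var z))).Ok 𝓜 s.mem ∧
    (Ex.arr .late (.op .add (.op .mul (.var y) (.var .dgn)) (.var z))).eval 𝓜.A s.mem =
      (𝓜.A.late ord v)[i] := by
  obtain ⟨h₁, h₂⟩ := hp.index_lt v hi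
  simp only [Ex.Ok, Ex.eval, BinOp.apply, BinOp.Fits, hy, hz, hE.dgn, true_and]
  exact ⟨⟨⟨by omega, h₂⟩, h₁⟩, hE.late v i hi⟩

theorem pick_append_singleton {α : Type} (l : List α) (w : α) (q : ℕ) :
    pick (l ++ [w]) q = pick l q ++ if q / 2 ^ l.length % 2 = 1 then [w] else [] := by
  induction l generalizing q with
  | nil => simp [pick]
  | cons x l ih =>
    have : q / 2 / 2 ^ l.length = q / 2 ^ (l.length + 1) := by
      rw [Nat.div_div_eq_div_mul, pow_succ, mul_comm]
    rw [List.cons_append, pick, pick, ih, List.length_cons, this]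
    by_cases h : q % 2 = 1 <;> simp [h]

/-- The variables that decoding a candidate changes. -/
def collectVars : List Var := [.i2, .bits, .w1, .ok, .lst, .cnt]

open Classical in
/-- The bits that remain after the loop show whether the mask refers to later neighbours only. -/
theorem collectProg_spec (hp : 𝓜.Params ord K) {s : St n 𝓜.D.State} {S : Finset (Fin n)}
    (hE : 𝓜.Env ord K s) (hA : 𝓜.Analysed ord S s) {v : Fin n} {i q : ℕ}
    (hv : s.mem .v1 0 = v) (hi : s.mem .i1 0 = i) (hq : s.mem .bits 0 = q)
    (hok : s.mem .ok 0 = 1) :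
    Run 𝓜 collectProg s (9 * K + 5) (fun s' => (HasList (pick (𝓜.A.late ord v) q) s' ∧
      s'.dom = s.dom ∧ Frame collectVars s s') ∧
      s'.mem .ok 0 = if (∀ w ∈ pick (𝓜.A.late ord v) q, firstPos G ord S w = i) ∧
        q < 2 ^ (𝓜.A.late ord v).length then 1 else 0) := by
  have hnX := hp.n_lt
  have hlen := hp.length_le v
  have hKX := hp.K_lt
  have hKW := hp.K_lt_W
  set L := 𝓜.A.late ord v with hL
  have hvX : (v : ℕ) < 𝓜.X := v.2.trans hnX
  refine Run.seq (t₁ := 1) (t₂ := 9 * K + 4) (R := fun s' => s' = s.upd .cnt 0 0)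
    (Run.asg (t := 0) (by simp [Ex.Ok]) rfl rfl) ?_
  rintro _ rfl
  refine Run.seq (t₁ := 9 * K + 2) (t₂ := 2) (R := fun s' => (HasList (pick L q) s' ∧
      s'.dom = s.dom ∧ Frame collectVars s s') ∧ s'.mem .bits 0 = q / 2 ^ L.length ∧
      s'.mem .ok 0 = if ∀ w ∈ pick L q, firstPos G ord S w = i then 1 else 0) ?_ ?_
  · refine Run.forLoop L.length (fun _ => 7) (fun r s' => (HasList (pick (L.take r) q) s' ∧
      s'.dom = s.dom ∧ Frame collectVars s s') ∧ s'.mem .bits 0 = q / 2 ^ r ∧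
      s'.mem .ok 0 = if ∀ w ∈ pick (L.take r) q, firstPos G ord S w = i then 1 else 0)
      (by omega) ?_ ?_ ?_ ?_ ?_
    · refine ⟨⟨⟨by simp [St.upd_mem, pick], by simp [pick]⟩, rfl,
        ((Frame.refl _ s).upd (by decide) _ _).upd (by decide) _ _⟩, by simp [St.upd_mem, hq],
        by simp [St.upd_mem, pick, hok]⟩
    · rintro r s' - ⟨⟨a₁, a₂, a₃⟩, a₄, a₅⟩
      have hv' : s'.mem .v1 0 = v := by rw [a₃.1 .v1 (by decide)]; exact hv
      exact ⟨⟨trivial, by simpa [Ex.eval, hv'] using hvX⟩,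
        by simpa [Ex.eval, hv'] using (hE.frame a₃ (by decide)).len v⟩
    · rintro r s₁ hr ⟨⟨a₁, a₂, a₃⟩, a₄, a₅⟩ hir
      have hE₁ := hE.frame a₃ (by decide)
      have hv' : s₁.mem .v1 0 = v := by rw [a₃.1 .v1 (by decide)]; exact hv
      have hi' : s₁.mem .i1 0 = i := by rw [a₃.1 .i1 (by decide)]; exact hi
      have hA₁ := hA.congr (a₃.1 .fst (by decide)) (a₃.1 .agr (by decide))
      have hdiv : q / 2 ^ r / 2 = q / 2 ^ (r + 1) := by
        rw [Nat.div_div_eq_div_mul, pow_succ]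
      have htake : L.take (r + 1) = L.take r ++ [L[r]] := by simp
      have hpick := pick_append_singleton (L.take r) L[r] q
      rw [← htake, List.length_take, min_eq_left hr.le] at hpick
      refine Run.seq (t₁ := 6) (t₂ := 1) (R := fun s' => s'.mem .i2 0 = r ∧
        (HasList (pick (L.take (r + 1)) q) s' ∧
        s'.dom = s.dom ∧ Frame collectVars s s') ∧ s'.mem .bits 0 = q / 2 ^ r ∧
        s'.mem .ok 0 = if ∀ w ∈ pick (L.take (r + 1)) q, firstPos G ord S w = i then 1 else 0)
        ?_ ?_
      · refine Run.branch ⟨trivial, by simp [Ex.Ok], trivial⟩ ?_ ?_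
        · intro hne
          have hbit : q / 2 ^ r % 2 = 1 := by
            simp only [Ex.eval, BinOp.apply, a₄] at hne
            omega
          rw [if_pos hbit] at hpick
          obtain ⟨hlok, hlev⟩ := hE₁.late_ok hp hr hv' hir
          refine Run.seq (t₁ := 1) (t₂ := 4) (R := fun s' => s' = s₁.upd .w1 0 L[r])
            (Run.asg (t := 0) hlok hlev rfl) ?_
          rintro _ rfl
          refine Run.seq (t₁ := 2) (t₂ := 2) (R := fun s' => (s'.mem .i2 0 = r ∧
            s'.mem .w1 0 = (L[r] : Fin n) ∧ HasList (pick (L.take r) q) s' ∧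
            s'.dom = s.dom ∧ Frame collectVars s s') ∧ s'.mem .bits 0 = q / 2 ^ r ∧
            s'.mem .ok 0 = if ∀ w ∈ pick (L.take (r + 1)) q, firstPos G ord S w = i then 1 else 0)
            ?_ ?_
          · have hfst : (s₁.upd .w1 0 L[r]).mem .fst (L[r] : Fin n) = firstPos G ord S L[r] :=
              hA₁.fst L[r]
            refine Run.branch (t := 1) ⟨⟨trivial, ?_⟩, trivial, trivial⟩ ?_ ?_
            · simp only [Ex.eval, St.upd_mem]
              simp
              exact L[r].2.trans hnX
            · intro hne
              have hf : firstPos G ord S L[r] = i := by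
                by_contra hcon
                apply hne
                simp only [Ex.eval, BinOp.apply]
                exact if_neg (by simp [St.upd_mem, hA₁.fst, hi', hcon])
              refine Run.skip ⟨⟨by simpa [St.upd_mem] using hir, by simp [St.upd_mem],
                ⟨a₁.cnt, a₁.lst⟩, a₂, a₃.upd (by decide) _ _⟩, a₄, ?_⟩
              rw [hpick]
              simpa [or_imp, forall_and, hf, St.upd_mem] using a₅
            · intro h0
              have hf : firstPos G ord S L[r] ≠ i := by
                intro hcon
                simp [Ex.eval, BinOp.apply, St.upd_mem, hA₁.fst, hi', hcon] at h0
              refine Run.asg (t := 0) (by simp [Ex.Ok]) rfl ⟨⟨by simpa [St.upd_mem] using hir,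
                by simp [St.upd_mem], ⟨a₁.cnt, a₁.lst⟩, a₂,
                (a₃.upd (by decide) _ _).upd (by decide) _ _⟩, a₄, ?_⟩
              rw [hpick]
              simp [hf, St.upd_mem, Ex.eval]
          · rintro s₂ ⟨⟨b₁, b₂, b₃, b₄, b₅⟩, b₆, b₇⟩
            have hcl : (pick (L.take r) q).length ≤ r := by
              have := (pick_sublist (L.take r) q).length_le
              rw [List.length_take] at this
              omega
            refine Run.seq (t₁ := 1) (t₂ := 1)
              (R := fun s' => s' = s₂.upd .lst (pick (L.take r) q).length L[r])
              (Run.sto (t := 0) trivial b₃.cnt (by omega) trivial b₂ rfl) ?_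
            rintro _ rfl
            have hcnt : (s₂.upd .lst (pick (L.take r) q).length L[r]).mem .cnt 0 =
              (pick (L.take r) q).length := by simp [St.upd_mem, b₃.cnt]
            refine Run.asg (t := 0) (z := (pick (L.take r) q).length + 1)
              ⟨trivial, by simp [Ex.Ok], ?_⟩ (by simp [Ex.eval, BinOp.apply, hcnt]) ?_
            · simp only [BinOp.Fits, Ex.eval, hcnt]
              omega
            · refine ⟨by simpa [St.upd_mem] using b₁, ⟨⟨?_, ?_⟩, b₄,
                (b₅.upd (by decide) _ _).upd (by decide) _ _⟩, by simpa [St.upd_mem] using b₆,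
                by simpa [St.upd_mem] using b₇⟩
              · rw [hpick]; simp [St.upd_mem]
              · intro j hj
                simp only [hpick] at hj ⊢
                rw [List.length_append, List.length_singleton] at hj
                by_cases hjl : j < (pick (L.take r) q).length
                · rw [List.getElem_append_left hjl, ← b₃.lst j hjl]
                  have : j ≠ (pick (L.take r) q).length := by omega
                  simp [St.upd_mem, this]
                · have : j = (pick (L.take r) q).length := by omega
                  subst this
                  simp [St.upd_mem]
        · intro h0
          have hbit : ¬ q / 2 ^ r % 2 = 1 := by
            simp only [Ex.eval, BinOp.apply, a₄] at h0
            omega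
          rw [if_neg hbit, List.append_nil] at hpick
          rw [hpick]
          exact Run.skip ⟨hir, ⟨a₁, a₂, a₃⟩, a₄, a₅⟩
      · rintro s₂ ⟨b₁, ⟨b₂, b₃, b₄⟩, b₅, b₆⟩
        refine Run.asg (t := 0) (z := q / 2 ^ (r + 1)) ⟨trivial, by simp [Ex.Ok], trivial⟩
          (by simp [Ex.eval, BinOp.apply, b₅, hdiv]) ?_
        exact ⟨by simpa [St.upd_mem] using b₁, ⟨⟨b₂.cnt, b₂.lst⟩, b₃,
          (b₄.upd (by decide) _ _).upd (by decide) _ _⟩, by simp [St.upd_mem],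
          by simpa [St.upd_mem] using b₆⟩
    · rintro s' h
      rwa [List.take_length] at h
    · simp; omega
  · rintro s₁ ⟨⟨a₁, a₂, a₃⟩, a₄, a₅⟩
    have hbits : q / 2 ^ L.length = 0 ↔ q < 2 ^ L.length := by
      rw [Nat.div_eq_zero_iff]; simp
    refine Run.branch trivial ?_ ?_
    · intro hne
      have hlt : ¬ q < 2 ^ L.length := by
        rw [← hbits, ← a₄]; exact hne
      refine Run.asg (t := 0) (by simp [Ex.Ok]) rfl
        ⟨⟨⟨a₁.cnt, a₁.lst⟩, a₂, a₃.upd (by decide) _ _⟩, ?_⟩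
      rw [if_neg (fun h => hlt h.2)]
      simp [St.upd_mem, Ex.eval]
    · intro h0
      have hlt : q < 2 ^ L.length := by
        rw [← hbits, ← a₄]; exact h0
      refine Run.skip ⟨⟨a₁, a₂, a₃⟩, ?_⟩
      rw [a₅]
      simp [hlt]

/-- The variables that checking a neighbour of a candidate changes. -/
def keptVars : List Var := [.i1, .u1, .tmp, .ok]

open Classical in
theorem keptProg_spec (hp : 𝓜.Params ord K) {s : St n 𝓜.D.State} {φ : Fin n → ℕ}
    (hE : 𝓜.Env ord K s) (hφ : 𝓜.Status φ s) {x : Fin n} (hx : s.mem .x1 0 = x) :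
    Run 𝓜 keptProg s (5 * K + 5) (fun s' => (s'.dom = s.dom ∧ Frame keptVars s s') ∧
      s'.mem .ok 0 = if ∃ y ∈ 𝓜.A.late ord x, φ y = 1 then s.mem .ok 0 else 0) := by
  have hnX := hp.n_lt
  have hlen := hp.length_le x
  have hKW := hp.K_lt_W
  set L := 𝓜.A.late ord x with hL
  refine Run.seq (t₁ := 1) (t₂ := 5 * K + 4) (R := fun s' => s' = s.upd .tmp 0 0)
    (Run.asg (t := 0) (by simp [Ex.Ok]) rfl rfl) ?_
  rintro _ rfl
  refine Run.seq (t₁ := 5 * K + 2) (t₂ := 2) (R := fun s' => (s'.dom = s.dom ∧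
    s'.mem .ok = s.mem .ok ∧ Frame keptVars s s') ∧
    s'.mem .tmp 0 = if ∃ y ∈ L, φ y = 1 then 1 else 0) ?_ ?_
  · refine Run.forLoop L.length (fun _ => 3) (fun r s' => (s'.dom = s.dom ∧
      s'.mem .ok = s.mem .ok ∧ Frame keptVars s s') ∧
      s'.mem .tmp 0 = if ∃ y ∈ L.take r, φ y = 1 then 1 else 0) (by omega) ?_ ?_ ?_ ?_ ?_
    · exact ⟨⟨rfl, rfl, ((Frame.refl _ s).upd (by decide) _ _).upd (by decide) _ _⟩,
        by simp [St.upd_mem]⟩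
    · rintro r s' - ⟨⟨a₁, a₂, a₃⟩, a₄⟩
      have hx' : s'.mem .x1 0 = x := by rw [a₃.1 .x1 (by decide)]; exact hx
      exact ⟨⟨trivial, by simpa [Ex.eval, hx'] using x.2.trans hnX⟩,
        by simpa [Ex.eval, hx'] using (hE.frame a₃ (by decide)).len x⟩
    · rintro r s₁ hr ⟨⟨a₁, a₂, a₃⟩, a₄⟩ hir
      have hE₁ := hE.frame a₃ (by decide)
      have hx' : s₁.mem .x1 0 = x := by rw [a₃.1 .x1 (by decide)]; exact hx
      have hst : s₁.mem .st (L[r] : Fin n) = φ L[r] := by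
        rw [a₃.1 .st (by decide)]; exact hφ.st _
      obtain ⟨hlok, hlev⟩ := hE₁.late_ok hp hr hx' hir
      refine Run.seq (t₁ := 1) (t₂ := 2) (R := fun s' => s' = s₁.upd .u1 0 L[r])
        (Run.asg (t := 0) hlok hlev rfl) ?_
      rintro _ rfl
      have htake : L.take (r + 1) = L.take r ++ [L[r]] := by simp
      have hlt : ((L[r] : Fin n) : ℕ) < 𝓜.X := L[r].2.trans hnX
      have heval : (Ex.op .eq (.arr .st (.var .u1)) (.lit 1)).eval 𝓜.A (s₁.upd .u1 0 L[r]).mem =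
          if φ L[r] = 1 then 1 else 0 := by
        simp only [Ex.eval, BinOp.apply]
        congr 1
        simp [St.upd_mem, hst]
      refine Run.branch (t := 1) ⟨⟨trivial, by simpa [Ex.eval, St.upd_mem] using hlt⟩,
        by simp [Ex.Ok], trivial⟩ ?_ ?_
      · intro hne
        have hone : φ L[r] = 1 := by
          by_contra hcon
          exact hne (by rw [heval, if_neg hcon])
        refine Run.asg (t := 0) (by simp [Ex.Ok]) rfl ⟨by simpa [St.upd_mem] using hir,
          ⟨a₁, a₂, ((a₃.upd (by decide) _ _).upd (by decide) _ _).upd (by decide) _ _⟩, ?_⟩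
        rw [if_pos ⟨L[r], htake ▸ List.mem_append_right _ (List.mem_singleton_self _), hone⟩]
        simp [St.upd_mem, Ex.eval]
      · intro h0
        have hone : ¬ φ L[r] = 1 := by
          intro hcon
          rw [heval, if_pos hcon] at h0
          omega
        refine Run.skip ⟨by simpa [St.upd_mem] using hir,
          ⟨a₁, a₂, (a₃.upd (by decide) _ _).upd (by decide) _ _⟩, ?_⟩
        rw [htake]
        have : (∃ y ∈ L.take r ++ [L[r]], φ y = 1) ↔ ∃ y ∈ L.take r, φ y = 1 := by
          simp only [List.mem_append, List.mem_singleton]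
          constructor
          · rintro ⟨y, h | rfl, h'⟩
            · exact ⟨y, h, h'⟩
            · exact absurd h' hone
          · rintro ⟨y, h, h'⟩
            exact ⟨y, Or.inl h, h'⟩
        simp only [this]
        simpa [St.upd_mem] using a₄
    · rintro s' h
      rwa [List.take_length] at h
    · simp; omega
  · rintro s₁ ⟨⟨a₁, a₂, a₃⟩, a₄⟩
    refine Run.branch trivial ?_ ?_
    · intro hne
      have hex : ∃ y ∈ L, φ y = 1 := by
        by_contra hcon
        exact hne (by simp only [Ex.eval, a₄, if_neg hcon])
      refine Run.skip ⟨⟨a₁, a₃⟩, ?_⟩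
      rw [if_pos hex, a₂]
    · intro h0
      have hex : ¬ ∃ y ∈ L, φ y = 1 := by
        intro hcon
        simp only [Ex.eval, a₄, if_pos hcon] at h0
        omega
      refine Run.asg (t := 0) (by simp [Ex.Ok]) rfl ⟨⟨a₁, a₃.upd (by decide) _ _⟩, ?_⟩
      rw [if_neg hex]
      simp [St.upd_mem, Ex.eval]

/-- The condition that is checked at the neighbours of a candidate. -/
def CheckedAt (A : AdjLists G) (ord : VertexOrder n) (S : Finset (Fin n)) (φ : Fin n → ℕ)
    (x : Fin n) : Prop :=
  φ x ≠ 3 ∧ (φ x = 0 → (ord.symm x : ℕ) < firstPos G ord S x → ∃ y ∈ A.late ord x, φ y = 1)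

/-- The variables that checking the neighbours of a candidate changes. -/
def checkVars : List Var := [.i1, .i2, .i3, .w1, .x1, .u1, .tmp, .ok]

open Classical in
theorem forPairs_checkProg_spec (hp : 𝓜.Params ord K) {s : St n 𝓜.D.State} {φ : Fin n → ℕ}
    {S : Finset (Fin n)} (hE : 𝓜.Env ord K s) (hφ : 𝓜.Status φ s) (hA : 𝓜.Analysed ord S s)
    {N : List (Fin n)} (hN : N.Nodup) (hL : HasList N s) (P : Prop)
    (hok : s.mem .ok 0 = if P then 1 else 0) :
    Run 𝓜 (forPairs checkProg) s ((5 * K + 13) * 𝓜.A.size N + 2) (fun s' =>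
      (s'.dom = s.dom ∧ Frame checkVars s s') ∧
      s'.mem .ok 0 =
        if P ∧ ∀ w ∈ N, ∀ x, G.Adj w x → CheckedAt 𝓜.A ord S φ x then 1 else 0) := by
  have hnX := hp.n_lt
  refine Run.forPairs hnX N hN (5 * K + 8) (fun l s' => (s'.dom = s.dom ∧ Frame checkVars s s') ∧
      s'.mem .ok 0 = if P ∧ ∀ x ∈ l, CheckedAt 𝓜.A ord S φ x then 1 else 0)
    ⟨⟨rfl, Frame.refl _ s⟩, by simpa using hok⟩ ?_
    (fun l s' h => hL.frame h.1.2 (by decide) (by decide)) ?_ ?_ le_rfl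
  · rintro l s' a z ha ⟨⟨h₁, h₂⟩, h₃⟩
    refine ⟨⟨h₁, h₂.upd ?_ _ _⟩, ?_⟩
    · revert a; decide
    · rw [St.upd_mem_of_ne _ _ _ _ (b := .ok) ?_, h₃]
      revert a; decide
  · rintro l w x s' hw - ⟨⟨h₁, h₂⟩, h₃⟩ hx
    have hE' := hE.frame h₂ (by decide)
    have hφ' := hφ.congr (h₂.1 .st (by decide)) h₁
    have hst := hφ'.st x
    have hpos := hE'.posOf x
    have hfst : s'.mem .fst x = firstPos G ord S x := by
      rw [h₂.1 .fst (by decide)]; exact hA.fst x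
    have hxX : (x : ℕ) < 𝓜.X := x.2.trans hnX
    -- The three ways in which the truth value is updated.
    have hbad : ∀ s'' : St n 𝓜.D.State, ¬ CheckedAt 𝓜.A ord S φ x → s''.mem .ok 0 = 0 →
        s''.mem .ok 0 = if P ∧ ∀ y ∈ l ++ [x], CheckedAt 𝓜.A ord S φ y then 1 else 0 := by
      intro s'' hc h
      rw [h, if_neg]
      exact fun h => hc (h.2 x (by simp))
    have hgood : ∀ s'' : St n 𝓜.D.State, CheckedAt 𝓜.A ord S φ x → s''.mem .ok 0 = s'.mem .ok 0 →
        s''.mem .ok 0 = if P ∧ ∀ y ∈ l ++ [x], CheckedAt 𝓜.A ord S φ y then 1 else 0 := by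
      intro s'' hc h
      rw [h, h₃]
      congr 1
      simp [or_imp, forall_and, hc]
    refine Run.branch (t := 5 * K + 7)
      ⟨⟨trivial, by simpa [Ex.eval, hx] using hxX⟩, by simp [Ex.Ok], trivial⟩ ?_ ?_
    · intro hne
      have h3 : φ x = 3 := by
        by_contra hcon
        exact hne (by simp [Ex.eval, BinOp.apply, hx, hst, hcon])
      refine Run.asg (by simp [Ex.Ok]) rfl ⟨fun a ha => ?_, ⟨h₁, h₂.upd (by decide) _ _⟩,
        hbad _ (fun h => h.1 h3) (by simp [St.upd_mem, Ex.eval])⟩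
      refine St.upd_mem_of_ne _ _ _ _ ?_
      revert a; decide
    · intro h0
      have h3 : φ x ≠ 3 := by
        intro hcon
        simp [Ex.eval, BinOp.apply, hx, hst, hcon] at h0
      refine Run.branch (t := 5 * K + 6) ⟨trivial, by simpa [Ex.eval, hx] using hxX⟩ ?_ ?_
      · intro hne
        have h0 : φ x ≠ 0 := by
          simpa [Ex.eval, hx, hst] using hne
        exact Run.skip ⟨fun _ _ => rfl, ⟨h₁, h₂⟩,
          hgood _ ⟨h3, fun h => absurd h h0⟩ rfl⟩
      · intro h0
        have h0 : φ x = 0 := by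
          simpa [Ex.eval, hx, hst] using h0
        refine Run.branch (t := 5 * K + 5) ⟨⟨trivial, by simpa [Ex.eval, hx] using hxX⟩,
          ⟨trivial, by simpa [Ex.eval, hx] using hxX⟩, trivial⟩ ?_ ?_
        · intro hne
          have hlt : (ord.symm x : ℕ) < firstPos G ord S x := by
            by_contra hcon
            exact hne (by simp [Ex.eval, BinOp.apply, hx, hpos, hfst, hcon])
          refine (keptProg_spec hp hE' hφ' hx).imp ?_
          rintro s'' ⟨⟨c₁, c₂⟩, c₃⟩
          refine ⟨fun a ha => c₂.1 a ?_, ⟨c₁.trans h₁, h₂.trans (c₂.mono (by decide))⟩, ?_⟩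
          · revert a; decide
          · by_cases hex : ∃ y ∈ 𝓜.A.late ord x, φ y = 1
            · rw [if_pos hex] at c₃
              exact hgood _ ⟨h3, fun _ _ => hex⟩ c₃
            · rw [if_neg hex] at c₃
              exact hbad _ (fun h => hex (h.2 h0 hlt)) c₃
        · intro hge
          have hge : ¬ (ord.symm x : ℕ) < firstPos G ord S x := by
            intro hcon
            simp [Ex.eval, BinOp.apply, hx, hpos, hfst, hcon] at hge
          exact Run.skip ⟨fun _ _ => rfl, ⟨h₁, h₂⟩,
            hgood _ ⟨h3, fun _ h => absurd h hge⟩ rfl⟩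
  · rintro s' ⟨h₁, h₂⟩
    refine ⟨h₁, h₂.trans ?_⟩
    congr 1
    simp only [List.mem_flatMap, 𝓜.A.mem_iff, eq_iff_iff]
    refine and_congr_right fun _ => ⟨fun h w hw x hwx => h x ⟨w, hw, hwx⟩, ?_⟩
    rintro h x ⟨w, hw, hwx⟩
    exact h w hw x hwx

end


section

variable {n : ℕ} {G : SimpleGraph (Fin n)} {𝓜 : Machine G} {ord : VertexOrder n} {K : ℕ}

open Classical in
/-- The conditions on a list `N` that are tested by exchanging its members for their neighbours. -/
def Exchangeable (A : AdjLists G) (ord : VertexOrder n) (S : Finset (Fin n)) (N : List (Fin n)) :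
    Prop :=
  Dominates G (exchange G S N.toFinset) ∧ ∀ w ∈ N, ∀ x, G.Adj w x → x ∉ N ∧
    (Defect G ord S x → ∃ y ∈ A.late ord x, y ∈ S ∧ ∀ w' ∈ N, ¬ G.Adj w' y)

/-- The variables that an exchange changes. -/
def exchangeVars : List Var := .st :: checkVars

open Classical in
/-- The status of the vertices is at first `1` in `S` and `0` elsewhere.  It is `φ₁` after the
members of `N` have been inserted, and `φ₂` while the result is tested. -/
theorem exchangeProg_spec (hp : 𝓜.Params ord K) {s : St n 𝓜.D.State} {S : Finset (Fin n)}
    (hE : 𝓜.Env ord K s) (hS : 𝓜.Holds S s) (hA : 𝓜.Analysed ord S s)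
    {N : List (Fin n)} (hN : N.Nodup) (hL : HasList N s) (hNS : ∀ w ∈ N, w ∉ S) :
    Run 𝓜 exchangeProg s ((5 * K + 39) * 𝓜.A.size N + 12) (fun s' => Frame exchangeVars s s' ∧
      if Exchangeable 𝓜.A ord S N then s'.mem .ok 0 = 1 ∧ 𝓜.Holds (exchange G S N.toFinset) s'
      else s'.mem .ok 0 = 0 ∧ 𝓜.Holds S s') := by
  have hnX := hp.n_lt
  let hit : Fin n → Prop := fun v => ∃ w ∈ N, G.Adj w v
  let φ₁ : Fin n → ℕ := fun v => if v ∈ N then 3 else if v ∈ S then 1 else 0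
  let φ₂ : Fin n → ℕ := fun v =>
    if v ∈ N then 3 else if v ∈ S then if hit v then 2 else 1 else 0
  have hmemT : ∀ v, v ∈ exchange G S N.toFinset ↔ (v ∈ S ∧ ¬ hit v) ∨ v ∈ N := by
    intro v; rw [mem_exchange]; simp [hit]
  refine Run.seq (memberSweep_spec hnX (𝓜.recolours_setIn hnX .w1 (α := 0) rfl rfl (by norm_num))
    hN hL (𝓜.holds_iff_status.1 hS) (fun w hw => by simp [hNS w hw]) (ψ := φ₁) (fun v => rfl))
    (t₂ := (5 * K + 34) * 𝓜.A.size N + 10) ?_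
    (by rw [show 5 * K + 39 = 5 * K + 34 + 5 by rfl, add_mul (5 * K + 34) 5]; omega)
  rintro s₁ ⟨h₁, F₁⟩
  refine Run.seq (pairSweep_spec hnX (𝓜.recolours_setOut hnX .x1 (α := 1) (β := 2) rfl rfl
    (by norm_num)) (by norm_num) (by norm_num) hN (hL.frame F₁ (by decide) (by decide)) h₁
    (ψ := φ₂) ?_) (t₂ := (5 * K + 26) * 𝓜.A.size N + 8) ?_
    (by rw [show 5 * K + 34 = 5 * K + 26 + 8 by rfl, add_mul (5 * K + 26) 8]; omega)
  · intro v
    simp only [φ₁, φ₂]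
    by_cases hvN : v ∈ N
    · simp [hvN]
    · by_cases hvS : v ∈ S
      · constructor
        · intro _ h; simp [hvN, hvS, hit, h]
        · intro h
          have : ¬ hit v := by simpa [hvN, hvS, hit] using h
          simp [hvN, hvS, this]
      · simp [hvN, hvS]
  rintro s₂ ⟨h₂, F₂⟩
  have F₁₂ : Frame exchangeVars s s₂ := (F₁.trans F₂).mono (by decide)
  have hdom₂ : 𝓜.D.toSet s₂.dom = exchange G S N.toFinset := by
    rw [h₂.dom]
    ext v
    rw [mem_filter, hmemT]
    simp only [φ₂, mem_univ, true_and]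
    by_cases hvN : v ∈ N
    · simp [hvN]
    · by_cases hvS : v ∈ S <;> by_cases hv : hit v <;> simp [hvN, hvS, hv]
  refine Run.seq (t₁ := 1) (t₂ := (5 * K + 26) * 𝓜.A.size N + 7) (R := fun s' => s' = s₂.upd .ok 0
    (if Dominates G (exchange G S N.toFinset) then 1 else 0))
    (Run.domTest (t := 0) (by rw [hdom₂])) ?_
  rintro _ rfl
  have F₃ : Frame exchangeVars s (s₂.upd .ok 0
    (if Dominates G (exchange G S N.toFinset) then 1 else 0)) := F₁₂.upd (by decide) _ _
  refine Run.seq (forPairs_checkProg_spec hp (hE.frame F₃ (by decide)) (h₂.congr rfl rfl)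
    (hA.congr (F₃.1 .fst (by decide)) (F₃.1 .agr (by decide))) hN
    (hL.frame F₃ (by decide) (by decide)) (Dominates G (exchange G S N.toFinset))
    (by simp [St.upd_mem])) (t₂ := 13 * 𝓜.A.size N + 5) ?_
    (by rw [show 5 * K + 26 = 5 * K + 13 + 13 by rfl, add_mul (5 * K + 13) 13]; omega)
  rintro s₄ ⟨⟨hd₄, F₄'⟩, hok₄⟩
  have F₄ : Frame exchangeVars s s₄ := F₃.trans (F₄'.mono (by decide))
  have h₄ : 𝓜.Status φ₂ s₄ := h₂.congr (F₄'.1 .st (by decide)) hd₄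
  have hone : ∀ y, φ₂ y = 1 ↔ y ∉ N ∧ y ∈ S ∧ ¬ hit y := by
    intro y
    simp only [φ₂]
    by_cases hyN : y ∈ N
    · simp [hyN]
    · by_cases hyS : y ∈ S <;> by_cases hy : hit y <;> simp [hyN, hyS, hy]
  have hzero : ∀ y, φ₂ y = 0 ↔ y ∉ N ∧ y ∉ S := by
    intro y
    simp only [φ₂]
    by_cases hyN : y ∈ N
    · simp [hyN]
    · by_cases hyS : y ∈ S <;> by_cases hy : hit y <;> simp [hyN, hyS, hy]
  have hthree : ∀ y, φ₂ y = 3 ↔ y ∈ N := by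
    intro y
    simp only [φ₂]
    by_cases hyN : y ∈ N
    · simp [hyN]
    · by_cases hyS : y ∈ S <;> by_cases hy : hit y <;> simp [hyN, hyS, hy]
  have hcheck : ∀ x, CheckedAt 𝓜.A ord S φ₂ x ↔ x ∉ N ∧ (Defect G ord S x →
      ∃ y ∈ 𝓜.A.late ord x, y ∈ S ∧ ∀ w' ∈ N, ¬ G.Adj w' y) := by
    intro x
    unfold CheckedAt
    rw [Ne, hthree, hzero, Defect]
    refine and_congr_right fun hxN => ?_
    have : ∀ y, φ₂ y = 1 ↔ y ∈ S ∧ ∀ w' ∈ N, ¬ G.Adj w' y := by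
      intro y
      rw [hone]
      simp only [hit]
      push Not
      exact ⟨fun h => h.2, fun h => ⟨fun hy => hNS y hy h.1, h⟩⟩
    simp only [this, hxN, not_false_eq_true, true_and, and_imp]
  simp only [hcheck] at hok₄
  have hok₄' : s₄.mem .ok 0 = if Exchangeable 𝓜.A ord S N then 1 else 0 :=
    hok₄.trans (if_congr Iff.rfl rfl rfl)
  have hL₄ := hL.frame F₄ (by decide) (by decide)
  refine Run.branch trivial ?_ ?_
  · intro hne
    have hex : Exchangeable 𝓜.A ord S N := by
      by_contra hcon
      exact hne (by simp only [Ex.eval, hok₄', if_neg hcon])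
    rw [if_pos hex] at hok₄'
    simp only [if_pos hex]
    refine Run.seq (pairSweep_spec hnX (𝓜.recolours_setKeep hnX .x1 (α := 2) (β := 0) rfl
      (by norm_num)) (by norm_num) (by norm_num) hN hL₄ h₄
      (ψ := fun v => if v ∈ N then 3 else if v ∈ S ∧ ¬ hit v then 1 else 0) ?_)
      (t₂ := 5 * 𝓜.A.size N + 2) ?_
    · intro v
      simp only [φ₂]
      by_cases hvN : v ∈ N
      · simp [hvN]
      · by_cases hvS : v ∈ S <;> by_cases hv : hit v
        · simp [hvN, hvS, hv]; simp only [hit] at hv; tauto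
        · simp [hvN, hvS, hv]
        · simp [hvN, hvS]
        · simp [hvN, hvS]
    · rintro s₅ ⟨h₅, F₅⟩
      refine (memberSweep_spec hnX (𝓜.recolours_setKeep hnX .w1 (α := 3) (β := 1) rfl
        (by norm_num)) hN (hL₄.frame F₅ (by decide) (by decide)) h₅
        (fun w hw => by simp [hw]) (fun v => rfl)).imp ?_
      rintro s₆ ⟨h₆, F₆⟩
      refine ⟨F₄.trans ((F₅.trans F₆).mono (by decide)), ?_, ?_⟩
      · rw [F₆.1 .ok (by decide), F₅.1 .ok (by decide), hok₄']
      · rw [𝓜.holds_iff_status]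
        convert h₆ using 1
        funext v
        simp only [hmemT]
        by_cases hvN : v ∈ N <;> simp [hvN]
  · intro h0
    have hex : ¬ Exchangeable 𝓜.A ord S N := by
      intro hcon
      simp only [Ex.eval, hok₄', if_pos hcon] at h0
      omega
    rw [if_neg hex] at hok₄'
    simp only [if_neg hex]
    refine Run.seq (pairSweep_spec hnX (𝓜.recolours_setIn hnX .x1 (α := 2) (β := 1) rfl rfl
      (by norm_num)) (by norm_num) (by norm_num) hN hL₄ h₄ (ψ := φ₁) ?_)
      (t₂ := 5 * 𝓜.A.size N + 2) ?_
    · intro v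
      simp only [φ₁, φ₂]
      by_cases hvN : v ∈ N
      · simp [hvN]
      · by_cases hvS : v ∈ S <;> by_cases hv : hit v
        · simp [hvN, hvS, hv]; simp only [hit] at hv; tauto
        · simp [hvN, hvS, hv]
        · simp [hvN, hvS]
        · simp [hvN, hvS]
    · rintro s₅ ⟨h₅, F₅⟩
      refine (memberSweep_spec hnX (𝓜.recolours_setOut hnX .w1 (α := 3) (β := 0) rfl rfl
        (by norm_num)) hN (hL₄.frame F₅ (by decide) (by decide)) h₅
        (fun w hw => by simp [φ₁, hw]) (fun v => rfl)).imp ?_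
      rintro s₆ ⟨h₆, F₆⟩
      refine ⟨F₄.trans ((F₅.trans F₆).mono (by decide)), ?_, ?_⟩
      · rw [F₆.1 .ok (by decide), F₅.1 .ok (by decide), hok₄']
      · rw [𝓜.holds_iff_status]
        convert h₆ using 1
        funext v
        by_cases hvN : v ∈ N
        · simp [hvN, hNS v hvN]
        · simp [φ₁, hvN]

/-- The variables that testing a candidate changes. -/
def tryVars : List Var :=
  [.i1, .i2, .i3, .w1, .x1, .u1, .v1, .tmp, .ok, .st, .bits, .lst, .cnt]

theorem pick_eq_nil_iff {α : Type} [DecidableEq α] {l : List α} (hl : l.Nodup) {q : ℕ}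
    (hq : q < 2 ^ l.length) : pick l q = [] ↔ q = 0 := by
  constructor
  · intro h
    rw [← mask_pick l hl hq, h]
    clear h hq hl
    induction l with
    | nil => rfl
    | cons w l ih => rw [mask, ih]; simp
  · rintro rfl
    clear hq hl
    induction l with
    | nil => rfl
    | cons w l ih => rw [pick]; simpa using ih

open Classical in
/-- The conditions for a child, in the order in which the program tests them. -/
theorem AdjLists.child_eq (A : AdjLists G) (S : Finset (Fin n)) {j : ℕ} {v : Fin n}
    (hv : (ord.symm v : ℕ) = j / 2 ^ K) (N : List (Fin n)) (hN : N = A.candidate ord K v j) :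
    A.child ord K S j =
      if (ord.symm v : ℕ) < agree G ord S ∧ v ∈ S ∧ j % 2 ^ K ≠ 0 ∧
        ((∀ w ∈ N, firstPos G ord S w = ord.symm v) ∧ j % 2 ^ K < 2 ^ (A.late ord v).length) ∧
        Exchangeable A ord S N
      then some (exchange G S N.toFinset) else none := by
  have hlt : j / 2 ^ K < n := by rw [← hv]; exact (ord.symm v).2
  have hvv : ord ⟨j / 2 ^ K, hlt⟩ = v := by
    rw [← Equiv.eq_symm_apply]; exact Fin.ext hv.symm
  unfold AdjLists.child
  rw [dif_pos hlt]
  simp only [hvv]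
  rw [← hN]
  congr 1
  rw [eq_iff_iff]
  have hlate : ∀ w ∈ N, w ∈ A.late ord v := fun w hw => (pick_sublist _ _).subset (hN ▸ hw)
  have hkept : ∀ x, Defect G ord S x → ((∃ y ∈ A.late ord x, y ∈ S ∧ ∀ w' ∈ N, ¬ G.Adj w' y) ↔
      ∃ y ∈ S, G.Adj x y ∧ ∀ w' ∈ N.toFinset, ¬ G.Adj w' y) := by
    intro x hd
    simp only [AdjLists.mem_late, List.mem_toFinset]
    constructor
    · rintro ⟨y, h₁, h₂, h₃⟩
      exact ⟨y, h₂, h₁.1, h₃⟩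
    · rintro ⟨y, h₁, h₂, h₃⟩
      exact ⟨y, ⟨h₂, (defect_iff.1 hd).2 y h₁ h₂⟩, h₁, h₃⟩
  constructor
  · rintro ⟨h₁, h₂⟩
    refine ⟨h₂.lt_agree, h₂.mem, ?_, ⟨fun w hw => h₂.first w (by simpa using hw), h₁⟩,
      h₂.dominates, fun w hw x hwx => ?_⟩
    · rw [Ne, ← pick_eq_nil_iff (A.nodup_late ord v) h₁]
      obtain ⟨w, hw⟩ := h₂.nonempty
      rw [List.mem_toFinset, hN] at hw
      exact List.ne_nil_of_mem hw
    · have hxN : x ∉ N := fun hx =>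
        h₂.indep w (List.mem_toFinset.2 hw) x (List.mem_toFinset.2 hx) hwx
      exact ⟨hxN, fun hd => (hkept x hd).2 (h₂.kept w (List.mem_toFinset.2 hw) x hwx
        (by simpa using hxN) hd)⟩
  · rintro ⟨h₁, h₂, h₃, ⟨h₄, h₅⟩, h₆, h₇⟩
    refine ⟨h₅, ⟨h₁, h₂, ?_, ?_, ?_, ?_, ?_, h₆, ?_⟩⟩
    · rw [List.toFinset_nonempty_iff, hN]
      exact (not_iff_not.2 (pick_eq_nil_iff (A.nodup_late ord v) h₅)).2 h₃
    · exact fun w hw => (AdjLists.mem_late.1 (hlate w (List.mem_toFinset.1 hw))).1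
    · exact fun w hw => (AdjLists.mem_late.1 (hlate w (List.mem_toFinset.1 hw))).2
    · exact fun w hw => h₄ w (List.mem_toFinset.1 hw)
    · exact fun w hw x hx hwx =>
        (h₇ w (List.mem_toFinset.1 hw) x hwx).1 (List.mem_toFinset.1 hx)
    · exact fun w hw x hwx _ hd => (hkept x hd).1 ((h₇ w (List.mem_toFinset.1 hw) x hwx).2 hd)

/-- Testing a candidate takes constant time, for fixed `K`, unless the vertex `v` is the first
neighbour in `S` of all members. -/
theorem tryProg_spec (hp : 𝓜.Params ord K) {s : St n 𝓜.D.State} {S : Finset (Fin n)}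
    (hE : 𝓜.Env ord K s) (hS : 𝓜.Holds S s) (hA : 𝓜.Analysed ord S s) (hM : IsMIS G S) {j : ℕ}
    (hj : s.mem .cand 0 = j) (hjl : j < n * 2 ^ K) :
    Run 𝓜 tryProg s ((5 * K + 39) * 𝓜.A.testCost ord K S j + (9 * K + 26)) (fun s' =>
      Frame tryVars s s' ∧ match 𝓜.A.child ord K S j with
        | some T => s'.mem .ok 0 = 1 ∧ 𝓜.Holds T s'
        | none => s'.mem .ok 0 = 0 ∧ 𝓜.Holds S s') := by
  classical
  have hnX := hp.n_lt
  have hlt : j / 2 ^ K < n := by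
    rw [Nat.div_lt_iff_lt_mul (by positivity)]; exact hjl
  obtain ⟨v, hv⟩ : ∃ v, v = ord ⟨j / 2 ^ K, hlt⟩ := ⟨_, rfl⟩
  have hvi : (ord.symm v : ℕ) = j / 2 ^ K := by rw [hv]; simp
  obtain ⟨N, hN⟩ : ∃ N, N = 𝓜.A.candidate ord K v j := ⟨_, rfl⟩
  have hNn : N.Nodup := hN ▸ 𝓜.A.nodup_candidate ord K v j
  have hchild := 𝓜.A.child_eq S hvi N hN
  have hvX : (v : ℕ) < 𝓜.X := v.2.trans hnX
  have hcost : (∀ w ∈ N, firstPos G ord S w = ord.symm v) →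
      𝓜.A.testCost ord K S j = 𝓜.A.size N := by
    intro h
    unfold AdjLists.testCost
    rw [dif_pos hlt, ← hv, ← hN, ← hvi, if_pos h, AdjLists.size]
  -- In all other cases, the tests before the exchange fail, and the cost plays no role.
  set cost := 𝓜.A.testCost ord K S j with hcost_def
  refine Run.seq (t₁ := 1) (t₂ := (5 * K + 39) * cost + (9 * K + 25))
    (R := fun s' => s' = s.upd .i1 0 (j / 2 ^ K)) (Run.asg (t := 0) ⟨trivial, trivial, trivial⟩
      (by simp [Ex.eval, BinOp.apply, hj, hE.pow]) rfl) ?_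
  rintro _ rfl
  refine Run.seq (t₁ := 1) (t₂ := (5 * K + 39) * cost + (9 * K + 24))
    (R := fun s' => s' = (s.upd .i1 0 (j / 2 ^ K)).upd .bits 0 (j % 2 ^ K))
    (Run.asg (t := 0) ⟨trivial, trivial, trivial⟩
      (by simp [Ex.eval, BinOp.apply, St.upd_mem, hj, hE.pow]) rfl) ?_
  rintro _ rfl
  refine Run.seq (t₁ := 1) (t₂ := (5 * K + 39) * cost + (9 * K + 23))
    (R := fun s' => s' = ((s.upd .i1 0 (j / 2 ^ K)).upd .bits 0 (j % 2 ^ K)).upd .ok 0 0)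
    (Run.asg (t := 0) (by simp [Ex.Ok]) rfl rfl) ?_
  rintro _ rfl
  set s₁ := ((s.upd .i1 0 (j / 2 ^ K)).upd .bits 0 (j % 2 ^ K)).upd .ok 0 0 with hs₁
  have F₁ : Frame tryVars s s₁ := (((Frame.refl _ s).upd (by decide) _ _).upd (by decide) _ _).upd
    (by decide) _ _
  have hi₁ : s₁.mem .i1 0 = ord.symm v := by rw [hvi]; simp [hs₁, St.upd_mem]
  have hb₁ : s₁.mem .bits 0 = j % 2 ^ K := by simp [hs₁, St.upd_mem]
  have ho₁ : s₁.mem .ok 0 = 0 := by simp [hs₁, St.upd_mem]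
  have hS₁ : 𝓜.Holds S s₁ := hS.congr rfl rfl
  have hA₁ : 𝓜.Analysed ord S s₁ := hA.congr rfl rfl
  have hE₁ : 𝓜.Env ord K s₁ := hE.frame F₁ (by decide)
  have hnone : ∀ {s' : St n 𝓜.D.State}, 𝓜.A.child ord K S j = none → Frame tryVars s s' →
      s'.mem .ok 0 = 0 → 𝓜.Holds S s' → (Frame tryVars s s' ∧ match 𝓜.A.child ord K S j with
        | some T => s'.mem .ok 0 = 1 ∧ 𝓜.Holds T s'
        | none => s'.mem .ok 0 = 0 ∧ 𝓜.Holds S s') := by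
    intro s' h h₁ h₂ h₃
    rw [h]
    exact ⟨h₁, h₂, h₃⟩
  clear_value s₁
  refine Run.branch (t := (5 * K + 39) * cost + (9 * K + 22)) ⟨trivial, trivial, trivial⟩ ?_ ?_
  swap
  · intro h0
    refine Run.skip (hnone ?_ F₁ ho₁ hS₁)
    rw [hchild, if_neg]
    rintro ⟨h, -⟩
    simp [Ex.eval, BinOp.apply, hi₁, hA₁.agr, h] at h0
  intro hne
  have hagr : (ord.symm v : ℕ) < agree G ord S := by
    by_contra hcon
    exact hne (by simp [Ex.eval, BinOp.apply, hi₁, hA₁.agr, hcon])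
  clear hne
  have hov : s₁.mem .ord (ord.symm v) = v := by
    have := hE₁.ordAt (ord.symm v)
    rwa [Equiv.apply_symm_apply] at this
  refine Run.seq (t₁ := 1) (t₂ := (5 * K + 39) * cost + (9 * K + 21))
    (R := fun s' => s' = s₁.upd .v1 0 v) (Run.asg (t := 0) ?_ ?_ rfl) ?_
  · exact ⟨trivial, by simp only [Ex.eval, hi₁]; exact (ord.symm v).2.trans hnX⟩
  · simp [Ex.eval, hi₁, hov]
  rintro _ rfl
  refine Run.branch (t := (5 * K + 39) * cost + (9 * K + 20))
    ⟨trivial, by simpa [Ex.eval, St.upd_mem] using hvX⟩ ?_ ?_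
  swap
  · intro h0
    refine Run.skip (hnone ?_ (F₁.upd (by decide) _ _) ho₁ (hS₁.congr rfl rfl))
    rw [hchild, if_neg]
    rintro ⟨-, h, -⟩
    simp [Ex.eval, St.upd_mem, hS₁.st, h] at h0
  intro hne
  have hvS : v ∈ S := by
    by_contra hcon
    exact hne (by simp [Ex.eval, St.upd_mem, hS₁.st, hcon])
  clear hne
  refine Run.branch (t := (5 * K + 39) * cost + (9 * K + 19)) trivial ?_ ?_
  swap
  · intro h0
    refine Run.skip (hnone ?_ (F₁.upd (by decide) _ _) ho₁ (hS₁.congr rfl rfl))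
    rw [hchild, if_neg]
    rintro ⟨-, -, h, -⟩
    apply h
    simpa [Ex.eval, St.upd_mem, hb₁] using h0
  intro hne
  have hq0 : j % 2 ^ K ≠ 0 := by
    simpa [Ex.eval, St.upd_mem, hb₁] using hne
  clear hne
  refine Run.seq (t₁ := 1) (t₂ := (5 * K + 39) * cost + (9 * K + 18))
    (R := fun s' => s' = (s₁.upd .v1 0 v).upd .ok 0 1)
    (Run.asg (t := 0) (by simp [Ex.Ok]) rfl rfl) ?_
  rintro _ rfl
  have F₂ : Frame tryVars s ((s₁.upd .v1 0 v).upd .ok 0 1) :=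
    (F₁.upd (by decide) _ _).upd (by decide) _ _
  refine Run.seq (collectProg_spec hp (hE.frame F₂ (by decide)) (S := S) (hA₁.congr rfl rfl)
    (v := v) (i := ord.symm v) (q := j % 2 ^ K) (by simp [St.upd_mem])
    (by simpa [St.upd_mem] using hi₁) (by simpa [St.upd_mem] using hb₁) (by simp [St.upd_mem]))
    (t₂ := (5 * K + 39) * cost + 13) ?_
  rintro s₂ ⟨⟨hL₂, hd₂, F₂'⟩, ho₂⟩
  have F₃ : Frame tryVars s s₂ := F₂.trans (F₂'.mono (by decide))
  have hS₂ : 𝓜.Holds S s₂ := hS₁.congr (F₂'.1 .st (by decide)) hd₂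
  have hA₂ : 𝓜.Analysed ord S s₂ :=
    hA₁.congr (F₂'.1 .fst (by decide)) (F₂'.1 .agr (by decide))
  rw [show pick (𝓜.A.late ord v) (j % 2 ^ K) = N from hN.symm] at hL₂ ho₂
  refine Run.branch trivial ?_ ?_
  swap
  · intro h0
    have ho₂' : s₂.mem .ok 0 = 0 := h0
    refine Run.skip (hnone ?_ F₃ ho₂' hS₂)
    rw [hchild, if_neg]
    rintro ⟨-, -, -, h, -⟩
    rw [if_pos h] at ho₂
    omega
  intro hne
  have hfirst : (∀ w ∈ N, firstPos G ord S w = ord.symm v) ∧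
      j % 2 ^ K < 2 ^ (𝓜.A.late ord v).length := by
    by_contra hcon
    exact hne (by simp only [Ex.eval, ho₂, if_neg hcon])
  have hNS : ∀ w ∈ N, w ∉ S := by
    intro w hw hwS
    have : w ∈ 𝓜.A.late ord v := (pick_sublist _ _).subset (hN ▸ hw)
    exact hM.not_adj hvS hwS (AdjLists.mem_late.1 this).1
  rw [hcost hfirst.1]
  refine (exchangeProg_spec hp (hE.frame F₃ (by decide)) hS₂ hA₂ hNn hL₂ hNS).imp ?_
  rintro s₃ ⟨F₄, h⟩
  have F₅ : Frame tryVars s s₃ := F₃.trans (F₄.mono (by decide))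
  by_cases hex : Exchangeable 𝓜.A ord S N
  · rw [if_pos hex] at h
    rw [hchild, if_pos ⟨hagr, hvS, hq0, hfirst, hex⟩]
    exact ⟨F₅, h⟩
  · rw [if_neg hex] at h
    refine hnone ?_ F₅ h.1 h.2
    rw [hchild, if_neg]
    rintro ⟨-, -, -, -, h'⟩
    exact hex h'

end


/-! ### Moving to the parent -/

/-- Replace the current set, which is not the root, by its parent, and compute the number that it
has as a child of its parent.  -/
def upProg : Prog :=
  asg .v1 (.arr .ord (.var .agr)) ;;
  asg .bits (.lit 0) ;;
  asg .tmp (.lit 1) ;;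
  forLoop .i2 (.arr .len (.var .v1)) (
    asg .w1 (.arr .late (.op .add (.op .mul (.var .v1) (.var .dgn)) (.var .i2))) ;;
    branch (.arr .st (.var .w1)) (asg .bits (.op .add (.var .bits) (.var .tmp))) .skip ;;
    asg .tmp (.op .add (.var .tmp) (.var .tmp))) ;;
  asg .cand (.op .add (.op .mul (.var .agr) (.var .pow)) (.var .bits)) ;;
  forNbrs .v1 (branch (.arr .st (.var .x1)) (setOut .x1 0) .skip) ;;
  setIn .v1 1 ;;
  greedyProg ;;
  analyseProg

/-- The variables that moving to the parent changes. -/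
def upVars : List Var :=
  [.i1, .i2, .x1, .u1, .ok, .st, .fst, .agr, .v1, .bits, .tmp, .w1, .cand]

section

variable {n : ℕ} {G : SimpleGraph (Fin n)} {𝓜 : Machine G} {ord : VertexOrder n} {K : ℕ}

theorem mask_append_singleton {α : Type} [DecidableEq α] (l : List α) (w : α) (S : Finset α) :
    mask (l ++ [w]) S = mask l S + if w ∈ S then 2 ^ l.length else 0 := by
  induction l with
  | nil => simp [mask]
  | cons x l ih =>
    rw [List.cons_append, mask, mask, ih, List.length_cons, pow_succ]
    split_ifs <;> ring

theorem AdjLists.length_le_degSum (A : AdjLists G) (v : Fin n) :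
    (A.nbrs v).length ≤ A.degSum :=
  Finset.single_le_sum (f := fun v => (A.nbrs v).length) (fun _ _ => Nat.zero_le _) (mem_univ v)

/-- Apart from the parent, the program computes from where the search has to continue there: `cand`
becomes the number of `T` as a child. -/
theorem upProg_spec (hp : 𝓜.Params ord K) {s : St n 𝓜.D.State} {T : Finset (Fin n)}
    (hE : 𝓜.Env ord K s) (hS : 𝓜.Holds T s) (hA : 𝓜.Analysed ord T s) (hM : IsMIS G T)
    (hlt : agree G ord T < n) :
    Run 𝓜 upProg s (17 * 𝓜.A.degSum + 23 * n + 6 * K + 15) (fun s' => Frame upVars s s' ∧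
      𝓜.Holds (parent G ord T) s' ∧ 𝓜.Analysed ord (parent G ord T) s' ∧
      s'.mem .cand 0 = 𝓜.A.childIndex ord K T) := by
  classical
  have hnX := hp.n_lt
  have hpow := hp.pow_lt
  have hlim := hp.lim_lt
  have hKW := hp.K_lt_W
  obtain ⟨v, hv⟩ : ∃ v, v = ord ⟨_, hlt⟩ := ⟨_, rfl⟩
  have hvd : Defect G ord T v := hv ▸ defect_of_agree_lt hlt
  have hva : agree G ord T = ord.symm v := by rw [hv]; simp
  have hvX : (v : ℕ) < 𝓜.X := v.2.trans hnX
  set L := 𝓜.A.late ord v with hL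
  have hlen : L.length ≤ K := hp.length_le v
  have hmaskK : mask L T < 2 ^ K :=
    (mask_lt L T).trans_le (Nat.pow_le_pow_right (by norm_num) hlen)
  have hidx : 𝓜.A.childIndex ord K T = agree G ord T * 2 ^ K + mask L T := by
    unfold AdjLists.childIndex
    rw [dif_pos hlt, ← hv]
  have hidxlt : agree G ord T * 2 ^ K + mask L T < n * 2 ^ K :=
    calc _ < (agree G ord T + 1) * 2 ^ K := by rw [add_mul, one_mul]; omega
      _ ≤ _ := Nat.mul_le_mul_right _ hlt
  have hdeg := 𝓜.A.length_le_degSum v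
  have hov : s.mem .ord (agree G ord T) = v := by rw [hv]; exact hE.ordAt ⟨_, hlt⟩
  refine Run.seq (t₁ := 1) (t₂ := 17 * 𝓜.A.degSum + 23 * n + 6 * K + 14)
    (R := fun s' => s' = s.upd .v1 0 v) (Run.asg (t := 0)
      ⟨trivial, by simp only [Ex.eval, hA.agr]; omega⟩ (by simp [Ex.eval, hA.agr, hov]) rfl) ?_
  rintro _ rfl
  refine Run.seq (t₁ := 1) (t₂ := 17 * 𝓜.A.degSum + 23 * n + 6 * K + 13)
    (R := fun s' => s' = (s.upd .v1 0 v).upd .bits 0 0)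
    (Run.asg (t := 0) (by simp [Ex.Ok]) rfl rfl) ?_
  rintro _ rfl
  refine Run.seq (t₁ := 1) (t₂ := 17 * 𝓜.A.degSum + 23 * n + 6 * K + 12)
    (R := fun s' => s' = ((s.upd .v1 0 v).upd .bits 0 0).upd .tmp 0 1)
    (Run.asg (t := 0) (by simp [Ex.Ok]) rfl rfl) ?_
  rintro _ rfl
  set s₁ := ((s.upd .v1 0 v).upd .bits 0 0).upd .tmp 0 1 with hs₁
  have F₁ : Frame upVars s s₁ := (((Frame.refl _ s).upd (by decide) _ _).upd (by decide) _ _).upd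
    (by decide) _ _
  refine Run.seq (t₁ := 6 * K + 2) (t₂ := 17 * 𝓜.A.degSum + 23 * n + 10)
    (R := fun s' => (Frame upVars s s' ∧ 𝓜.Holds T s' ∧ 𝓜.Analysed ord T s' ∧ s'.mem .v1 0 = v) ∧
      s'.mem .bits 0 = mask L T) ?_ ?_
  · refine Run.forLoop L.length (fun _ => 4) (fun r s' => (Frame upVars s s' ∧ 𝓜.Holds T s' ∧
      𝓜.Analysed ord T s' ∧ s'.mem .v1 0 = v) ∧ s'.mem .bits 0 = mask (L.take r) T ∧
      s'.mem .tmp 0 = 2 ^ r) (by omega) ?_ ?_ ?_ ?_ ?_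
    · exact ⟨⟨F₁.upd (by decide) _ _, hS.congr rfl rfl, hA.congr rfl rfl,
        by simp [hs₁, St.upd_mem]⟩, by simp [hs₁, St.upd_mem, mask], by simp [hs₁, St.upd_mem]⟩
    · rintro r s' - ⟨⟨a₁, a₂, a₃, a₄⟩, a₅, a₆⟩
      exact ⟨⟨trivial, by simpa [Ex.eval, a₄] using hvX⟩,
        by simpa [Ex.eval, a₄] using (hE.frame a₁ (by decide)).len v⟩
    · rintro r s₂ hr ⟨⟨a₁, a₂, a₃, a₄⟩, a₅, a₆⟩ hir
      have hE₂ := hE.frame a₁ (by decide)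
      obtain ⟨hlok, hlev⟩ := hE₂.late_ok hp hr a₄ hir
      have htake : L.take (r + 1) = L.take r ++ [L[r]] := by simp
      have hmask := mask_append_singleton (L.take r) L[r] T
      rw [← htake, List.length_take, min_eq_left hr.le] at hmask
      have hmr := mask_lt (L.take r) T
      rw [List.length_take, min_eq_left hr.le] at hmr
      have hrK : 2 ^ r ≤ 2 ^ K := Nat.pow_le_pow_right (by norm_num) (by omega)
      refine Run.seq (t₁ := 1) (t₂ := 3) (R := fun s' => s' = s₂.upd .w1 0 L[r])
        (Run.asg (t := 0) hlok hlev rfl) ?_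
      rintro _ rfl
      have F₂ : Frame upVars s (s₂.upd .w1 0 L[r]) := a₁.upd (by decide) _ _
      refine Run.seq (t₁ := 2) (t₂ := 1) (R := fun s' => s'.mem .i2 0 = r ∧
        (Frame upVars s s' ∧ 𝓜.Holds T s' ∧ 𝓜.Analysed ord T s' ∧ s'.mem .v1 0 = v) ∧
        s'.mem .bits 0 = mask (L.take (r + 1)) T ∧ s'.mem .tmp 0 = 2 ^ r) ?_ ?_
      · have hst : (s₂.upd .w1 0 L[r]).mem .st (L[r] : Fin n) = if L[r] ∈ T then 1 else 0 :=
          a₂.st L[r]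
        refine Run.branch (t := 1) ⟨trivial, ?_⟩ ?_ ?_
        · simp only [Ex.eval, St.upd_mem]
          simpa using L[r].2.trans hnX
        · intro hne
          have hmem : L[r] ∈ T := by
            by_contra hcon
            apply hne
            rw [if_neg hcon] at hst
            simpa [Ex.eval, St.upd_mem] using hst
          rw [if_pos hmem] at hmask
          refine Run.asg (t := 0) (z := mask (L.take r) T + 2 ^ r) ⟨trivial, trivial, ?_⟩ ?_ ?_
          · simp only [BinOp.Fits, Ex.eval, St.upd_mem]
            simp [a₅, a₆]
            omega
          · simp [Ex.eval, BinOp.apply, St.upd_mem, a₅, a₆]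
          · exact ⟨by simpa [St.upd_mem] using hir, ⟨F₂.upd (by decide) _ _, a₂.congr rfl rfl,
              a₃.congr rfl rfl, by simpa [St.upd_mem] using a₄⟩, by simp [St.upd_mem, hmask],
              by simpa [St.upd_mem] using a₆⟩
        · intro h0
          have hmem : L[r] ∉ T := by
            intro hcon
            rw [if_pos hcon] at hst
            have : (s₂.upd .w1 0 L[r]).mem .st (L[r] : Fin n) = 0 := by
              simpa [Ex.eval, St.upd_mem] using h0
            omega
          rw [if_neg hmem, add_zero] at hmask
          exact Run.skip ⟨by simpa [St.upd_mem] using hir, ⟨F₂, a₂.congr rfl rfl,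
            a₃.congr rfl rfl, by simpa [St.upd_mem] using a₄⟩, by rw [hmask]; exact a₅, a₆⟩
      · rintro s₃ ⟨b₁, ⟨b₂, b₃, b₄, b₅⟩, b₆, b₇⟩
        refine Run.asg (t := 0) (z := 2 ^ (r + 1)) ⟨trivial, trivial, ?_⟩ ?_ ?_
        · simp only [BinOp.Fits, Ex.eval, b₇]
          omega
        · simp only [Ex.eval, BinOp.apply, b₇, pow_succ]; ring
        · exact ⟨by simpa [St.upd_mem] using b₁, ⟨(b₂.upd (by decide) _ _).upd (by decide) _ _,
            b₃.congr rfl rfl, b₄.congr rfl rfl, by simpa [St.upd_mem] using b₅⟩,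
            by simpa [St.upd_mem] using b₆, by simp [St.upd_mem]⟩
    · rintro s' ⟨h₁, h₂, -⟩
      rw [List.take_length] at h₂
      exact ⟨h₁, h₂⟩
    · simp; omega
  rintro s₂ ⟨⟨F₂, a₂, a₃, a₄⟩, a₅⟩
  have hE₂ := hE.frame F₂ (by decide)
  refine Run.seq (t₁ := 1) (t₂ := 17 * 𝓜.A.degSum + 23 * n + 9)
    (R := fun s' => s' = s₂.upd .cand 0 (agree G ord T * 2 ^ K + mask L T))
    (Run.asg (t := 0) ⟨⟨trivial, trivial, ?_⟩, trivial, ?_⟩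
      (by simp [Ex.eval, BinOp.apply, a₃.agr, hE₂.pow, a₅]) rfl) ?_
  · simp only [BinOp.Fits, Ex.eval, a₃.agr, hE₂.pow]; omega
  · simp only [BinOp.Fits, Ex.eval, BinOp.apply, a₃.agr, hE₂.pow, a₅]; omega
  rintro _ rfl
  rw [← hidx]
  have F₃ : Frame upVars s (s₂.upd .cand 0 (𝓜.A.childIndex ord K T)) := F₂.upd (by decide) _ _
  let N := T.filter (fun u => G.Adj v u)
  refine Run.seq (t₁ := 6 * 𝓜.A.degSum + 2) (t₂ := 11 * 𝓜.A.degSum + 23 * n + 7)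
    (R := fun s' => (Frame upVars s s' ∧ s'.mem .cand 0 = 𝓜.A.childIndex ord K T ∧
      s'.mem .v1 0 = v) ∧ 𝓜.Status (fun x => if x ∈ T \ N then 1 else 0) s') ?_ ?_
  · refine Run.forNbrs v 3 (fun l s' => (Frame upVars s s' ∧
      s'.mem .cand 0 = 𝓜.A.childIndex ord K T ∧ s'.mem .v1 0 = v) ∧
      𝓜.Status (fun x => if x ∈ T ∧ x ∉ l then 1 else 0) s') ?_ ?_ ?_ ?_ ?_ ?_ ?_
    · refine ⟨⟨F₃, by simp [St.upd_mem], by simpa [St.upd_mem] using a₄⟩, ?_⟩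
      simpa using (𝓜.holds_iff_status.1 a₂).congr (s' := s₂.upd .cand 0 _) rfl rfl
    · rintro l s' z ⟨⟨h₁, h₂, h₃⟩, h₄⟩
      exact ⟨⟨h₁.upd (by decide) _ _, by simpa [St.upd_mem] using h₂,
        by simpa [St.upd_mem] using h₃⟩, h₄.congr rfl rfl⟩
    · rintro l s' z ⟨⟨h₁, h₂, h₃⟩, h₄⟩
      exact ⟨⟨h₁.upd (by decide) _ _, by simpa [St.upd_mem] using h₂,
        by simpa [St.upd_mem] using h₃⟩, h₄.congr rfl rfl⟩
    · rintro l s' ⟨⟨h₁, h₂, h₃⟩, h₄⟩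
      exact h₃
    · rintro l x s' - ⟨⟨h₁, h₂, h₃⟩, h₄⟩ hx
      have hst := h₄.st x
      refine Run.branch (t := 2) ⟨trivial, by simpa [Ex.eval, hx] using x.2.trans hnX⟩ ?_ ?_
      · intro hne
        have hmem : x ∈ T ∧ x ∉ l := by
          by_contra hcon
          exact hne (by simp only [Ex.eval, hx, hst, if_neg hcon])
        refine (𝓜.recolours_setOut hnX .x1 (α := 1) (β := 0) rfl rfl (by norm_num) _ s' x h₄ hx
          (if_pos hmem)).imp ?_
        rintro s'' ⟨g₁, g₂⟩
        refine ⟨by rw [g₁.1 .i2 (by decide)], ⟨h₁.trans (g₁.mono (by decide)),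
          by rw [g₁.1 .cand (by decide), h₂], by rw [g₁.1 .v1 (by decide), h₃]⟩, ?_⟩
        convert g₂ using 1
        funext y
        by_cases hy : y = x
        · simp [hy]
        · simp [hy]
      · intro h0
        have hmem : ¬ (x ∈ T ∧ x ∉ l) := by
          intro hcon
          simp only [Ex.eval, hx, hst, if_pos hcon] at h0
          omega
        refine Run.skip ⟨rfl, ⟨h₁, h₂, h₃⟩, ?_⟩
        convert h₄ using 1
        funext y
        by_cases hy : y = x
        · rw [hy, if_neg hmem]; simp
        · simp [hy]
    · rintro s' ⟨h₁, h₂⟩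
      refine ⟨h₁, ?_⟩
      convert h₂ using 1
      funext x
      by_cases hx : x ∈ T <;> simp [N, hx, 𝓜.A.mem_iff]
    · omega
  rintro s₄ ⟨⟨F₄, b₁, b₂⟩, b₃⟩
  have hvT := hvd.1
  refine Run.seq (𝓜.recolours_setIn hnX .v1 (α := 0) (β := 1) rfl rfl (by norm_num) _ s₄ v b₃ b₂
    (by simp [hvT])) (t₂ := 11 * 𝓜.A.degSum + 23 * n + 5) ?_
  rintro s₅ ⟨F₅, c₁⟩
  have F₅' : Frame upVars s s₅ := F₄.trans (F₅.mono (by decide))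
  have hH : 𝓜.Holds (insert v T \ N) s₅ := by
    rw [𝓜.holds_iff_status]
    convert c₁ using 1
    funext x
    by_cases hx : x = v
    · simp [hx, N]
    · simp [hx]
  refine Run.seq (greedyProg_spec hp (hE.frame F₅' (by decide)) hH)
    (t₂ := 6 * 𝓜.A.degSum + 11 * n + 3) ?_
  rintro s₆ ⟨d₁, F₆⟩
  have F₆' : Frame upVars s s₆ := F₅'.trans (F₆.mono (by decide))
  have hpar : parent G ord T = lexFirstSuperset G ord (insert v T \ N) := parent_eq hM hvd hva
  rw [← hpar] at d₁
  refine (analyseProg_spec hp (hE.frame F₆' (by decide)) d₁).imp ?_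
  rintro s₇ ⟨e₁, e₂, F₇⟩
  refine ⟨F₆'.trans (F₇.mono (by decide)), e₁, e₂, ?_⟩
  rw [F₇.1 .cand (by decide), F₆.1 .cand (by decide), F₅.1 .cand (by decide), b₁]

end


/-! ### Computing a degeneracy ordering -/

/-- Append the vertex `y` to the queue. -/
def pushProg (y : Var) : Prog :=
  sto .ord (.var .tail) (.var y) ;; sto .mk (.var y) (.lit 1) ;;
    asg .tail (.op .add (.var .tail) (.lit 1))

/-- Remove the first vertex of the queue that has not been removed, and append to the queue the
neighbours that have fewer than `dgn` neighbours left. -/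
def removeProg : Prog :=
  asg .v1 (.arr .ord (.var .head)) ;;
  forNbrs .v1 (branch (.arr .mk (.var .x1)) .skip (
    sto .dg (.var .x1) (.op .sub (.arr .dg (.var .x1)) (.lit 1)) ;;
    branch (.op .lt (.arr .dg (.var .x1)) (.var .dgn)) (pushProg .x1) .skip)) ;;
  asg .head (.op .add (.var .head) (.lit 1))

/-- Increase `dgn`, and append to the queue the vertices that have fewer than `dgn` neighbours
left. -/
def raiseProg : Prog :=
  asg .dgn (.op .add (.var .dgn) (.lit 1)) ;;
  forLoop .i1 .size (branch (.arr .mk (.var .i1)) .skip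
    (branch (.op .lt (.arr .dg (.var .i1)) (.var .dgn)) (pushProg .i1) .skip))

/-- Compute an ordering of the vertices by peeling: as long as some vertex has fewer than `dgn`
neighbours left, remove such a vertex; otherwise increase `dgn`. -/
def peelProg : Prog :=
  forLoop .i1 .size (sto .dg (.var .i1) (.deg (.var .i1))) ;;
  whileLoop (.op .lt (.var .head) .size)
    (branch (.op .lt (.var .head) (.var .tail)) removeProg raiseProg)

/-- The variables that the peeling process changes. -/
def peelVars : List Var := [.dgn, .ord, .dg, .mk, .head, .tail, .i1, .i2, .v1, .x1]

section

variable {n : ℕ} {G : SimpleGraph (Fin n)} {𝓜 : Machine G}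

/-- The number of neighbours of `v` that are not in `P`. -/
def AdjLists.rest (A : AdjLists G) (P : List (Fin n)) (v : Fin n) : ℕ :=
  (A.nbrs v).countP (· ∉ P)

theorem AdjLists.rest_anti (A : AdjLists G) {P P' : List (Fin n)} (h : P ⊆ P') (v : Fin n) :
    A.rest P' v ≤ A.rest P v := by
  refine List.countP_mono_left fun w _ hw => ?_
  simp only [decide_eq_true_eq] at hw ⊢
  exact fun hP => hw (h hP)

theorem AdjLists.rest_append_singleton (A : AdjLists G) {P : List (Fin n)} {q : Fin n}
    (hq : q ∉ P) (v : Fin n) :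
    A.rest (P ++ [q]) v = A.rest P v - if v ∈ A.nbrs q then 1 else 0 := by
  have hsymm : v ∈ A.nbrs q ↔ q ∈ A.nbrs v := by rw [A.mem_iff, A.mem_iff, G.adj_comm]
  have key : ∀ l : List (Fin n), l.Nodup →
      l.countP (· ∉ P) = l.countP (· ∉ P ++ [q]) + if q ∈ l then 1 else 0 := by
    intro l hl
    induction l with
    | nil => simp
    | cons x l ih =>
      have hx := (List.nodup_cons.1 hl).1
      have ih := ih (List.nodup_cons.1 hl).2
      rw [List.countP_cons, List.countP_cons, ih]
      by_cases hxq : x = q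
      · subst hxq
        simp [hx, hq]
      · have : q ≠ x := fun h => hxq h.symm
        have h' : decide (x ∉ P ++ [q]) = decide (x ∉ P) := by simp [hxq]
        rw [h']
        simp only [List.mem_cons, this, false_or]
        omega
  have := key _ (A.nodup v)
  unfold AdjLists.rest
  simp only [hsymm]
  omega

/-- In a `k`-degenerate graph, one of the vertices outside of `P` has at most `k` neighbours
outside of `P`. -/
theorem AdjLists.exists_rest_le (A : AdjLists G) {k : ℕ} (hG : IsDegenerate G k)
    {P : List (Fin n)} (hP : ∃ v, v ∉ P) : ∃ v, v ∉ P ∧ A.rest P v ≤ k := by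
  obtain ⟨ord, hord⟩ := hG
  obtain ⟨v, hv, hmin⟩ := (univ.filter (· ∉ P)).exists_min_image (fun v => ord.symm v)
    (by obtain ⟨v, hv⟩ := hP; exact ⟨v, by simpa using hv⟩)
  simp only [mem_filter, mem_univ, true_and] at hv hmin
  refine ⟨v, hv, le_trans ?_ (hord v)⟩
  have hnd : ((A.nbrs v).filter (· ∉ P)).Nodup := (A.nodup v).filter _
  rw [AdjLists.rest, List.countP_eq_length_filter, ← List.toFinset_card_of_nodup hnd,
    ← Set.ncard_coe_finset]
  refine Set.ncard_le_ncard ?_ (Set.toFinite _)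
  intro w hw
  simp only [List.coe_toFinset, List.mem_filter, A.mem_iff, decide_eq_true_eq,
    Set.mem_ofPred_eq] at hw
  refine ⟨hw.1, lt_of_le_of_ne (hmin w hw.2) fun h => ?_⟩
  rw [ord.symm.injective h] at hw
  exact G.loopless.irrefl _ hw.1

/-- The invariant of the peeling process: the vertices `Q` have been queued, each of them with fewer
than `K` neighbours outside of the part of the queue before it, and `g` bounds, for the other
vertices, the number of neighbours outside of the queue. -/
structure Machine.Peeling (𝓜 : Machine G) (s₀ : St n 𝓜.D.State) (Q : List (Fin n)) (K : ℕ)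
    (g : Fin n → ℕ) (s : St n 𝓜.D.State) : Prop where
  frame : Frame peelVars s₀ s
  dom : s.dom = s₀.dom
  nodup : Q.Nodup
  dgn : s.mem .dgn 0 = K
  tail : s.mem .tail 0 = Q.length
  ordAt : ∀ (i : ℕ) (h : i < Q.length), s.mem .ord i = Q[i]
  marked : ∀ v : Fin n, s.mem .mk v = if v ∈ Q then 1 else 0
  dg : ∀ v : Fin n, v ∉ Q → s.mem .dg v = g v
  rest_le : ∀ v, v ∉ Q → 𝓜.A.rest Q v ≤ g v
  few : ∀ (i : ℕ) (h : i < Q.length), 𝓜.A.rest (Q.take i) Q[i] < K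

variable {s₀ s : St n 𝓜.D.State} {Q : List (Fin n)} {K : ℕ} {g : Fin n → ℕ}

theorem Machine.Peeling.upd (h : 𝓜.Peeling s₀ Q K g s) {a : Var}
    (ha : a ∈ [Var.head, .i1, .i2, .v1, .x1]) (x y : ℕ) : 𝓜.Peeling s₀ Q K g (s.upd a x y) := by
  have hne : ∀ b ∈ [Var.dgn, .tail, .ord, .mk, .dg], (s.upd a x y).mem b = s.mem b := by
    intro b hb
    refine St.upd_mem_of_ne _ _ _ _ ?_
    rintro rfl
    revert b
    decide
  simp only [List.mem_cons, List.not_mem_nil, or_false, forall_eq_or_imp, forall_eq] at hne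
  obtain ⟨e₁, e₂, e₃, e₄, e₅⟩ := hne
  refine ⟨h.frame.upd ?_ _ _, h.dom, h.nodup, e₁ ▸ h.dgn, e₂ ▸ h.tail, e₃ ▸ h.ordAt, e₄ ▸ h.marked,
    e₅ ▸ h.dg, h.rest_le, h.few⟩
  have : ∀ a ∈ [Var.head, .i1, .i2, .v1, .x1], a ∈ peelVars := by decide
  exact this a ha

theorem pushProg_spec (hnX : n < 𝓜.X) (h : 𝓜.Peeling s₀ Q K g s) {y : Var}
    (hy : y ∈ [Var.i1, .x1]) {v : Fin n} (hyv : s.mem y 0 = v) (hv : v ∉ Q) (hK : g v < K) :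
    Run 𝓜 (pushProg y) s 3 (fun s' => (∀ a ∈ [Var.i1, .i2, .v1, .x1, .head], s'.mem a = s.mem a) ∧
      𝓜.Peeling s₀ (Q ++ [v]) K g s') := by
  have hnd : (Q ++ [v]).Nodup := by
    rw [List.nodup_append]
    exact ⟨h.nodup, List.nodup_singleton v, by
      simp only [List.mem_singleton]; rintro a ha b rfl rfl; exact hv ha⟩
  have hlen := hnd.length_le_card
  simp only [List.length_append, List.length_singleton, Fintype.card_fin] at hlen
  have hW := 𝓜.hnW
  have hvn := v.2
  have hyne : ∀ y ∈ [Var.i1, .x1], y ≠ .ord := by decide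
  have n₁ := hyne y hy
  refine Run.seq (t₁ := 1) (t₂ := 2) (R := fun s' => s' = s.upd .ord Q.length v)
    (Run.sto (t := 0) trivial h.tail (by omega) trivial hyv rfl (hce := by
      simp [Ex.compile, Expr.cost])) ?_
  rintro _ rfl
  refine Run.seq (t₁ := 1) (t₂ := 1)
    (R := fun s' => s' = (s.upd .ord Q.length v).upd .mk v 1)
    (Run.sto (t := 0) trivial ?_ (by omega) (by simp [Ex.Ok]) rfl rfl (hcx := by
      simp [Ex.compile, Expr.cost])) ?_
  · simp [Ex.eval, St.upd_mem_of_ne, n₁, hyv]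
  rintro _ rfl
  refine Run.asg (t := 0) (z := Q.length + 1) ⟨trivial, by simp [Ex.Ok], ?_⟩ ?_ ?_
  · simp only [BinOp.Fits, Ex.eval, St.upd_mem]
    simp [h.tail]; omega
  · simp [Ex.eval, BinOp.apply, St.upd_mem, h.tail]
  · refine ⟨?_, ⟨?_, h.dom, hnd, ?_, ?_, ?_, ?_, ?_, ?_, ?_⟩⟩
    · intro a ha
      have : ∀ a ∈ [Var.i1, .i2, .v1, .x1, .head], a ≠ .ord ∧ a ≠ .mk ∧ a ≠ .tail := by decide
      have := this a ha
      rw [St.upd_mem_of_ne _ _ _ _ this.2.2, St.upd_mem_of_ne _ _ _ _ this.2.1,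
        St.upd_mem_of_ne _ _ _ _ this.1]
    · exact ((h.frame.upd (by decide) _ _).upd (by decide) _ _).upd (by decide) _ _
    · simpa [St.upd_mem] using h.dgn
    · simp [St.upd_mem]
    · intro i hi
      by_cases hiQ : i < Q.length
      · have : i ≠ Q.length := hiQ.ne
        simp [St.upd_mem, this, List.getElem_append_left hiQ, h.ordAt i hiQ]
      · have : i = Q.length := by simp at hi; omega
        subst this
        simp [St.upd_mem]
    · intro w
      by_cases hw : w = v
      · simp [St.upd_mem, hw]
      · have : (w : ℕ) ≠ v := fun h => hw (Fin.ext h)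
        simp [St.upd_mem, hw, this, h.marked]
    · intro w hw
      simp only [List.mem_append, not_or] at hw
      simpa [St.upd_mem] using h.dg w hw.1
    · intro w hw
      simp only [List.mem_append, not_or] at hw
      exact (𝓜.A.rest_anti (by simp) w).trans (h.rest_le w hw.1)
    · intro i hi
      by_cases hiQ : i < Q.length
      · rw [List.getElem_append_left hiQ, List.take_append_of_le_length hiQ.le]
        exact h.few i hiQ
      · have : i = Q.length := by simp at hi; omega
        subst this
        simp only [List.take_left', List.getElem_concat_length]
        exact (h.rest_le v hv).trans_lt hK

/-- The vertices that have not been queued have at least `K` neighbours that are not among the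
first `h` vertices of the queue. -/
def Machine.Settled (𝓜 : Machine G) (s₀ : St n 𝓜.D.State) (Q : List (Fin n)) (h K : ℕ)
    (s : St n 𝓜.D.State) : Prop :=
  𝓜.Peeling s₀ Q K (𝓜.A.rest (Q.take h)) s ∧ s.mem .head 0 = h ∧
    ∀ v, v ∉ Q → K ≤ 𝓜.A.rest (Q.take h) v

/-- After the removal of a vertex, its neighbours that have fewer than `K` neighbours left have been
queued. -/
theorem removeProg_spec (hnX : n < 𝓜.X) {h : ℕ} (hs : 𝓜.Settled s₀ Q h K s)
    (hh : h < Q.length) :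
    Run 𝓜 removeProg s (9 * (𝓜.A.nbrs Q[h]).length + 4) (fun s' =>
      ∃ Q', Q <+: Q' ∧ 𝓜.Settled s₀ Q' (h + 1) K s') := by
  obtain ⟨hP, hhead, hK⟩ := hs
  obtain ⟨q, hq⟩ : ∃ q, q = Q[h] := ⟨_, rfl⟩
  rw [← hq]
  have hW := 𝓜.hnW
  have hlen := hP.nodup.length_le_card
  rw [Fintype.card_fin] at hlen
  have htake : Q.take (h + 1) = Q.take h ++ [q] := by rw [hq]; simp
  have hqh : q ∉ Q.take h := by
    have := hP.nodup.sublist (List.take_sublist (h + 1) Q)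
    rw [htake, List.nodup_append] at this
    exact fun hm => this.2.2 q hm q (by simp) rfl
  have hrest := 𝓜.A.rest_append_singleton hqh
  rw [← htake] at hrest
  have hpre : ∀ {Q'}, Q <+: Q' → Q'.take h = Q.take h ∧ Q'.take (h + 1) = Q.take (h + 1) := by
    rintro _ ⟨t, rfl⟩
    exact ⟨List.take_append_of_le_length hh.le, List.take_append_of_le_length hh⟩
  -- The stored numbers of remaining neighbours, when the neighbours `l` of `q` have been processed.
  let g : List (Fin n) → Fin n → ℕ := fun l v =>
    𝓜.A.rest (Q.take h) v - if v ∈ l then 1 else 0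
  refine Run.seq (t₁ := 1) (t₂ := 9 * (𝓜.A.nbrs q).length + 3)
    (R := fun s' => s' = s.upd .v1 0 q) (Run.asg (t := 0) ?_ ?_ rfl) ?_
  · exact ⟨trivial, by simp only [Ex.eval, hhead]; omega⟩
  · simp [Ex.eval, hhead, hP.ordAt h hh, hq]
  rintro _ rfl
  refine Run.seq (t₁ := 9 * (𝓜.A.nbrs q).length + 2) (t₂ := 1)
    (R := fun s' => s'.mem .head 0 = h ∧ ∃ Q', Q <+: Q' ∧ 𝓜.Peeling s₀ Q' K (g (𝓜.A.nbrs q)) s' ∧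
      ∀ v, v ∉ Q' → K ≤ g (𝓜.A.nbrs q) v) ?_ ?_
  · refine Run.forNbrs q 6 (fun l s' => s'.mem .v1 0 = q ∧ s'.mem .head 0 = h ∧
      ∃ Q', Q <+: Q' ∧ 𝓜.Peeling s₀ Q' K (g l) s' ∧ ∀ v, v ∉ Q' → K ≤ g l v) ?_ ?_ ?_ ?_ ?_ ?_ ?_
    · refine ⟨by simp [St.upd_mem], by simpa [St.upd_mem] using hhead, Q, List.prefix_rfl, ?_, ?_⟩
      · have : g [] = 𝓜.A.rest (Q.take h) := by funext v; simp [g]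
        rw [this]
        exact hP.upd (by decide) _ _
      · simpa [g] using hK
    · rintro l s' z ⟨h₁, h₂, Q', h₃, h₄, h₅⟩
      exact ⟨by simpa [St.upd_mem] using h₁, by simpa [St.upd_mem] using h₂, Q', h₃,
        h₄.upd (by decide) _ _, h₅⟩
    · rintro l s' z ⟨h₁, h₂, Q', h₃, h₄, h₅⟩
      exact ⟨by simpa [St.upd_mem] using h₁, by simpa [St.upd_mem] using h₂, Q', h₃,
        h₄.upd (by decide) _ _, h₅⟩
    · rintro l s' ⟨h₁, -⟩
      exact h₁
    · rintro l x s' hl ⟨h₁, h₂, Q', h₃, h₄, h₅⟩ hx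
      have hxX : (x : ℕ) < 𝓜.X := x.2.trans hnX
      have hxl : x ∉ l := by
        have := (𝓜.A.nodup q).sublist hl.sublist
        rw [List.nodup_append] at this
        exact fun hm => this.2.2 x hm x (by simp) rfl
      have hgx : ∀ v, v ≠ x → g (l ++ [x]) v = g l v := by
        intro v hv
        simp [g, hv]
      have hgxx : g (l ++ [x]) x = g l x - 1 := by simp [g, hxl]
      have hle : ∀ v, v ∉ Q' → 𝓜.A.rest Q' v ≤ g (l ++ [x]) v := by
        intro v _
        refine (𝓜.A.rest_anti (P := Q.take (h + 1)) ?_ v).trans ?_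
        · exact fun w hw => h₃.subset (List.take_subset _ _ hw)
        · rw [hrest v]
          refine Nat.sub_le_sub_left ?_ _
          by_cases hv : v ∈ l ++ [x]
          · rw [if_pos hv, if_pos (hl.subset hv)]
          · rw [if_neg hv]; omega
      refine Run.branch (t := 5) ⟨trivial, by simpa [Ex.eval, hx] using hxX⟩ ?_ ?_
      · intro hne
        have hxQ : x ∈ Q' := by
          by_contra hcon
          exact hne (by simp [Ex.eval, hx, h₄.marked, hcon])
        have hne' : ∀ v, v ∉ Q' → v ≠ x := by rintro v hv rfl; exact hv hxQ
        refine Run.skip ⟨rfl, h₁, h₂, Q', h₃, ?_, ?_⟩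
        · exact { h₄ with
            dg := fun v hv => by rw [hgx v (hne' v hv)]; exact h₄.dg v hv
            rest_le := hle }
        · intro v hv
          rw [hgx v (hne' v hv)]
          exact h₅ v hv
      · intro h0
        have hxQ : x ∉ Q' := by
          intro hcon
          simp [Ex.eval, hx, h₄.marked, hcon] at h0
        refine Run.seq (t₁ := 1) (t₂ := 4)
          (R := fun s'' => s'' = s'.upd .dg x (g l x - 1))
          (Run.sto (t := 0) trivial hx hxX ⟨⟨trivial, by simpa [Ex.eval, hx] using hxX⟩,
            by simp [Ex.Ok], trivial⟩ (by simp [Ex.eval, BinOp.apply, hx, h₄.dg x hxQ]) rfl) ?_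
        rintro _ rfl
        have h₆ : 𝓜.Peeling s₀ Q' K (g (l ++ [x])) (s'.upd .dg x (g l x - 1)) := by
          refine ⟨h₄.frame.upd (by decide) _ _, h₄.dom, h₄.nodup,
            by simpa [St.upd_mem] using h₄.dgn, by simpa [St.upd_mem] using h₄.tail, ?_, ?_, ?_,
            hle, h₄.few⟩
          · intro i hi; simpa [St.upd_mem] using h₄.ordAt i hi
          · intro v; simpa [St.upd_mem] using h₄.marked v
          · intro v hv
            by_cases hvx : v = x
            · simp [St.upd_mem, hvx, hgxx]
            · have : (v : ℕ) ≠ x := fun h => hvx (Fin.ext h)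
              simp [St.upd_mem, this, hgx v hvx, h₄.dg v hv]
        refine Run.branch (t := 3) ⟨⟨trivial, ?_⟩, trivial, trivial⟩ ?_ ?_
        · simpa [Ex.eval, St.upd_mem, hx] using hxX
        · intro hlt
          have hlt : g (l ++ [x]) x < K := by
            by_contra hcon
            refine hlt ?_
            simp only [Ex.eval, BinOp.apply, h₆.dgn]
            refine if_neg ?_
            simpa [St.upd_mem, hx, ← hgxx] using hcon
          refine (pushProg_spec hnX h₆ (y := .x1) (by decide) (by simpa [St.upd_mem] using hx) hxQ
            hlt).imp ?_
          rintro s'' ⟨k₁, k₂⟩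
          refine ⟨by rw [k₁ .i2 (by decide)]; simp [St.upd_mem],
            by rw [k₁ .v1 (by decide)]; simpa [St.upd_mem] using h₁,
            by rw [k₁ .head (by decide)]; simpa [St.upd_mem] using h₂,
            Q' ++ [x], h₃.trans (List.prefix_append _ _), k₂, ?_⟩
          intro v hv
          simp only [List.mem_append, List.mem_singleton, not_or] at hv
          rw [hgx v hv.2]
          exact h₅ v hv.1
        · intro hge
          have hge : K ≤ g (l ++ [x]) x := by
            by_contra hcon
            simp only [Ex.eval, BinOp.apply, h₆.dgn] at hge
            rw [if_pos] at hge
            · omega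
            · simpa [St.upd_mem, hx, ← hgxx] using hcon
          refine Run.skip ⟨by simp [St.upd_mem], by simpa [St.upd_mem] using h₁,
            by simpa [St.upd_mem] using h₂, Q', h₃, h₆, ?_⟩
          intro v hv
          by_cases hvx : v = x
          · rw [hvx]; exact hge
          · rw [hgx v hvx]; exact h₅ v hv
    · rintro s' ⟨-, h₂⟩
      exact h₂
    · omega
  · rintro s' ⟨h₂, Q', h₃, h₄, h₅⟩
    have hgr : g (𝓜.A.nbrs q) = 𝓜.A.rest (Q'.take (h + 1)) := by
      funext v
      rw [(hpre h₃).2, hrest v]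
    rw [hgr] at h₄ h₅
    refine Run.asg (t := 0) (z := h + 1) ⟨trivial, by simp [Ex.Ok], ?_⟩
      (by simp [Ex.eval, BinOp.apply, h₂])
      ⟨Q', h₃, h₄.upd (by decide) _ _, by simp [St.upd_mem], h₅⟩
    simp only [BinOp.Fits, Ex.eval, h₂]; omega

/-- When all queued vertices have been removed, the numbers of remaining neighbours are compared
with the next value of `dgn`.  -/
theorem raiseProg_spec (hnX : n < 𝓜.X) (hKW : K + 1 < 𝓜.W) (hs : 𝓜.Settled s₀ Q Q.length K s) :
    Run 𝓜 raiseProg s (7 * n + 3) (fun s' =>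
      ∃ Q', Q <+: Q' ∧ 𝓜.Settled s₀ Q' Q.length (K + 1) s') := by
  obtain ⟨hP, hhead, hK⟩ := hs
  rw [List.take_length] at hP
  have hW := 𝓜.hnW
  refine Run.seq (t₁ := 1) (t₂ := 7 * n + 2) (R := fun s' => s' = s.upd .dgn 0 (K + 1))
    (Run.asg (t := 0) ⟨trivial, by simp [Ex.Ok], ?_⟩ ?_ rfl) ?_
  · simp only [BinOp.Fits, Ex.eval, hP.dgn]; omega
  · simp [Ex.eval, BinOp.apply, hP.dgn]
  rintro _ rfl
  have hP' : 𝓜.Peeling s₀ Q (K + 1) (𝓜.A.rest Q) (s.upd .dgn 0 (K + 1)) := by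
    refine ⟨hP.frame.upd (by decide) _ _, hP.dom, hP.nodup, by simp [St.upd_mem],
      by simpa [St.upd_mem] using hP.tail, ?_, ?_, ?_, hP.rest_le,
      fun i hi => (hP.few i hi).trans (by omega)⟩
    · intro i hi; simpa [St.upd_mem] using hP.ordAt i hi
    · intro v; simpa [St.upd_mem] using hP.marked v
    · intro v hv; simpa [St.upd_mem] using hP.dg v hv
  refine Run.forLoop n (fun _ => 5) (fun r s' => s'.mem .head 0 = Q.length ∧ ∃ Q', Q <+: Q' ∧
    𝓜.Peeling s₀ Q' (K + 1) (𝓜.A.rest Q) s' ∧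
    ∀ v : Fin n, (v : ℕ) < r → v ∉ Q' → K + 1 ≤ 𝓜.A.rest Q v) hW ?_ ?_ ?_ ?_ ?_
  · exact ⟨by simpa [St.upd_mem] using hhead, Q, List.prefix_rfl, hP'.upd (by decide) _ _, by simp⟩
  · intros; exact ⟨trivial, rfl⟩
  · rintro r s' hr ⟨h₂, Q', h₃, h₄, h₅⟩ hir
    have hrX : r < 𝓜.X := by omega
    obtain ⟨x, hx⟩ : ∃ x : Fin n, x = ⟨r, hr⟩ := ⟨_, rfl⟩
    have hxr : (x : ℕ) = r := by rw [hx]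
    have hmk := h₄.marked x
    rw [hxr] at hmk
    have hcase : ∀ v : Fin n, (v : ℕ) < r + 1 → (v : ℕ) < r ∨ v = x := by
      intro v hv
      rcases Nat.lt_succ_iff_lt_or_eq.1 hv with h | h
      · exact .inl h
      · exact .inr (Fin.ext (h.trans hxr.symm))
    refine Run.branch (t := 4) ⟨trivial, by simpa [Ex.eval, hir] using hrX⟩ ?_ ?_
    · intro hne
      have hxQ : x ∈ Q' := by
        by_contra hcon
        exact hne (by simp [Ex.eval, hir, hmk, hcon])
      refine Run.skip ⟨hir, by simpa [St.upd_mem] using h₂, Q', h₃, h₄.upd (by decide) _ _, ?_⟩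
      intro v hv hvQ
      rcases hcase v hv with h | rfl
      · exact h₅ v h hvQ
      · exact absurd hxQ hvQ
    · intro h0
      have hxQ : x ∉ Q' := by
        intro hcon
        simp [Ex.eval, hir, hmk, hcon] at h0
      have hdg := h₄.dg x hxQ
      rw [hxr] at hdg
      refine Run.branch (t := 3) ⟨⟨trivial, by simpa [Ex.eval, hir] using hrX⟩, trivial, trivial⟩
        ?_ ?_
      · intro hlt
        have hlt : 𝓜.A.rest Q x < K + 1 := by
          by_contra hcon
          exact hlt (by simp only [Ex.eval, BinOp.apply, h₄.dgn, hir, hdg]; exact if_neg hcon)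
        refine (pushProg_spec hnX h₄ (y := .i1) (by decide) (hir.trans hxr.symm) hxQ hlt).imp ?_
        rintro s'' ⟨k₁, k₂⟩
        refine ⟨by rw [k₁ .i1 (by decide)]; exact hir, ?_, Q' ++ [x],
          h₃.trans (List.prefix_append _ _), k₂.upd (by decide) _ _, ?_⟩
        · simp only [St.upd_mem]
          simpa [k₁ .head (by decide)] using h₂
        · intro v hv hvQ
          simp only [List.mem_append, List.mem_singleton, not_or] at hvQ
          rcases hcase v hv with h | h
          · exact h₅ v h hvQ.1
          · exact absurd h hvQ.2
      · intro hge
        have hge : K + 1 ≤ 𝓜.A.rest Q x := by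
          by_contra hcon
          have : 𝓜.A.rest Q x < K + 1 := by omega
          simp only [Ex.eval, BinOp.apply, h₄.dgn, hir, hdg, if_pos this] at hge
          omega
        refine Run.skip ⟨hir, by simpa [St.upd_mem] using h₂, Q', h₃, h₄.upd (by decide) _ _, ?_⟩
        intro v hv hvQ
        rcases hcase v hv with h | rfl
        · exact h₅ v h hvQ
        · exact hge
  · rintro s' ⟨h₂, Q', h₃, h₄, h₅⟩
    have htake : Q'.take Q.length = Q := List.prefix_iff_eq_take.1 h₃ |>.symm
    exact ⟨Q', h₃, by rw [htake]; exact h₄, h₂, fun v hv => by rw [htake]; exact h₅ v v.2 hv⟩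
  · simp; omega

/-- The time that it takes to remove the vertices that have not been removed. -/
def AdjLists.removalTime (A : AdjLists G) (P : List (Fin n)) : ℕ :=
  ∑ v ∈ univ.filter (· ∉ P), (9 * (A.nbrs v).length + 6)

theorem AdjLists.removalTime_append_singleton (A : AdjLists G) {P : List (Fin n)} {q : Fin n}
    (hq : q ∉ P) :
    A.removalTime (P ++ [q]) + (9 * (A.nbrs q).length + 6) = A.removalTime P := by
  have : univ.filter (· ∉ P) = insert q (univ.filter (· ∉ P ++ [q])) := by
    ext v
    by_cases h : v = q
    · simp [h, hq]
    · simp [h]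
  rw [AdjLists.removalTime, AdjLists.removalTime, this, sum_insert (by simp), add_comm]

/-- The value of `dgn` does not exceed `k + 1`: it is only increased when every vertex that is left
has at least `dgn` remaining neighbours, whereas by degeneracy one of them has at most `k`.  -/
theorem peelProg_spec {k : ℕ} (hG : IsDegenerate G k) (hnX : n < 𝓜.X) (hkW : k + 1 < 𝓜.W)
    {s : St n 𝓜.D.State} (hs : ∀ a x, s.mem a x = 0) :
    Run 𝓜 peelProg s (9 * 𝓜.A.degSum + 9 * n + (k + 1) * (7 * n + 5) + 3) (fun s' =>
      Frame peelVars s s' ∧ s'.dom = s.dom ∧ ∃ (ord : VertexOrder n) (K : ℕ), K ≤ k + 1 ∧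
      (∀ v, (𝓜.A.late ord v).length ≤ K) ∧ s'.mem .dgn 0 = K ∧
      ∀ i : Fin n, s'.mem .ord i = ord i) := by
  have hW := 𝓜.hnW
  have hrest0 : ∀ v, 𝓜.A.rest [] v = (𝓜.A.nbrs v).length := fun v => by
    simp [AdjLists.rest]
  refine Run.seq (t₁ := 3 * n + 2) (t₂ := 9 * 𝓜.A.degSum + 6 * n + (k + 1) * (7 * n + 5) + 1)
    (R := fun s' => 𝓜.Settled s [] 0 0 s') ?_ ?_
  · refine Run.forLoop n (fun _ => 1) (fun r s' => (Frame [.i1, .dg] s s' ∧ s'.dom = s.dom) ∧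
      ∀ v : Fin n, (v : ℕ) < r → s'.mem .dg v = (𝓜.A.nbrs v).length) hW ?_ ?_ ?_ ?_ ?_
    · exact ⟨⟨(Frame.refl _ s).upd (by decide) _ _, rfl⟩, by simp⟩
    · intros; exact ⟨trivial, rfl⟩
    · rintro r s' hr ⟨⟨h₁, h₂⟩, h₃⟩ hir
      refine Run.sto (t := 0) trivial hir (by omega) ⟨trivial, by simpa [Ex.eval, hir] using hr⟩ rfl
        ⟨by simp [St.upd_mem, hir],
        ⟨(h₁.upd (by decide) _ _).upd (by decide) _ _, h₂⟩, ?_⟩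
      intro v hv
      by_cases hvr : (v : ℕ) = r
      · simp [St.upd_mem, ← hvr, Ex.eval, hir.trans hvr.symm]
      · simp [St.upd_mem, hvr, h₃ v (by omega)]
    · rintro s' ⟨⟨h₁, h₂⟩, h₃⟩
      have hz : ∀ a, a ∉ [Var.i1, .dg] → ∀ x, s'.mem a x = 0 := fun a ha x => by
        rw [h₁.1 a ha, hs]
      refine ⟨⟨h₁.mono (by decide), h₂, List.nodup_nil, hz _ (by decide) _, hz _ (by decide) _,
        by simp, fun v => by simp [hz .mk (by decide)], fun v _ => ?_, by simp, by simp⟩,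
        hz _ (by decide) _, by simp⟩
      rw [h₃ v v.2, List.take_nil, hrest0]
    · simp; omega
  rintro s₁ hs₁
  -- The potential of the loop: each increase of `dgn` takes `7 * n + 5` units of time, and the
  -- removals take time proportional to the degrees.
  refine Run.whileLoop (fun r s' => ∃ Q h K, 𝓜.Settled s Q h K s' ∧ h ≤ Q.length ∧ K ≤ k + 1 ∧
    r = (k + 1 - K) * (7 * n + 5) + 𝓜.A.removalTime (Q.take h)) ?_ ?_ ?_
    (r := 9 * 𝓜.A.degSum + 6 * n + (k + 1) * (7 * n + 5)) ?_ le_rfl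
  · intros; exact ⟨trivial, trivial, trivial⟩
  · rintro _ s₂ ⟨Q, h, K, hs₂, hQ, hK, rfl⟩ hlt
    have hlt : h < n := by
      by_contra hcon
      exact hlt (by simp [Ex.eval, BinOp.apply, hs₂.2.1, hcon])
    have hcond : (Ex.op .lt (.var .head) (.var .tail)).eval 𝓜.A s₂.mem =
        if h < Q.length then 1 else 0 := by
      simp only [Ex.eval, BinOp.apply, hs₂.2.1, hs₂.1.tail]
    by_cases hhQ : h < Q.length
    · refine ⟨9 * (𝓜.A.nbrs Q[h]).length + 4 + 1, Run.branch ⟨trivial, trivial, trivial⟩ ?_ ?_⟩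
      · intro _
        refine (removeProg_spec hnX hs₂ hhQ).imp ?_
        rintro s₃ ⟨Q', hQ', hs₃⟩
        have htake : Q'.take (h + 1) = Q.take h ++ [Q[h]] := by
          obtain ⟨t, rfl⟩ := hQ'
          rw [List.take_append_of_le_length hhQ]
          simp
        have hqh : Q[h] ∉ Q.take h := by
          have := hs₃.1.nodup.sublist (List.take_sublist (h + 1) Q')
          rw [htake, List.nodup_append] at this
          exact fun hm => this.2.2 _ hm _ (by simp) rfl
        have := 𝓜.A.removalTime_append_singleton hqh
        refine ⟨_, ⟨Q', h + 1, K, hs₃, ?_, hK, rfl⟩, ?_⟩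
        · have := hQ'.length_le
          omega
        · rw [htake]
          omega
      · intro h0
        rw [hcond, if_pos hhQ] at h0
        omega
    · have hh : h = Q.length := by omega
      subst hh
      have hKk : K ≤ k := by
        obtain ⟨v, hv, hvk⟩ := 𝓜.A.exists_rest_le hG (P := Q) (by
          by_contra! hcon
          have := Fintype.card_le_of_surjective (fun i : Fin Q.length => Q.get i) (fun v => by
            obtain ⟨i, hi⟩ := List.get_of_mem (hcon v)
            exact ⟨i, hi⟩)
          simp at this
          omega)
        have := hs₂.2.2 v hv
        rw [List.take_length] at this
        omega
      refine ⟨7 * n + 3 + 1, Run.branch ⟨trivial, trivial, trivial⟩ ?_ ?_⟩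
      · intro h0
        exact absurd (hcond.trans (if_neg hhQ)) h0
      · intro _
        refine (raiseProg_spec hnX (by omega) hs₂).imp ?_
        rintro s₃ ⟨Q', hQ', hs₃⟩
        have htake : Q'.take Q.length = Q.take Q.length := by
          rw [List.take_length]
          exact (List.prefix_iff_eq_take.1 hQ').symm
        refine ⟨_, ⟨Q', Q.length, K + 1, hs₃, hQ'.length_le, by omega, rfl⟩, ?_⟩
        rw [htake]
        have : k + 1 - K = (k + 1 - (K + 1)) + 1 := by omega
        rw [this, add_mul, one_mul]
        omega
  · rintro _ s₂ ⟨Q, h, K, hs₂, hQ, hK, rfl⟩ hge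
    have hge : n ≤ h := by
      by_contra hcon
      have hcon : h < n := by omega
      simp [Ex.eval, BinOp.apply, hs₂.2.1, hcon] at hge
    have hlen := hs₂.1.nodup.length_le_card
    rw [Fintype.card_fin] at hlen
    have hQn : Q.length = n := by omega
    have hinj : Function.Injective (fun i : Fin n => Q.get (i.cast hQn.symm)) := by
      intro i j hij
      have := (List.nodup_iff_injective_get.1 hs₂.1.nodup) hij
      exact Fin.ext (by simpa using congrArg Fin.val this)
    let ord : VertexOrder n := Equiv.ofBijective _ (Finite.injective_iff_bijective.1 hinj)
    have hord : ∀ i : Fin n, ord i = Q[(i : ℕ)] := fun i => rfl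
    refine ⟨hs₂.1.frame, hs₂.1.dom, ord, K, hK, ?_, hs₂.1.dgn, ?_⟩
    · intro v
      obtain ⟨i, rfl⟩ := ord.surjective v
      have hfew := hs₂.1.few i (by omega)
      rw [← hord] at hfew
      refine le_trans ?_ hfew.le
      rw [AdjLists.late, AdjLists.rest, ← List.countP_eq_length_filter]
      refine List.countP_mono_left fun w _ hw => ?_
      simp only [decide_eq_true_eq] at hw ⊢
      intro hmem
      obtain ⟨j, hj, hjw⟩ := List.getElem_of_mem hmem
      rw [List.length_take] at hj
      have hjn : j < n := by omega
      rw [List.getElem_take] at hjw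
      have : w = ord ⟨j, hjn⟩ := by rw [hord]; exact hjw.symm
      rw [this] at hw
      simp only [Equiv.symm_apply_apply, Fin.lt_def] at hw
      omega
    · intro i
      rw [hs₂.1.ordAt i (by omega), hord]
  · refine ⟨[], 0, 0, hs₁, le_rfl, by omega, ?_⟩
    simp only [AdjLists.removalTime, List.take_nil, List.not_mem_nil, not_false_eq_true,
      filter_true, AdjLists.degSum, sum_add_distrib, ← mul_sum, sum_const, card_univ,
      Fintype.card_fin, smul_eq_mul]
    rw [Nat.sub_zero]
    ring

end


/-! ### Computing the tables -/

/-- Compute the positions of the vertices, the lists of their later neighbours, and the number of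
candidates, from the ordering. -/
def tableProg : Prog :=
  forLoop .i1 .size (sto .pos (.arr .ord (.var .i1)) (.var .i1)) ;;
  forLoop .i1 .size (
    asg .cnt (.lit 0) ;;
    forNbrs .i1 (
      branch (.op .lt (.arr .pos (.var .i1)) (.arr .pos (.var .x1)))
        (sto .late (.op .add (.op .mul (.var .i1) (.var .dgn)) (.var .cnt)) (.var .x1) ;;
          asg .cnt (.op .add (.var .cnt) (.lit 1))) .skip) ;;
    sto .len (.var .i1) (.var .cnt)) ;;
  asg .pow (.lit 1) ;;
  forLoop .i1 (.var .dgn) (asg .pow (.op .add (.var .pow) (.var .pow))) ;;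
  asg .lim (.op .mul .size (.var .pow))

/-- The variables that the computation of the tables changes. -/
def tableVars : List Var := [.pos, .late, .len, .cnt, .pow, .lim, .i1, .i2, .x1]

section

variable {n : ℕ} {G : SimpleGraph (Fin n)} {𝓜 : Machine G} {ord : VertexOrder n} {K : ℕ}

theorem AdjLists.sum_degree (A : AdjLists G) : ∑ r ∈ range n, A.degree r = A.degSum := by
  rw [Finset.sum_range]
  simp [AdjLists.degSum]

/-- The lists `L v` of the vertices `v < r` have been stored. -/
def StoredBelow {σ : Type} (K : ℕ) (L : Fin n → List (Fin n)) (r : ℕ) (s : St n σ) : Prop :=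
  ∀ v : Fin n, (v : ℕ) < r → s.mem .len v = (L v).length ∧
    ∀ (i : ℕ) (h : i < (L v).length), s.mem .late (v * K + i) = (L v)[i]

/-- The list of later neighbours of the vertex `v` occupies the entries of `late` from `v * K` on.
-/
theorem tableProg_spec (hp : 𝓜.Params ord K) {s : St n 𝓜.D.State} (hdgn : s.mem .dgn 0 = K)
    (hord : ∀ i : Fin n, s.mem .ord i = ord i) :
    Run 𝓜 tableProg s (6 * 𝓜.A.degSum + 9 * n + 3 * K + 8) (fun s' =>
      Frame tableVars s s' ∧ s'.dom = s.dom ∧ 𝓜.Env ord K s') := by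
  have hnX := hp.n_lt
  have hW := 𝓜.hnW
  have hKW := hp.K_lt_W
  have hpowW := hp.pow_lt
  have hlimW := hp.lim_lt
  have hlen := hp.length_le
  let L : Fin n → List (Fin n) := fun v => 𝓜.A.late ord v
  have keep : ∀ {s' : St n 𝓜.D.State}, Frame tableVars s s' → s'.mem .dgn 0 = K ∧
      ∀ i : Fin n, s'.mem .ord i = ord i := fun h =>
    ⟨by rw [h.1 _ (by decide), hdgn], fun i => by rw [h.1 _ (by decide), hord]⟩
  refine Run.seq (t₁ := 3 * n + 2) (t₂ := 6 * 𝓜.A.degSum + 6 * n + 3 * K + 6)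
    (R := fun s' => (Frame tableVars s s' ∧ s'.dom = s.dom) ∧
      ∀ v : Fin n, s'.mem .pos v = ord.symm v) ?_ ?_
  · refine Run.forLoop n (fun _ => 1) (fun r s' => (Frame tableVars s s' ∧ s'.dom = s.dom) ∧
      ∀ v : Fin n, (ord.symm v : ℕ) < r → s'.mem .pos v = ord.symm v) hW ?_ ?_ ?_ ?_ ?_
    · exact ⟨⟨(Frame.refl _ s).upd (by decide) _ _, rfl⟩, by simp⟩
    · intros; exact ⟨trivial, rfl⟩
    · rintro r s' hr ⟨⟨h₁, h₂⟩, h₃⟩ hir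
      obtain ⟨v, hv⟩ : ∃ v, v = ord ⟨r, hr⟩ := ⟨_, rfl⟩
      have hov : s'.mem .ord r = v := by rw [hv]; exact (keep h₁).2 ⟨r, hr⟩
      refine Run.sto (t := 0) (y := v) (z := r)
        ⟨trivial, by simp only [Ex.eval, hir]; omega⟩ (by simp [Ex.eval, hir, hov])
        (by omega) trivial hir ⟨by simp [St.upd_mem, hir],
        ⟨(h₁.upd (by decide) _ _).upd (by decide) _ _, h₂⟩, ?_⟩
      intro w hw
      by_cases hwv : w = v
      · simp [St.upd_mem, hwv, hv]
      · have hne : (w : ℕ) ≠ v := fun h => hwv (Fin.ext h)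
        have : (ord.symm w : ℕ) ≠ r := fun h => hwv (by
          rw [hv, ← Equiv.symm_apply_eq]; exact Fin.ext h)
        simp [St.upd_mem, hne, h₃ w (by omega)]
    · rintro s' ⟨h₁, h₂⟩
      exact ⟨h₁, fun v => h₂ v (ord.symm v).2⟩
    · simp; omega
  rintro s₁ ⟨⟨F₁, hd₁⟩, hpos₁⟩
  refine Run.seq (t₁ := 6 * 𝓜.A.degSum + 6 * n + 2) (t₂ := 3 * K + 4)
    (R := fun s' => (Frame tableVars s s' ∧ s'.dom = s.dom) ∧
      (∀ v : Fin n, s'.mem .pos v = ord.symm v) ∧ StoredBelow K L n s') ?_ ?_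
  · refine Run.forLoop n (fun r => 6 * 𝓜.A.degree r + 4) (fun r s' =>
      (Frame tableVars s s' ∧ s'.dom = s.dom) ∧
      (∀ v : Fin n, s'.mem .pos v = ord.symm v) ∧ StoredBelow K L r s') hW ?_ ?_ ?_ ?_ ?_
    · refine ⟨⟨F₁.upd (by decide) _ _, hd₁⟩, fun v => ?_, fun v hv => absurd hv (by omega)⟩
      simpa [St.upd_mem] using hpos₁ v
    · intros; exact ⟨trivial, rfl⟩
    · rintro r s₂ hr ⟨⟨F₂, hd₂⟩, hpos₂, hst₂⟩ hir
      obtain ⟨v, hv⟩ : ∃ v : Fin n, (v : ℕ) = r := ⟨⟨r, hr⟩, rfl⟩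
      subst hv
      rw [𝓜.A.degree_coe]
      let p : Fin n → Bool := fun w => ord.symm v < ord.symm w
      have hL : L v = (𝓜.A.nbrs v).filter p := rfl
      refine Run.seq (t₁ := 1) (t₂ := 6 * (𝓜.A.nbrs v).length + 3)
        (R := fun s' => s' = s₂.upd .cnt 0 0) (Run.asg (t := 0) (by simp [Ex.Ok]) rfl rfl) ?_
      rintro _ rfl
      refine Run.seq (t₁ := 6 * (𝓜.A.nbrs v).length + 2) (t₂ := 1)
        (R := fun s' => s'.mem .i1 0 = v ∧ (Frame tableVars s s' ∧ s'.dom = s.dom) ∧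
          (∀ v : Fin n, s'.mem .pos v = ord.symm v) ∧ StoredBelow K L v s' ∧
          s'.mem .cnt 0 = (L v).length ∧
          ∀ (i : ℕ) (h : i < (L v).length), s'.mem .late (v * K + i) = (L v)[i]) ?_ ?_
      · refine Run.forNbrs v 3 (fun l s' => s'.mem .i1 0 = v ∧
          (Frame tableVars s s' ∧ s'.dom = s.dom) ∧
          (∀ v : Fin n, s'.mem .pos v = ord.symm v) ∧ StoredBelow K L v s' ∧
          s'.mem .cnt 0 = (l.filter p).length ∧
          ∀ (i : ℕ) (h : i < (l.filter p).length), s'.mem .late (v * K + i) = (l.filter p)[i])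
          ?_ ?_ ?_ ?_ ?_ ?_ ?_
        · refine ⟨by simpa [St.upd_mem] using hir, ⟨F₂.upd (by decide) _ _, hd₂⟩, ?_, ?_, ?_, ?_⟩
          · intro w; simpa [St.upd_mem] using hpos₂ w
          · intro w hw; simpa [St.upd_mem] using hst₂ w hw
          · simp [St.upd_mem]
          · simp
        · rintro l s' z ⟨a₁, ⟨a₂, a₃⟩, a₄, a₅, a₆, a₇⟩
          refine ⟨by simpa [St.upd_mem] using a₁, ⟨a₂.upd (by decide) _ _, a₃⟩, ?_, ?_, ?_, ?_⟩
          · intro w; simpa [St.upd_mem] using a₄ w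
          · intro w hw; simpa [St.upd_mem] using a₅ w hw
          · simpa [St.upd_mem] using a₆
          · intro i hi; simpa [St.upd_mem] using a₇ i hi
        · rintro l s' z ⟨a₁, ⟨a₂, a₃⟩, a₄, a₅, a₆, a₇⟩
          refine ⟨by simpa [St.upd_mem] using a₁, ⟨a₂.upd (by decide) _ _, a₃⟩, ?_, ?_, ?_, ?_⟩
          · intro w; simpa [St.upd_mem] using a₄ w
          · intro w hw; simpa [St.upd_mem] using a₅ w hw
          · simpa [St.upd_mem] using a₆
          · intro i hi; simpa [St.upd_mem] using a₇ i hi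
        · rintro l s' ⟨a₁, -⟩
          exact a₁
        · rintro l x s' hl ⟨a₁, ⟨a₂, a₃⟩, a₄, a₅, a₆, a₇⟩ hx
          have hcond : (Ex.op .lt (.arr .pos (.var .i1)) (.arr .pos (.var .x1))).eval 𝓜.A s'.mem =
              if ord.symm v < ord.symm x then 1 else 0 := by
            simp only [Ex.eval, BinOp.apply, a₁, hx, a₄, Fin.lt_def]
          refine Run.branch (t := 2) ⟨⟨trivial, ?_⟩, ⟨trivial, ?_⟩, trivial⟩ ?_ ?_
          · simp only [Ex.eval, a₁]; omega
          · simp only [Ex.eval, hx]; omega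
          · intro hne
            have hlt : ord.symm v < ord.symm x := by
              by_contra hcon
              exact hne (hcond.trans (if_neg hcon))
            have happ : (l ++ [x]).filter p = l.filter p ++ [x] := by
              rw [List.filter_append]; simp [p, hlt]
            have hsub : (l.filter p).length < (L v).length := by
              have := (hl.sublist.filter p).length_le
              rw [happ, List.length_append, List.length_singleton] at this
              rw [hL]; omega
            have hLn : (L v).length ≤ n := (List.length_filter_le _ _).trans (𝓜.A.length_le v)
            obtain ⟨hidx, hidxW⟩ := hp.index_lt v hsub
            have hmul : (v : ℕ) * K ≤ v * K + (l.filter p).length := Nat.le_add_right _ _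
            refine Run.seq (t₁ := 1) (t₂ := 1)
              (R := fun s'' => s'' = s'.upd .late (v * K + (l.filter p).length) x)
              (Run.sto (t := 0) ⟨⟨trivial, trivial, ?_⟩, trivial, ?_⟩ ?_ hidx trivial hx rfl) ?_
            · simp only [BinOp.Fits, Ex.eval, a₁, (keep a₂).1]; omega
            · simp only [BinOp.Fits, Ex.eval, BinOp.apply, a₁, (keep a₂).1, a₆]; omega
            · simp only [Ex.eval, BinOp.apply, a₁, (keep a₂).1, a₆]
            rintro _ rfl
            refine Run.asg (t := 0) (z := (l.filter p).length + 1)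
              ⟨trivial, by simp [Ex.Ok], ?_⟩ ?_ ?_
            · simp only [BinOp.Fits, Ex.eval, St.upd_mem]
              simp [a₆]
              omega
            · simp [Ex.eval, BinOp.apply, St.upd_mem, a₆]
            · refine ⟨by simp [St.upd_mem], by simpa [St.upd_mem] using a₁,
                ⟨(a₂.upd (by decide) _ _).upd (by decide) _ _, a₃⟩, ?_, ?_, ?_, ?_⟩
              · intro w; simpa [St.upd_mem] using a₄ w
              · intro w hw
                refine ⟨by simpa [St.upd_mem] using (a₅ w hw).1, fun i hi => ?_⟩
                have hiK : i < K := hi.trans_le (hlen w)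
                have h₁ : ((w : ℕ) + 1) * K ≤ v * K := Nat.mul_le_mul_right _ hw
                rw [add_mul, one_mul] at h₁
                have hne : (w : ℕ) * K + i ≠ v * K + (l.filter p).length := by omega
                simpa [St.upd_mem, hne] using (a₅ w hw).2 i hi
              · simp [St.upd_mem, happ]
              · intro i hi
                simp only [happ] at hi ⊢
                by_cases hil : i < (l.filter p).length
                · have : i ≠ (l.filter p).length := hil.ne
                  rw [List.getElem_append_left hil]
                  simpa [St.upd_mem, this] using a₇ i hil
                · have : i = (l.filter p).length := by simp at hi; omega
                  subst this
                  simp [St.upd_mem]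
          · intro h0
            have hge : ¬ ord.symm v < ord.symm x := by
              intro hcon
              rw [hcond, if_pos hcon] at h0
              omega
            have happ : (l ++ [x]).filter p = l.filter p := by
              rw [List.filter_append]; simp [p, hge]
            refine Run.skip ⟨rfl, a₁, ⟨a₂, a₃⟩, a₄, a₅, ?_⟩
            rw [happ]
            exact ⟨a₆, a₇⟩
        · exact fun _ h => h
        · omega
      · rintro s' ⟨a₁, ⟨a₂, a₃⟩, a₄, a₅, a₆, a₇⟩
        refine Run.sto (t := 0) trivial a₁ (by omega) trivial a₆ ⟨by simpa [St.upd_mem] using a₁,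
          ⟨(a₂.upd (by decide) _ _).upd (by decide) _ _, a₃⟩, ?_, ?_⟩
        · intro w; simpa [St.upd_mem] using a₄ w
        · intro w hw
          rcases Nat.lt_succ_iff_lt_or_eq.1 hw with h | h
          · have hne : (w : ℕ) ≠ v := h.ne
            simpa [St.upd_mem, hne] using a₅ w h
          · have := Fin.ext h
            subst this
            simpa [St.upd_mem] using a₇
    · exact fun _ h => h
    · have := 𝓜.A.sum_degree
      simp only [add_assoc, Finset.sum_add_distrib, ← Finset.mul_sum, this, sum_const, card_range,
        smul_eq_mul]
      omega
  rintro s₂ ⟨⟨F₂, hd₂⟩, hpos₂, hst₂⟩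
  refine Run.seq (t₁ := 1) (t₂ := 3 * K + 3) (R := fun s' => s' = s₂.upd .pow 0 1)
    (Run.asg (t := 0) (by simp [Ex.Ok]) rfl rfl) ?_
  rintro _ rfl
  refine Run.seq (t₁ := 3 * K + 2) (t₂ := 1)
    (R := fun s' => ((Frame tableVars s s' ∧ s'.dom = s.dom) ∧
      (∀ v : Fin n, s'.mem .pos v = ord.symm v) ∧ StoredBelow K L n s') ∧
      s'.mem .pow 0 = 2 ^ K) ?_ ?_
  · refine Run.forLoop K (fun _ => 1) (fun r s' => ((Frame tableVars s s' ∧ s'.dom = s.dom) ∧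
      (∀ v : Fin n, s'.mem .pos v = ord.symm v) ∧ StoredBelow K L n s') ∧
      s'.mem .pow 0 = 2 ^ r) hKW ?_ ?_ ?_ ?_ ?_
    · refine ⟨⟨⟨(F₂.upd (by decide) _ _).upd (by decide) _ _, hd₂⟩, fun v => ?_, fun v hv => ?_⟩,
        by simp [St.upd_mem]⟩
      · simpa [St.upd_mem] using hpos₂ v
      · simpa [St.upd_mem] using hst₂ v hv
    · rintro r s' - ⟨⟨⟨a₁, -⟩, -⟩, -⟩
      exact ⟨trivial, (keep a₁).1⟩
    · rintro r s' hr ⟨⟨⟨a₁, a₂⟩, a₃, a₄⟩, a₅⟩ hir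
      have h2 : 2 ^ r ≤ 2 ^ K := Nat.pow_le_pow_right (by norm_num) hr.le
      refine Run.asg (t := 0) (z := 2 ^ (r + 1)) ⟨trivial, trivial, ?_⟩ ?_ ?_
      · simp only [BinOp.Fits, Ex.eval, a₅]; omega
      · simp only [Ex.eval, BinOp.apply, a₅, pow_succ]; ring
      · refine ⟨by simpa [St.upd_mem] using hir,
          ⟨⟨(a₁.upd (by decide) _ _).upd (by decide) _ _, a₂⟩, fun v => ?_, fun v hv => ?_⟩,
          by simp [St.upd_mem]⟩
        · simpa [St.upd_mem] using a₃ v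
        · simpa [St.upd_mem] using a₄ v hv
    · exact fun _ h => h
    · simp; omega
  rintro s₃ ⟨⟨⟨F₃, hd₃⟩, hpos₃, hst₃⟩, hpow₃⟩
  refine Run.asg (t := 0) (z := n * 2 ^ K) ⟨trivial, trivial, ?_⟩
    (by simp [Ex.eval, BinOp.apply, hpow₃]) ⟨F₃.upd (by decide) _ _, hd₃, ?_⟩
  · simpa only [BinOp.Fits, Ex.eval, hpow₃] using hlimW
  · refine ⟨by simpa [St.upd_mem] using (keep F₃).1, by simpa [St.upd_mem] using hpow₃,
      by simp [St.upd_mem], ?_, ?_, ?_, ?_⟩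
    · intro i; simpa [St.upd_mem] using (keep F₃).2 i
    · intro v; simpa [St.upd_mem] using hpos₃ v
    · intro v; simpa [St.upd_mem] using (hst₃ v v.2).1
    · intro v i hi; simpa [St.upd_mem] using (hst₃ v v.2).2 i hi

end


/-! ### The traversal -/

/-- Print the current set, which is new, and start to test its candidates. -/
def visitProg : Prog :=
  analyseProg ;; emitProg ;; .endSet ;; asg .cand (.lit 0)

/-- Test one candidate, and visit the child that it stands for, if any; or move to the parent and
proceed with the next candidate there. -/
def stepProg : Prog :=
  branch (.op .lt (.var .cand) (.var .lim))
    (tryProg ;; branch (.var .ok) visitProg (asg .cand (.op .add (.var .cand) (.lit 1))))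
    (upProg ;; asg .cand (.op .add (.var .cand) (.lit 1)))

/-- The condition that candidates are left, or that the current set has a parent. -/
def unfinished : Ex :=
  .op .add (.op .lt (.var .cand) (.var .lim)) (.op .lt (.var .agr) .size)

/-- Test the candidates of the current set and of the sets that are reached from it, until the
candidates of the root are exhausted. -/
def traverseProg : Prog := whileLoop unfinished stepProg

/-- The program that lists all maximal independent sets. -/
def listProg : Prog := (peelProg ;; tableProg ;; greedyProg) ;; visitProg ;; traverseProg

section

variable {n : ℕ} {G : SimpleGraph (Fin n)} (𝓜 : Machine G) (ord : VertexOrder n) (K : ℕ)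

/-- The unit of time: enough steps for an elementary command. -/
def Machine.unit : ℕ := 64 * 𝓜.τ

/-- The time for testing the candidate with number `j`. -/
noncomputable def Machine.testTime (S : Finset (Fin n)) (j : ℕ) : ℕ :=
  (5 * K + 39) * 𝓜.A.testCost ord K S j + (9 * K + 30)

/-- A bound for the time for testing all candidates. -/
def Machine.searchTime : ℕ :=
  (5 * K + 39) * (2 ^ K * (𝓜.A.degSum + n)) + n * 2 ^ K * (9 * K + 30)

/-- The time for visiting a set. -/
def Machine.visitTime : ℕ := 6 * 𝓜.A.degSum + 15 * n + 7

/-- The time for moving to the parent. -/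
def Machine.upTime : ℕ := 17 * 𝓜.A.degSum + 23 * n + 6 * K + 18

/-- A bound for the time that is spent on each set. -/
def Machine.nodeTime : ℕ := 𝓜.searchTime K + 𝓜.visitTime + 𝓜.upTime K

variable {𝓜 K}

theorem Machine.sum_testTime_le (S : Finset (Fin n)) :
    ∑ j ∈ range (n * 2 ^ K), 𝓜.testTime ord K S j ≤ 𝓜.searchTime K := by
  have h := 𝓜.A.sum_testCost_le (ord := ord) (K := K) S
  rw [sum_add_distrib, sum_const, card_univ, Fintype.card_fin, smul_eq_mul, mul_one] at h
  simp only [Machine.testTime, Machine.searchTime]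
  rw [sum_add_distrib, ← mul_sum, sum_const, card_range, smul_eq_mul]
  exact Nat.add_le_add_right (Nat.mul_le_mul_left _ h) _

theorem Machine.sum_testTime_le_of_le (S : Finset (Fin n)) {j : ℕ} (hj : j ≤ n * 2 ^ K) :
    ∑ i ∈ range j, 𝓜.testTime ord K S i ≤ 𝓜.searchTime K :=
  (sum_le_sum_of_subset (range_subset_range.2 hj)).trans (𝓜.sum_testTime_le ord S)

variable (𝓜 K)

/-- The tables have been computed, the current set is the maximal independent set `S`, and no output
has been begun. -/
structure Machine.Ready (S : Finset (Fin n)) (c : Config n 𝓜.D.State) : Prop where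
  isMIS : IsMIS G S
  words : ∀ y, c.mem y < 𝓜.W
  cur : c.cur = []
  env : 𝓜.Env ord K c.abs
  holds : 𝓜.Holds S c.abs

/-- The traversal is at `S`, and the candidates before the one with number `j` have been tested. -/
structure Machine.At (S : Finset (Fin n)) (j : ℕ) (c : Config n 𝓜.D.State) : Prop
    extends 𝓜.Ready ord K S c where
  analysed : 𝓜.Analysed ord S c.abs
  cand : c.abs.mem .cand 0 = j

/-- The time since the last output is at most `φ`, and the earlier delays are at most `d`. -/
structure Machine.Punctual (d φ : ℕ) (c : Config n 𝓜.D.State) : Prop where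
  isChain : (0 :: c.out.map Prod.snd).IsChain (fun t t' => t' ≤ t + 𝓜.unit * d)
  time_le : c.time ≤ (0 :: c.out.map Prod.snd).getLast (by simp) + 𝓜.unit * φ

/-- A bound for the time since the last output, when the traversal is at `S` and the candidates
before the one with number `j` have been tested: since then it has moved up a path in the tree. -/
noncomputable def Machine.potential (S : Finset (Fin n)) (j : ℕ) : ℕ :=
  1 + agree G ord S * (𝓜.searchTime K + 𝓜.upTime K) + ∑ i ∈ range j, 𝓜.testTime ord K S i

/-- A bound for the delay. -/
def Machine.delay : ℕ := n * (𝓜.searchTime K + 𝓜.upTime K) + 𝓜.nodeTime K + 2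

variable {𝓜 ord K}

theorem Machine.potential_le {S : Finset (Fin n)} {j : ℕ} (hj : j ≤ n * 2 ^ K) :
    𝓜.potential ord K S j ≤ 1 + n * (𝓜.searchTime K + 𝓜.upTime K) + 𝓜.searchTime K := by
  unfold Machine.potential
  have := 𝓜.sum_testTime_le_of_le ord S hj
  have h := Nat.mul_le_mul_right (𝓜.searchTime K + 𝓜.upTime K)
    (agree_le (G := G) (ord := ord) (S := S))
  omega

theorem Machine.Punctual.wait {d φ φ' : ℕ} {c c' : Config n 𝓜.D.State} (h : 𝓜.Punctual d φ c)
    (ho : c'.out = c.out) {t : ℕ} (ht : c'.time ≤ c.time + 𝓜.unit * t) (hφ : φ + t ≤ φ') :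
    𝓜.Punctual d φ' c' := by
  have hmul : 𝓜.unit * (φ + t) ≤ 𝓜.unit * φ' := Nat.mul_le_mul_left _ hφ
  have := h.time_le
  rw [mul_add] at hmul
  refine ⟨by rw [ho]; exact h.isChain, ?_⟩
  simp only [ho]
  omega

theorem Machine.Punctual.output {d φ : ℕ} {c c' : Config n 𝓜.D.State} (h : 𝓜.Punctual d φ c)
    {r : List (Fin n) × ℕ} (ho : c'.out = c.out ++ [r]) {t : ℕ}
    (hr : r.2 ≤ c.time + 𝓜.unit * t) (hφ : φ + t ≤ d) (ht : c'.time ≤ r.2 + 𝓜.unit) :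
    𝓜.Punctual d 1 c' := by
  have hmul : 𝓜.unit * (φ + t) ≤ 𝓜.unit * d := Nat.mul_le_mul_left _ hφ
  have := h.time_le
  rw [mul_add] at hmul
  constructor
  · rw [ho, List.map_append, List.map_singleton, ← List.cons_append, List.isChain_append]
    refine ⟨h.isChain, List.isChain_singleton _, ?_⟩
    intro x hx y hy
    rw [List.getLast?_eq_some_getLast (by simp), Option.mem_some_iff] at hx
    simp only [List.head?_cons, Option.mem_some_iff] at hy
    subst hx hy
    omega
  · have hlast : (0 :: c'.out.map Prod.snd).getLast (by simp) = r.2 := by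
      simp [ho, List.getLast_cons]
    rw [hlast]
    omega

theorem Machine.cost_le {e : Ex} (he : e.compile.cost ≤ 50) : e.compile.cost + 1 ≤ 𝓜.unit := by
  have := 𝓜.one_le_τ
  unfold Machine.unit
  omega

/-- Visiting `S`, which is output as the record `r`. -/
theorem Machine.Ready.visit (hp : 𝓜.Params ord K) {S : Finset (Fin n)}
    {c : Config n 𝓜.D.State} (h : 𝓜.Ready ord K S c) :
    ∃ c' r, Exec 𝓜.A 𝓜.D 𝓜.M 𝓜.W visitProg c c' ∧ 𝓜.At ord K S 0 c' ∧ c'.out = c.out ++ [r] ∧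
      r.1.Nodup ∧ r.1.toFinset = S ∧ r.2 ≤ c.time + 𝓜.unit * (6 * 𝓜.A.degSum + 15 * n + 6) ∧
      c'.time ≤ r.2 + 𝓜.unit := by
  obtain ⟨c₁, x₁, w₁, o₁, t₁, a₁, a₂, a₃⟩ := analyseProg_spec hp h.env h.holds c rfl h.words
  obtain ⟨c₂, x₂, w₂, o₂, t₂, b₁, b₂, b₃⟩ := emitProg_spec hp.n_lt a₁ c₁ rfl w₁
  have hcur : c₂.cur = (List.finRange n).filter (· ∈ S) := by
    have e₁ : c₁.abs.cur = [] := a₃.2.trans h.cur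
    rw [e₁, List.nil_append] at b₃
    exact b₃
  have hE₂ : 𝓜.Env ord K c₂.abs :=
    (h.env.frame a₃ (by decide)).congr fun a ha => b₁.1 a (by revert a; decide)
  have hH₂ : 𝓜.Holds S c₂.abs := a₁.congr (b₁.1 .st (by decide)) b₂
  have hA₂ : 𝓜.Analysed ord S c₂.abs := a₂.congr (b₁.1 .fst (by decide)) (b₁.1 .agr (by decide))
  let c₃ : Config n 𝓜.D.State :=
    { c₂ with cur := [], out := c₂.out ++ [(c₂.cur, c₂.time + 1)], time := c₂.time + 1 }
  have hrun : Run 𝓜 (asg .cand (.lit 0)) c₃.abs 1 (fun s => s = c₃.abs.upd .cand 0 0) :=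
    Run.asg (t := 0) (by simp [Ex.Ok]) rfl rfl
  obtain ⟨c₄, x₄, w₄, o₄, t₄, hs₄⟩ := hrun c₃ rfl w₂
  have hcur₄ : c₄.cur = [] := congrArg St.cur hs₄
  have hU : 1 ≤ 𝓜.unit := by
    have := 𝓜.one_le_τ
    unfold Machine.unit
    omega
  refine ⟨c₄, (c₂.cur, c₂.time + 1),
    .seq _ _ _ _ _ x₁ (.seq _ _ _ _ _ x₂ (.seq _ _ _ _ _ (.endSet c₂) x₄)),
    ⟨⟨h.isMIS, w₄, hcur₄, ?_, ?_⟩, ?_, ?_⟩, ?_, ?_, ?_, ?_, ?_⟩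
  · rw [hs₄]
    exact hE₂.congr fun a ha => St.upd_mem_of_ne _ _ _ _ (by
      have : ∀ a ∈ envVars, a ≠ .cand := by decide
      exact this a ha)
  · rw [hs₄]
    exact hH₂.congr rfl rfl
  · rw [hs₄]
    exact hA₂.congr rfl rfl
  · rw [hs₄]
    simp [St.upd_mem]
  · rw [o₄]
    change c₂.out ++ _ = _
    rw [o₂, o₁]
  · rw [hcur]
    exact (List.nodup_finRange n).filter _
  · ext v
    simp [hcur]
  · change c₂.time + 1 ≤ _
    have : 𝓜.unit * (6 * 𝓜.A.degSum + 15 * n + 6) =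
      𝓜.unit * (6 * 𝓜.A.degSum + 11 * n + 3) + 𝓜.unit * (4 * n + 2) + 𝓜.unit := by ring
    rw [this]
    change c₁.time ≤ c.time + 𝓜.unit * _ at t₁
    change c₂.time ≤ c₁.time + 𝓜.unit * _ at t₂
    omega
  · change c₄.time ≤ c₃.time + 𝓜.unit * 1 at t₄
    change c₄.time ≤ c₃.time + 𝓜.unit
    omega

theorem unfinished_ok {s : St n 𝓜.D.State} : unfinished.Ok 𝓜 s.mem := by
  refine ⟨⟨trivial, trivial, trivial⟩, ⟨trivial, trivial, trivial⟩, ?_⟩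
  have hW := 𝓜.hW
  have key : ∀ a b, BinOp.lt.apply a b ≤ 1 := by
    intro a b
    simp only [BinOp.apply]
    split_ifs <;> omega
  have h₁ := key (s.mem .cand 0) (s.mem .lim 0)
  have h₂ := key (s.mem .agr 0) n
  simp only [BinOp.Fits, Ex.eval]
  omega

theorem Machine.At.unfinished_eval {S : Finset (Fin n)} {j : ℕ} {c : Config n 𝓜.D.State}
    (h : 𝓜.At ord K S j c) : unfinished.eval 𝓜.A c.abs.mem =
      (if j < n * 2 ^ K then 1 else 0) + if agree G ord S < n then 1 else 0 := by
  simp only [unfinished, Ex.eval, BinOp.apply, h.cand, h.env.lim, h.analysed.agr]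

/-- If the traversal can be completed from `c'`, then it can be completed from `c`. -/
def Machine.Reaches (𝓜 : Machine G) (c c' : Config n 𝓜.D.State) : Prop :=
  ∀ c'', Exec 𝓜.A 𝓜.D 𝓜.M 𝓜.W traverseProg c' c'' → Exec 𝓜.A 𝓜.D 𝓜.M 𝓜.W traverseProg c c''

theorem Machine.At.reaches {S : Finset (Fin n)} {j : ℕ} {c c' : Config n 𝓜.D.State}
    (h : 𝓜.At ord K S j c) (hj : j < n * 2 ^ K ∨ agree G ord S < n)
    (hx : Exec 𝓜.A 𝓜.D 𝓜.M 𝓜.W stepProg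
      { c with time := c.time + unfinished.compile.cost + 1 } c') : 𝓜.Reaches c c' := by
  intro c'' hx'
  obtain ⟨e₁, e₂, -⟩ := Ex.sound 𝓜 h.words _ (unfinished_ok (s := c.abs))
  refine .loop_true _ _ _ _ _ e₁ ?_ hx hx'
  rw [e₂]
  change unfinished.eval 𝓜.A c.abs.mem ≠ 0
  rw [h.unfinished_eval]
  rcases hj with hj | hj <;> simp [hj]

/-- Testing a candidate that does not stand for a child. -/
theorem Machine.At.step_none (hp : 𝓜.Params ord K) {S : Finset (Fin n)} {j : ℕ}
    {c : Config n 𝓜.D.State} (h : 𝓜.At ord K S j c) (hj : j < n * 2 ^ K)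
    (hT : 𝓜.A.child ord K S j = none) :
    ∃ c', 𝓜.Reaches c c' ∧ 𝓜.At ord K S (j + 1) c' ∧ c'.out = c.out ∧
      c'.time ≤ c.time + 𝓜.unit * 𝓜.testTime ord K S j := by
  have hlim := hp.lim_lt
  have hrun : Run 𝓜 stepProg c.abs ((5 * K + 39) * 𝓜.A.testCost ord K S j + (9 * K + 29))
      (fun s' => Frame (.cand :: tryVars) c.abs s' ∧ 𝓜.Holds S s' ∧ s'.mem .cand 0 = j + 1) := by
    refine Run.branch (t := (5 * K + 39) * 𝓜.A.testCost ord K S j + (9 * K + 28))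
      ⟨trivial, trivial, trivial⟩ ?_ ?_
    · intro _
      refine Run.seq (tryProg_spec hp h.env h.holds h.analysed h.isMIS h.cand hj) (t₂ := 2) ?_
      rw [hT]
      rintro s₁ ⟨F₁, h₁, h₂⟩
      have hc₁ : s₁.mem .cand 0 = j := by rw [F₁.1 .cand (by decide)]; exact h.cand
      refine Run.branch (t := 1) trivial ?_ ?_
      · intro hne
        exact absurd h₁ hne
      · intro _
        refine Run.asg (t := 0) (z := j + 1) ⟨trivial, by simp [Ex.Ok], ?_⟩
          (by simp [Ex.eval, BinOp.apply, hc₁])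
          ⟨(F₁.mono (by simp)).upd (by simp) _ _, h₂.congr rfl rfl, by simp [St.upd_mem]⟩
        simp only [BinOp.Fits, Ex.eval, hc₁]
        omega
    · intro h0
      simp only [Ex.eval, BinOp.apply, h.cand, h.env.lim, if_pos hj] at h0
      omega
  obtain ⟨c', x', w', o', t', F', hH, hc⟩ :=
    hrun { c with time := c.time + unfinished.compile.cost + 1 } rfl h.words
  refine ⟨c', h.reaches (.inl hj) x', ⟨⟨h.isMIS, w', F'.2.trans h.cur,
    h.env.frame F' (by decide), hH⟩,
    h.analysed.congr (F'.1 .fst (by decide)) (F'.1 .agr (by decide)), hc⟩, o', ?_⟩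
  have hcost := 𝓜.cost_le (e := unfinished) (by decide)
  change c'.time ≤ c.time + unfinished.compile.cost + 1 + 𝓜.unit * _ at t'
  have : 𝓜.unit * 𝓜.testTime ord K S j = 𝓜.unit *
      ((5 * K + 39) * 𝓜.A.testCost ord K S j + (9 * K + 29)) + 𝓜.unit := by
    unfold Machine.testTime; ring
  omega

/-- Testing a candidate that stands for a child. -/
theorem Machine.At.step_some (hp : 𝓜.Params ord K) {S T : Finset (Fin n)} {j : ℕ}
    {c : Config n 𝓜.D.State} (h : 𝓜.At ord K S j c) (hj : j < n * 2 ^ K)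
    (hT : 𝓜.A.child ord K S j = some T) :
    ∃ c' r, 𝓜.Reaches c c' ∧ 𝓜.At ord K T 0 c' ∧ c'.out = c.out ++ [r] ∧
      r.1.Nodup ∧ r.1.toFinset = T ∧
      r.2 ≤ c.time + 𝓜.unit * (𝓜.testTime ord K S j + (6 * 𝓜.A.degSum + 15 * n + 6)) ∧
      c'.time ≤ r.2 + 𝓜.unit := by
  have hisMIS := (AdjLists.isChild_of_child_eq_some h.isMIS hT).1.1
  let c₀ : Config n 𝓜.D.State := { c with time := c.time + unfinished.compile.cost + 1 }
  obtain ⟨e₀, e₀', -⟩ := Ex.sound 𝓜 h.words (.op .lt (.var .cand) (.var .lim))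
    ⟨trivial, trivial, trivial⟩
  let c₁ : Config n 𝓜.D.State :=
    { c₀ with time := c₀.time + (Ex.op .lt (.var .cand) (.var .lim)).compile.cost + 1 }
  have htry := tryProg_spec hp h.env h.holds h.analysed h.isMIS h.cand hj
  rw [hT] at htry
  obtain ⟨c₂, x₂, w₂, o₂, t₂, F₂, ok₂, hH₂⟩ := htry c₁ rfl h.words
  obtain ⟨e₂, e₂', -⟩ := Ex.sound 𝓜 w₂ (.var .ok) trivial
  let c₃ : Config n 𝓜.D.State :=
    { c₂ with time := c₂.time + (Ex.var .ok).compile.cost + 1 }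
  have hready : 𝓜.Ready ord K T c₃ :=
    ⟨hisMIS, w₂, F₂.2.trans h.cur, h.env.frame F₂ (by decide), hH₂⟩
  obtain ⟨c₄, r, x₄, hAt, o₄, hnd, hr, t₄, t₄'⟩ := hready.visit hp
  refine ⟨c₄, r, h.reaches (.inl hj) ?_, hAt, ?_, hnd, hr, ?_, t₄'⟩
  · refine .ite_true _ _ _ _ _ e₀ ?_ (.seq _ _ _ _ _ x₂ (.ite_true _ _ _ _ _ e₂ ?_ x₄))
    · rw [e₀']
      change (Ex.op .lt (.var .cand) (.var .lim)).eval 𝓜.A c.abs.mem ≠ 0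
      simp only [Ex.eval, BinOp.apply, h.cand, h.env.lim, if_pos hj]
      exact one_ne_zero
    · rw [e₂']
      change c₂.abs.mem .ok 0 ≠ 0
      rw [ok₂]
      exact one_ne_zero
  · rw [o₄]
    change c₂.out ++ _ = _
    rw [o₂]
  · have k₁ := 𝓜.cost_le (e := unfinished) (by decide)
    have k₂ := 𝓜.cost_le (e := .op .lt (.var .cand) (.var .lim)) (by decide)
    have k₃ := 𝓜.cost_le (e := .var .ok) (by decide)
    change c₂.time ≤ c.time + unfinished.compile.cost + 1 +
      (Ex.op .lt (.var .cand) (.var .lim)).compile.cost + 1 + 𝓜.unit * _ at t₂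
    change r.2 ≤ c₂.time + (Ex.var .ok).compile.cost + 1 + _ at t₄
    have : 𝓜.unit * (𝓜.testTime ord K S j + (6 * 𝓜.A.degSum + 15 * n + 6)) = 𝓜.unit *
      ((5 * K + 39) * 𝓜.A.testCost ord K S j + (9 * K + 26)) + 4 * 𝓜.unit +
      𝓜.unit * (6 * 𝓜.A.degSum + 15 * n + 6) := by
      unfold Machine.testTime; ring
    omega

/-- Moving to the parent. -/
theorem Machine.At.step_up (hp : 𝓜.Params ord K) {T : Finset (Fin n)}
    {c : Config n 𝓜.D.State} (h : 𝓜.At ord K T (n * 2 ^ K) c) (hlt : agree G ord T < n) :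
    ∃ c', 𝓜.Reaches c c' ∧ 𝓜.At ord K (parent G ord T) (𝓜.A.childIndex ord K T + 1) c' ∧
      c'.out = c.out ∧ c'.time ≤ c.time + 𝓜.unit * 𝓜.upTime K := by
  have hlim := hp.lim_lt
  have hidx := (AdjLists.child_childIndex (A := 𝓜.A) hp.length_le
    ⟨h.isMIS, (agree_lt_iff h.isMIS).1 hlt, rfl⟩).1
  have hrun : Run 𝓜 stepProg c.abs (17 * 𝓜.A.degSum + 23 * n + 6 * K + 17)
      (fun s' => Frame upVars c.abs s' ∧ 𝓜.Holds (parent G ord T) s' ∧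
        𝓜.Analysed ord (parent G ord T) s' ∧ s'.mem .cand 0 = 𝓜.A.childIndex ord K T + 1) := by
    refine Run.branch (t := 17 * 𝓜.A.degSum + 23 * n + 6 * K + 16)
      ⟨trivial, trivial, trivial⟩ ?_ ?_
    · intro hne
      refine absurd ?_ hne
      simp only [Ex.eval, BinOp.apply, h.cand, h.env.lim]
      exact if_neg (lt_irrefl _)
    · intro _
      refine Run.seq (upProg_spec hp h.env h.holds h.analysed h.isMIS hlt) (t₂ := 1) ?_
      rintro s₁ ⟨F₁, h₁, h₂, h₃⟩
      refine Run.asg (t := 0) (z := 𝓜.A.childIndex ord K T + 1) ⟨trivial, by simp [Ex.Ok], ?_⟩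
        (by simp [Ex.eval, BinOp.apply, h₃])
        ⟨F₁.upd (by decide) _ _, h₁.congr rfl rfl, h₂.congr rfl rfl, by simp [St.upd_mem]⟩
      simp only [BinOp.Fits, Ex.eval, h₃]
      omega
  obtain ⟨c', x', w', o', t', F', hH, hA, hc⟩ :=
    hrun { c with time := c.time + unfinished.compile.cost + 1 } rfl h.words
  refine ⟨c', h.reaches (.inr hlt) x', ⟨⟨isMIS_parent h.isMIS, w', F'.2.trans h.cur,
    h.env.frame F' (by decide), hH⟩, hA, hc⟩, o', ?_⟩
  have hcost := 𝓜.cost_le (e := unfinished) (by decide)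
  change c'.time ≤ c.time + unfinished.compile.cost + 1 + 𝓜.unit * _ at t'
  have : 𝓜.unit * 𝓜.upTime K = 𝓜.unit * (17 * 𝓜.A.degSum + 23 * n + 6 * K + 17) + 𝓜.unit := by
    unfold Machine.upTime; ring
  omega

/-- The children of `S` whose numbers are at least `j`. -/
noncomputable def AdjLists.childrenFrom (A : AdjLists G) (ord : VertexOrder n) (K : ℕ)
    (S : Finset (Fin n)) (j : ℕ) : List (Finset (Fin n)) :=
  (List.range' j (n * 2 ^ K - j)).filterMap (A.child ord K S)

theorem AdjLists.childrenFrom_of_lt (A : AdjLists G) (S : Finset (Fin n)) {j : ℕ}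
    (hj : j < n * 2 ^ K) : A.childrenFrom ord K S j =
      (A.child ord K S j).toList ++ A.childrenFrom ord K S (j + 1) := by
  unfold AdjLists.childrenFrom
  rw [show n * 2 ^ K - j = (n * 2 ^ K - (j + 1)) + 1 by omega, List.range'_succ,
    List.filterMap_cons]
  cases A.child ord K S j <;> rfl

theorem AdjLists.childrenFrom_zero (A : AdjLists G) (hK : ∀ v, (A.late ord v).length ≤ K)
    {S : Finset (Fin n)} (hS : IsMIS G S) : (A.childrenFrom ord K S 0).Nodup ∧
      ∀ T, T ∈ A.childrenFrom ord K S 0 ↔ IsChild G ord T S := by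
  constructor
  · refine List.Nodup.filterMap ?_ (List.nodup_range' (step := 1))
    intro i j T hi hj
    exact (AdjLists.isChild_of_child_eq_some hS hi).2.symm.trans
      (AdjLists.isChild_of_child_eq_some hS hj).2
  · intro T
    simp only [AdjLists.childrenFrom, List.mem_filterMap]
    constructor
    · rintro ⟨j, -, hj⟩
      exact (AdjLists.isChild_of_child_eq_some hS hj).1
    · intro hT
      obtain ⟨h₁, h₂⟩ := AdjLists.child_childIndex hK hT
      exact ⟨_, by simpa using h₁, h₂⟩

/-- The traversal of the subtrees of the remaining children of `S` lists their nodes in preorder,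
and returns to `S`.  The time for testing the candidates of `S` that are left is counted separately;
all other time is charged to the sets that are output.  The proof is by induction on the position of
the first defect, which is smaller for children, and on the number of candidates left. -/
theorem Machine.At.traverse (hp : 𝓜.Params ord K) {d : ℕ}
    (hd : 𝓜.delay K ≤ d) {S : Finset (Fin n)} {j : ℕ} {c : Config n 𝓜.D.State}
    (h : 𝓜.At ord K S j c) (hj : j ≤ n * 2 ^ K)
    (hc : 𝓜.Punctual d (𝓜.potential ord K S j) c) :
    ∃ c' o, 𝓜.Reaches c c' ∧ 𝓜.At ord K S (n * 2 ^ K) c' ∧ c'.out = c.out ++ o ∧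
      𝓜.Punctual d (𝓜.potential ord K S (n * 2 ^ K)) c' ∧ (∀ r ∈ o, r.1.Nodup) ∧
      ForestPreorder (IsChild G ord) (𝓜.A.childrenFrom ord K S j)
        (o.map fun r => r.1.toFinset) ∧
      c'.time ≤ c.time + 𝓜.unit * (∑ i ∈ Ico j (n * 2 ^ K), 𝓜.testTime ord K S i +
        o.length * 𝓜.nodeTime K) := by
  induction hm : agree G ord S using Nat.strong_induction_on generalizing S j c with
  | _ m ihm =>
  induction hi : n * 2 ^ K - j generalizing j c with
  | zero =>
    have : j = n * 2 ^ K := by omega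
    subst this
    refine ⟨c, [], fun _ h => h, h, by simp, hc, by simp, ?_, by simp⟩
    simp only [AdjLists.childrenFrom, Nat.sub_self, List.range'_zero, List.filterMap_nil,
      List.map_nil]
    exact .nil
  | succ i ihi =>
    have hjl : j < n * 2 ^ K := by omega
    have hsum := Finset.sum_eq_sum_Ico_succ_bot hjl (fun i => 𝓜.testTime ord K S i)
    have hch := 𝓜.A.childrenFrom_of_lt (ord := ord) S hjl
    have hpot : 𝓜.potential ord K S (j + 1) =
        𝓜.potential ord K S j + 𝓜.testTime ord K S j := by
      simp only [Machine.potential, sum_range_succ]; ring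
    cases hT : 𝓜.A.child ord K S j with
    | none =>
      obtain ⟨c₁, r₁, h₁, o₁, t₁⟩ := h.step_none hp hjl hT
      obtain ⟨c₂, o, r₂, h₂, o₂, p₂, n₂, f₂, t₂⟩ :=
        ihi h₁ hjl (hc.wait o₁ t₁ hpot.ge) (by omega)
      rw [hT, Option.toList_none, List.nil_append] at hch
      refine ⟨c₂, o, fun _ hx => r₁ _ (r₂ _ hx), h₂, by rw [o₂, o₁], p₂, n₂, by rwa [hch], ?_⟩
      rw [hsum]
      simp only [mul_add] at t₂ ⊢
      omega
    | some T =>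
      obtain ⟨hchild, hindex⟩ := AdjLists.isChild_of_child_eq_some h.isMIS hT
      obtain ⟨hTM, hTne, hTS⟩ := hchild
      have hTlt := (agree_lt_iff (ord := ord) hTM).2 hTne
      have hTag := agree_lt_agree_parent (ord := ord) hTM hTlt
      rw [hTS] at hTag
      obtain ⟨c₁, r, r₁, h₁, o₁, hrn, hrT, t₁, t₁'⟩ := h.step_some hp hjl hT
      have hp₁ : 𝓜.Punctual d (𝓜.potential ord K T 0) c₁ := by
        have hle := 𝓜.potential_le (ord := ord) (S := S) (K := K) (j := j + 1) hjl
        refine (hc.output o₁ t₁ ?_ t₁').wait rfl (t := 0) (by simp) ?_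
        · unfold Machine.delay Machine.nodeTime Machine.visitTime at hd
          omega
        · simp only [Machine.potential]; omega
      obtain ⟨c₂, os, r₂, h₂, o₂, p₂, n₂, f₂, t₂⟩ :=
        ihm _ (hm ▸ hTag) h₁ (Nat.zero_le _) hp₁ rfl
      -- After the traversal of the subtree of `T`, the next step leads back to `S`, where the
      -- search continues with the candidate after `T`.
      obtain ⟨c₃, r₃, h₃, o₃, t₃⟩ := h₂.step_up hp hTlt
      rw [hTS, hindex] at h₃
      -- As `agree` increases, the time that has been spent at `T` is covered by the potential.
      have hp₃ : 𝓜.Punctual d (𝓜.potential ord K S (j + 1)) c₃ := by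
        refine p₂.wait o₃ t₃ ?_
        have h₁ := 𝓜.sum_testTime_le (K := K) ord T
        have h₂ := Nat.mul_le_mul_right (𝓜.searchTime K + 𝓜.upTime K)
          (Nat.succ_le_of_lt hTag)
        rw [Nat.succ_eq_add_one, add_mul, one_mul] at h₂
        unfold Machine.potential
        omega
      obtain ⟨c₄, o, r₄, h₄, o₄, p₄, n₄, f₄, t₄⟩ := ihi h₃ hjl hp₃ (by omega)
      rw [hT, Option.toList_some, List.singleton_append] at hch
      refine ⟨c₄, r :: (os ++ o), fun _ hx => r₁ _ (r₂ _ (r₃ _ (r₄ _ hx))), h₄,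
        by rw [o₄, o₃, o₂, o₁]; simp, p₄, ?_, ?_, ?_⟩
      · simp only [List.mem_cons, List.mem_append]
        rintro x (rfl | hx | hx)
        · exact hrn
        · exact n₂ x hx
        · exact n₄ x hx
      · rw [hch, List.map_cons, List.map_append, hrT]
        obtain ⟨g₁, g₂⟩ := 𝓜.A.childrenFrom_zero hp.length_le hTM
        exact .cons g₁ g₂ f₂ f₄
      · have h₁ := 𝓜.sum_testTime_le (K := K) ord T
        rw [hsum]
        rw [← Finset.range_eq_Ico] at t₂
        have hmul := Nat.mul_le_mul_left 𝓜.unit h₁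
        have hnode : 𝓜.unit * 𝓜.nodeTime K = 𝓜.unit * 𝓜.searchTime K +
            𝓜.unit * (6 * 𝓜.A.degSum + 15 * n + 6) + 𝓜.unit + 𝓜.unit * 𝓜.upTime K := by
          unfold Machine.nodeTime Machine.visitTime; ring
        simp only [List.length_cons, List.length_append, add_mul, one_mul] at t₁ t₂ t₄ ⊢
        simp only [mul_add] at t₁ t₂ t₄ ⊢ hnode
        omega

end


/-! ### The resources used by the algorithm -/

section

variable {n : ℕ} {G : SimpleGraph (Fin n)} {𝓜 : Machine G}

/-- A bound for the time until the first set is visited. -/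
def Machine.setupTime (𝓜 : Machine G) (k : ℕ) : ℕ :=
  20 * 𝓜.A.degSum + 30 * n + (k + 1) * (7 * n + 8) + 13

/-- The current set is at first empty, so that the greedy construction turns it into the root. -/
theorem setup_spec {k : ℕ} (hG : IsDegenerate G k)
    (hp : ∀ (ord : VertexOrder n) (K : ℕ), K ≤ k + 1 → (∀ v, (𝓜.A.late ord v).length ≤ K) →
      𝓜.Params ord K) (hnX : n < 𝓜.X) (hkW : k + 1 < 𝓜.W) {s : St n 𝓜.D.State}
    (hs : ∀ a x, s.mem a x = 0) (hd : 𝓜.D.toSet s.dom = ∅) :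
    Run 𝓜 (peelProg ;; tableProg ;; greedyProg) s (𝓜.setupTime k) (fun s' => s'.cur = s.cur ∧
      ∃ (ord : VertexOrder n) (K : ℕ), K ≤ k + 1 ∧ 𝓜.Params ord K ∧ 𝓜.Env ord K s' ∧
      𝓜.Holds (lfmis G ord) s') := by
  refine Run.seq (peelProg_spec hG hnX hkW hs)
    (t₂ := 11 * 𝓜.A.degSum + 21 * n + 3 * (k + 1) + 10) ?_
    (by unfold Machine.setupTime; simp only [mul_add]; omega)
  rintro s₁ ⟨F₁, d₁, ord, K, hK, hlate, hdgn, hord⟩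
  have hpK := hp ord K hK hlate
  refine Run.seq (tableProg_spec hpK hdgn hord) (t₂ := 5 * 𝓜.A.degSum + 12 * n + 2) ?_
  rintro s₂ ⟨F₂, d₂, hE⟩
  have hH : 𝓜.Holds ∅ s₂ := by
    refine ⟨fun v => ?_, by rw [d₂, d₁, hd]⟩
    rw [F₂.1 .st (by decide), F₁.1 .st (by decide), hs]
    simp
  refine (greedyProg_spec hpK hE hH).imp ?_
  rintro s₃ ⟨hH₃, F₃⟩
  exact ⟨F₃.2.trans (F₂.2.trans F₁.2), ord, K, hK, hpK, hE.frame F₃ (by decide), hH₃⟩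

/-- The algorithm visits the sets in the order of a reverse search.  Its total time is bounded by a
multiple of the number of sets; the time for setting up is charged to the root. -/
theorem listProg_spec {k : ℕ} (hG : IsDegenerate G k)
    (hp : ∀ (ord : VertexOrder n) (K : ℕ), K ≤ k + 1 → (∀ v, (𝓜.A.late ord v).length ≤ K) →
      𝓜.Params ord K) (hnX : n < 𝓜.X) (hkW : k + 1 < 𝓜.W) :
    ∃ (c : Config n 𝓜.D.State) (ord : VertexOrder n) (K : ℕ), K ≤ k + 1 ∧
      (∀ v, (𝓜.A.late ord v).length ≤ K) ∧
      Exec 𝓜.A 𝓜.D 𝓜.M 𝓜.W listProg (Config.start 𝓜.D) c ∧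
      (∀ r ∈ c.out, r.1.Nodup) ∧ c.cur = [] ∧ IsReverseSearch G ord c.sets ∧
      c.time ≤ 𝓜.unit * (c.out.length * (𝓜.setupTime k + 𝓜.nodeTime K + 1)) ∧
      c.HasDelay (𝓜.unit * (𝓜.setupTime k + 𝓜.delay K)) := by
  have hW := 𝓜.hW
  obtain ⟨c₁, x₁, w₁, o₁, t₁, hcur₁, ord, K, hK, hpK, hE, hH⟩ :=
    setup_spec hG hp hnX hkW (s := (Config.start 𝓜.D).abs) (fun _ _ => rfl) 𝓜.D.toSet_init
      (Config.start 𝓜.D) rfl (fun _ => by simp only [Config.start]; omega)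
  have hready : 𝓜.Ready ord K (lfmis G ord) c₁ := ⟨isMIS_lfmis, w₁, hcur₁, hE, hH⟩
  obtain ⟨c₂, r, x₂, hAt, o₂, hrn, hrS, t₂, t₂'⟩ := hready.visit hpK
  have hout₂ : c₂.out = [r] := by rw [o₂, o₁]; rfl
  have hp₁ : 𝓜.Punctual (𝓜.setupTime k + 𝓜.delay K) (𝓜.setupTime k) c₁ := by
    have hout₁ : c₁.out = [] := o₁
    constructor
    · rw [hout₁]; exact List.isChain_singleton _
    · simp only [hout₁, List.map_nil, List.getLast_singleton]
      exact t₁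
  have hp₂ : 𝓜.Punctual (𝓜.setupTime k + 𝓜.delay K) (𝓜.potential ord K (lfmis G ord) 0) c₂ := by
    refine (hp₁.output o₂ t₂ ?_ t₂').wait rfl (t := 0) (by simp) ?_
    · unfold Machine.delay Machine.nodeTime Machine.visitTime; omega
    · simp only [Machine.potential]; omega
  obtain ⟨c₃, o, r₃, hAt₃, o₃, p₃, n₃, f₃, t₃⟩ :=
    hAt.traverse hpK (d := 𝓜.setupTime k + 𝓜.delay K) (by omega) (Nat.zero_le _) hp₂
  have hroot : ¬ agree G ord (lfmis G ord) < n := by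
    rw [agree_lt_iff isMIS_lfmis]
    exact fun h => h rfl
  obtain ⟨e₁, e₂, -⟩ := Ex.sound 𝓜 hAt₃.words _ (unfinished_ok (s := c₃.abs))
  have x₄ : Exec 𝓜.A 𝓜.D 𝓜.M 𝓜.W traverseProg c₃
      { c₃ with time := c₃.time + unfinished.compile.cost + 1 } := by
    refine .loop_false _ _ _ e₁ ?_
    rw [e₂]
    change unfinished.eval 𝓜.A c₃.abs.mem = 0
    rw [hAt₃.unfinished_eval, if_neg (lt_irrefl _), if_neg hroot]
  have hcost := 𝓜.cost_le (e := unfinished) (by decide)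
  have hout₃ : c₃.out = r :: o := by rw [o₃, hout₂]; rfl
  refine ⟨_, ord, K, hK, hpK.length_le,
    .seq _ _ _ _ _ x₁ (.seq _ _ _ _ _ x₂ (r₃ _ x₄)), ?_, hAt₃.cur, ?_, ?_, ?_⟩
  · change ∀ r ∈ c₃.out, _
    rw [hout₃, List.forall_mem_cons]
    exact ⟨hrn, n₃⟩
  · change ForestPreorder _ _ (c₃.out.map fun r => r.1.toFinset)
    obtain ⟨g₁, g₂⟩ := 𝓜.A.childrenFrom_zero (ord := ord) hpK.length_le isMIS_lfmis
    have := ForestPreorder.cons g₁ g₂ f₃ .nil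
    rw [hout₃, List.map_cons, hrS]
    rwa [List.append_nil] at this
  · -- The root is charged for the setup, for its own visit and tests, and for the last evaluation
    -- of the condition of the loop.
    change c₃.time + unfinished.compile.cost + 1 ≤ 𝓜.unit * (c₃.out.length * _)
    rw [hout₃, List.length_cons]
    have hsum := Nat.mul_le_mul_left 𝓜.unit (𝓜.sum_testTime_le (K := K) ord (lfmis G ord))
    rw [← Finset.range_eq_Ico] at t₃
    change c₁.time ≤ 0 + 𝓜.unit * _ at t₁
    have hnode : 𝓜.unit * 𝓜.nodeTime K = 𝓜.unit * 𝓜.searchTime K +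
        𝓜.unit * (6 * 𝓜.A.degSum + 15 * n + 6) + 𝓜.unit + 𝓜.unit * 𝓜.upTime K := by
      unfold Machine.nodeTime Machine.visitTime; ring
    have hle : 𝓜.unit * (o.length * 𝓜.nodeTime K) ≤
        𝓜.unit * (o.length * (𝓜.setupTime k + 𝓜.nodeTime K + 1)) := by
      gcongr; omega
    simp only [add_mul, one_mul, mul_add] at t₁ t₂ t₃ hnode hsum hle ⊢
    omega
  · have hlast := p₃.time_le
    have hpot := 𝓜.potential_le (ord := ord) (S := lfmis G ord) (K := K) le_rfl
    change (0 :: (c₃.out.map Prod.snd ++ [c₃.time + unfinished.compile.cost + 1])).IsChain _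
    rw [← List.cons_append, List.isChain_append]
    refine ⟨p₃.isChain, List.isChain_singleton _, ?_⟩
    intro x hx y hy
    rw [List.getLast?_eq_some_getLast (by simp), Option.mem_some_iff] at hx
    simp only [List.head?_cons, Option.mem_some_iff] at hy
    subst hx hy
    have hmul : 𝓜.unit * (𝓜.potential ord K (lfmis G ord) (n * 2 ^ K) + 1) ≤
        𝓜.unit * (𝓜.setupTime k + 𝓜.delay K) := by
      refine Nat.mul_le_mul_left _ ?_
      unfold Machine.delay Machine.nodeTime
      omega
    rw [mul_add, mul_one] at hmul
    omega

/-- The time for setting up and for one set is at most this number times `n + 1`, where `k` is a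
bound for the degeneracy and `q = k + 1`. -/
def timeConstant (q : ℕ) : ℕ :=
  ((5 * q + 39) * 2 ^ q + 43) * (2 * q) + (5 * q + 39) * 2 ^ q + 2 ^ q * (9 * q + 30) +
    21 * q + 120

theorem setupTime_add_nodeTime_le {k K : ℕ} {ord : VertexOrder n} (hK : K ≤ k + 1)
    (hlate : ∀ v, (𝓜.A.late ord v).length ≤ K) :
    𝓜.setupTime k + 𝓜.nodeTime K + 2 ≤ timeConstant (k + 1) * (n + 1) := by
  obtain ⟨q, hq⟩ : ∃ q, q = k + 1 := ⟨_, rfl⟩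
  rw [← hq] at hK ⊢
  have hdeg : 𝓜.A.degSum ≤ 2 * q * n :=
    AdjLists.sum_length_nbrs_le fun v => (hlate v).trans hK
  have hpow : 2 ^ K ≤ 2 ^ q := Nat.pow_le_pow_right (by norm_num) hK
  have hsearch : 𝓜.searchTime K ≤
      (5 * q + 39) * (2 ^ q * (2 * q * n + n)) + n * 2 ^ q * (9 * q + 30) := by
    unfold Machine.searchTime
    gcongr
  have hsetup : 𝓜.setupTime k ≤ 20 * (2 * q * n) + 30 * n + q * (7 * n + 8) + 13 := by
    unfold Machine.setupTime
    rw [← hq]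
    gcongr
  have hvisit : 𝓜.visitTime ≤ 6 * (2 * q * n) + 15 * n + 7 := by
    unfold Machine.visitTime
    gcongr
  have hup : 𝓜.upTime K ≤ 17 * (2 * q * n) + 23 * n + 6 * q + 18 := by
    unfold Machine.upTime
    gcongr
  unfold Machine.nodeTime
  refine le_trans (Nat.add_le_add_right (Nat.add_le_add hsetup
    (Nat.add_le_add (Nat.add_le_add hsearch hvisit) hup)) 2) ?_
  unfold timeConstant
  obtain ⟨b, hb⟩ : ∃ b, b = 2 ^ q := ⟨_, rfl⟩
  rw [← hb]
  nlinarith [Nat.zero_le (q * b), Nat.zero_le (q * q * b), Nat.zero_le (q * n),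
    Nat.zero_le (q * b * n), Nat.zero_le (b * n)]

end

end MISListing


/-- There is one program that lists all maximal independent sets of every graph by reverse search,
with the following bounds, whose constants depend only on the degeneracy `k`: on `n`-vertex
`k`-degenerate graphs with a dominance structure that takes time `T n` per operation it uses
`O(n)` memory cells with words of `O(log n)` bits (besides the one dominance structure), it takes
time `O(n * T n)` per listed set, and its delay is at most a polynomial in `n` times `T n`. -/
theorem mainTheorem5 :
    ∃ P : MISListing.Prog, ∀ k : ℕ, ∃ (C : ℕ) (p : Polynomial ℕ),
      ∀ (T : ℕ → ℕ) (n : ℕ) (G : SimpleGraph (Fin n)), MISListing.IsDegenerate G k →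
      ∀ (A : MISListing.AdjLists G) (D : MISListing.DominanceStructure G),
        D.RunsInTime (T n) →
        ∃ c : MISListing.Config n D.State,
          MISListing.Exec A D (C * (n + 1)) ((n + 2) ^ C) P (MISListing.Config.start D) c ∧
          c.ListsAllMIS G ∧
          (∃ ord : MISListing.VertexOrder n, MISListing.IsReverseSearch G ord c.sets) ∧
          c.time ≤ C * (n + 1) * T n * c.out.length ∧
          c.HasDelay (p.eval n * T n) := by
  refine ⟨MISListing.listProg, fun k => ?_⟩
  -- The constant `C` is large enough for three purposes.  The time per set is at most `64 * T n`
  -- times `Z * (n + 1)`.  The arrays, with at most `(q + 1) * (n + 1)` entries, occupy `32` times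
  -- as many cells.  Words must hold addresses, numbers of candidates, and the literals of the
  -- program.
  let q := k + 1
  let Z := MISListing.timeConstant q
  let C := 64 * Z + 32 * (q + 1) + 8
  refine ⟨C, .C (64 * Z) * (.X + 1) ^ 2, fun T n G hG A D hD => ?_⟩
  -- The bounds for words have to hold for `n = 0`, too, where `(n + 2) ^ C` is `2 ^ C`.
  have hqC : q + 8 ≤ C := by omega
  have hpowC : 2 ^ (q + 8) ≤ (n + 2) ^ C :=
    (Nat.pow_le_pow_right (by norm_num) hqC).trans (Nat.pow_le_pow_left (by omega) _)
  have hbase : (n + 2) * 2 ^ (C - 1) ≤ (n + 2) ^ C := by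
    obtain ⟨e, he⟩ : ∃ e, C = e + 1 := ⟨C - 1, by omega⟩
    rw [he, Nat.add_sub_cancel, pow_succ, mul_comm]
    exact Nat.mul_le_mul_right _ (Nat.pow_le_pow_left (by omega) _)
  have hCpow : C ≤ 2 ^ (C - 1) := by
    have := Nat.lt_two_pow_self (n := C - 1)
    omega
  have hMW : C * (n + 1) ≤ (n + 2) ^ C := by
    refine le_trans ?_ hbase
    rw [mul_comm]
    exact Nat.mul_le_mul (by omega) hCpow
  have hCW : C ≤ (n + 2) ^ C := le_trans (Nat.le_mul_of_pos_right _ (by omega)) hMW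
  have h64 : 64 ≤ (n + 2) ^ C := by
    refine le_trans ?_ hpowC
    rw [pow_add]
    have : 1 ≤ 2 ^ q := Nat.one_le_two_pow
    omega
  have hlim : n * 2 ^ q < (n + 2) ^ C := by
    refine lt_of_lt_of_le ?_ hbase
    have h₁ : 2 ^ q ≤ 2 ^ (C - 1) := Nat.pow_le_pow_right (by norm_num) (by omega)
    have h₂ : 0 < 2 ^ (C - 1) := by positivity
    nlinarith
  have hnW : n < (n + 2) ^ C := by
    have : 1 ≤ 2 ^ q := Nat.one_le_two_pow
    exact lt_of_le_of_lt (Nat.le_mul_of_pos_right _ this) hlim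
  let 𝓜 : MISListing.Machine G :=
    { A := A
      D := D
      M := C * (n + 1)
      W := (n + 2) ^ C
      X := (q + 1) * (n + 1)
      τ := T n
      runs := hD
      hX := Nat.mul_pos (by omega) (by omega)
      hXM := by
        rw [← mul_assoc]
        exact Nat.mul_le_mul_right _ (by omega)
      hMW := hMW
      hnW := hnW
      hW := h64 }
  have hnX : n < 𝓜.X := by
    change n < (q + 1) * (n + 1)
    nlinarith
  have hparams : ∀ (ord : MISListing.VertexOrder n) (K : ℕ), K ≤ k + 1 →
      (∀ v, (𝓜.A.late ord v).length ≤ K) → 𝓜.Params ord K := by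
    intro ord K hK hlate
    have hpow : 2 ^ K ≤ 2 ^ q := Nat.pow_le_pow_right (by norm_num) hK
    refine ⟨hlate, hnX, ?_, ?_, ?_, ?_, ?_⟩
    · change n * K < (q + 1) * (n + 1)
      have : n * K ≤ n * q := Nat.mul_le_mul_left _ hK
      nlinarith
    · change K < (q + 1) * (n + 1)
      have : K ≤ q := hK
      nlinarith
    · change K < (n + 2) ^ C
      have : K ≤ q := hK
      omega
    · change 2 * 2 ^ K < (n + 2) ^ C
      refine lt_of_lt_of_le ?_ hpowC
      rw [pow_add]
      have : 1 ≤ 2 ^ q := Nat.one_le_two_pow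
      omega
    · exact lt_of_le_of_lt (Nat.mul_le_mul_left _ hpow) hlim
  obtain ⟨c, ord, K, hK, hlate, hexec, hnd, hcur, hrev, htime, hdelay⟩ :=
    MISListing.listProg_spec (𝓜 := 𝓜) hG hparams hnX
      (by change k + 1 < (n + 2) ^ C; omega)
  have hZ : 𝓜.setupTime k + 𝓜.nodeTime K + 2 ≤ Z * (n + 1) :=
    MISListing.setupTime_add_nodeTime_le hK hlate
  refine ⟨c, hexec, ⟨hnd, hcur, hrev.nodup_and_mem_iff⟩, ⟨ord, hrev⟩, htime.trans ?_, ?_⟩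
  · change 64 * T n * (c.out.length * (𝓜.setupTime k + 𝓜.nodeTime K + 1)) ≤ _
    calc 64 * T n * (c.out.length * (𝓜.setupTime k + 𝓜.nodeTime K + 1))
        ≤ 64 * T n * (c.out.length * (Z * (n + 1))) := by gcongr; omega
      _ = 64 * Z * (n + 1) * T n * c.out.length := by ring
      _ ≤ C * (n + 1) * T n * c.out.length := by gcongr; omega
  · refine List.IsChain.imp (fun t t' h => h.trans (Nat.add_le_add_left ?_ _)) hdelay
    change 64 * T n * (𝓜.setupTime k + 𝓜.delay K) ≤ _
    have hle : 𝓜.setupTime k + 𝓜.delay K ≤ (n + 1) * (Z * (n + 1)) := by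
      unfold MISListing.Machine.delay
      have : 𝓜.searchTime K + 𝓜.upTime K ≤ Z * (n + 1) := by
        unfold MISListing.Machine.nodeTime at hZ
        omega
      have := Nat.mul_le_mul_left n this
      rw [add_mul, one_mul]
      omega
    calc 64 * T n * (𝓜.setupTime k + 𝓜.delay K)
        ≤ 64 * T n * ((n + 1) * (Z * (n + 1))) := by gcongr
      _ = _ := by simp; ring
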